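/- Let $d\ge 2$ be an integer and $p>1$ real. For $x,y\in\mathbb R^d$ and $A\subset\mathbb R^d$ let $L(x,y;A)$ be the power-weighted shortest path length from $x$ to $y$ through $A\cup\{x,y\}$, i.e. the infimum of $\sum_{i=0}^{k-1}|\pi_i-\pi_{i+1}|^p$ over all finite paths $x=\pi_0,\pi_1,\dots,\pi_k=y$ with nodes in $A\cup\{x,y\}$. There is a constant $C(d,p)>0$, depending only on $d$ and $p$, with the following two properties. (1) $C(d,p)$ is the constant of the homogeneous Poisson model: if $\mathcal H_1$ is a homogeneous Poisson point process of intensity $1$ in $\mathbb R^d$ and $e$ is a unit vector, then $\lim_{t\to\infty}\frac1t\,\mathbb E\,L(0,te;\mathcal H_1)=C(d,p)$. (2) Let $z\in\mathbb R^d$, $R_2>R_1>0$ and $\alpha=(d+2p)^{-1}$. Let $X_1,X_2,\dots$ be i.i.d. with the uniform density $f=|B(z;R_2)|^{-1}\mathbf 1_{B(z;R_2)}$ on the open ball $B(z;R_2)$, and put $L_n(x,y)=L(x,y;\{X_1,\dots,X_n\})$. Let $x_n,y_n$ be sequences in $B(z;R_1)$ satisfying $\liminf_{n}(nf(z))^\alpha|x_n-y_n|=+\infty$.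 Fix $\varepsilon>0$ and let $E_n$ be the event that $$\left|\frac{L_n(x_n,y_n)}{(nf(z))^{(1-p)/d}\,|x_n-y_n|}-C(d,p)\right|\le\varepsilon .$$ Then, with $\log 0=-\infty$, $$\limsup_{n\to\infty}\frac{1}{(nf(z))^\alpha|x_n-y_n|}\log\bigl(1-\Pr(E_n)\bigr)<0 .$$ -/

import Mathlib

open MeasureTheory ProbabilityTheory Filter Topology

/-- The power-weighted shortest path length `L(x, y; A)`: the infimum, over all finite paths
`x = π 0 → π 1 → ⋯ → π k = y` whose nodes lie in `A ∪ {x, y}`, of the sum of the edge weights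
`|π i - π (i + 1)| ^ p`. The direct path `x → y` is always admissible. -/
noncomputable def shortestPathLength {d : ℕ} (p : ℝ) (x y : EuclideanSpace ℝ (Fin d))
    (A : Set (EuclideanSpace ℝ (Fin d))) : ℝ :=
  sInf {s : ℝ | ∃ (k : ℕ) (π : ℕ → EuclideanSpace ℝ (Fin d)),
    π 0 = x ∧ π k = y ∧ (∀ i ≤ k, π i ∈ A ∪ {x, y}) ∧
    s = ∑ i ∈ Finset.range k, dist (π i) (π (i + 1)) ^ p}

/-- The uniform probability density on the open ball `B(z; R)`. -/
noncomputable def uniformBallDensity {d : ℕ} (z : EuclideanSpace ℝ (Fin d)) (R : ℝ) :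
    EuclideanSpace ℝ (Fin d) → ℝ :=
  (Metric.ball z R).indicator (fun _ => 1 / (volume (Metric.ball z R)).toReal)

/-- The first `n` points of a sequence of random points, as a random set. -/
def sampleSet {d : ℕ} {Ω : Type*} (X : ℕ → Ω → EuclideanSpace ℝ (Fin d)) (n : ℕ) (ω : Ω) :
    Set (EuclideanSpace ℝ (Fin d)) :=
  {u | ∃ i < n, X i ω = u}

/-- `X 0, X 1, …` are i.i.d. random points with probability density `f` with respect to Lebesgue
measure. -/
structure IsIIDWithDensity {d : ℕ} {Ω : Type*} [MeasurableSpace Ω] (P : Measure Ω)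
    (X : ℕ → Ω → EuclideanSpace ℝ (Fin d)) (f : EuclideanSpace ℝ (Fin d) → ℝ) : Prop where
  measurable : ∀ i, Measurable (X i)
  law : ∀ i, P.map (X i) = volume.withDensity (fun u => ENNReal.ofReal (f u))
  indep : iIndepFun X P

/-- `H` is a homogeneous Poisson point process in `ℝ^d` of intensity `lam`: the number of points
in a Borel set `B` of finite volume is a Poisson random variable with mean `lam * volume B`, and
the numbers of points in disjoint Borel sets are independent. -/
structure IsPoissonPointProcess {d : ℕ} {Ω : Type*} [MeasurableSpace Ω] (P : Measure Ω)
    (H : Ω → Set (EuclideanSpace ℝ (Fin d))) (lam : NNReal) : Prop where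
  ae_finite : ∀ B : Set (EuclideanSpace ℝ (Fin d)), MeasurableSet B → volume B < ⊤ →
    ∀ᵐ ω ∂P, (H ω ∩ B).Finite
  measurable_count : ∀ B : Set (EuclideanSpace ℝ (Fin d)), MeasurableSet B → volume B < ⊤ →
    Measurable (fun ω => (H ω ∩ B).ncard)
  law_count : ∀ B : Set (EuclideanSpace ℝ (Fin d)), MeasurableSet B → volume B < ⊤ →
    P.map (fun ω => (H ω ∩ B).ncard) = poissonMeasure (lam * (volume B).toNNReal)
  indep_count : ∀ (m : ℕ) (B : Fin m → Set (EuclideanSpace ℝ (Fin d))),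
    (∀ j, MeasurableSet (B j) ∧ volume (B j) < ⊤) → Pairwise (fun i j => Disjoint (B i) (B j)) →
    iIndepFun (fun j ω => (H ω ∩ B j).ncard) P

/-! After dilation by `s = (n f(z))^(1/d)`, a Poisson(`n`) number of sample points has the law of
the unit Poisson process restricted to the dilated ball (`map_scaledSample`). The Poisson number
equals `n` with probability at least `1/(e n)`, so fixing the sample size costs only a factor `e n`
(`measureReal_scaledSample_le`). Everything thus reduces to deviations of `L/t` from `C` for the
Poisson process at distance `t = s |x_n - y_n|`, with rate `t ^ β`, `β = d/(d+2p)`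
(`large_deviation`). The rates match: `t ^ β = (n f(z)) ^ α |x_n - y_n| ^ β`, and `|x_n - y_n|` is
bounded with `β ≤ 1`. The growth hypothesis makes `n` polynomial in `t`, so the factor `e n` is
absorbed.

Upper tail (`upper_tail_of_block`). Place points at a fixed spacing `r` on the segment and join
consecutive ones by local shortest paths, replacing each point by a nearby Poisson point. Truncate
the block costs at scale `N ≈ t^(1/(d+2p))`. The truncation is harmless unless some ball of radius
`N` is empty, which has probability `exp(-c N^d)`. The block costs are of order at most `N^p`, and
those `4N` apart are independent, so a Chernoff bound gives `exp(-c t / N^(p+1))`. Since `p > 1`,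
both rates are at least of order `t ^ β`. The block length only has to make the normalized mean
nearly minimal, so the estimate holds above the liminf of `E L / t`. Fed back into the means, it
shows that the limit `C` exists (`exists_tendsto_meanLength_div`).

Lower tail (`lower_tail_of_cheapCrossing`). Coarse-grain a path into a self-avoiding chain of
lattice cells, one step per exit from a ball of radius `r`. A step costs about `κ` per unit length
unless the ball around its cell has a cheap crossing, so a path cheaper than `(1 - ε) κ t` meets a
positive density of such balls. Distant balls are independent, and a Peierls sum over chains gives a
bound exponential in `t`, provided a cheap crossing has probability below a threshold depending only
on `d` and `ε`. This is used twice. With `r` tiny the ball is usually empty, which gives `C > 0`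
(`timeConstant_pos`). With `r` large and `κ` close to `C`, a cheap crossing is unlikely because
convergence of the means and the upper tail control the lower tail in probability
(`eventually_measure_cheapCrossing_le`). This gives `lower_tail`. -/

/-- Points of the Euclidean space `ℝ^d`. -/
abbrev Pt (d : ℕ) := EuclideanSpace ℝ (Fin d)

/-! ### An elementary inequality for powers of sums. -/

section Inequalities

/-- Either `b` is small compared with `a`, and the factor `1 + δ` absorbs it, or `a` is at most a
multiple of `b`. This prices the displacement of an endpoint: a factor near `1` on the edge, plus a
multiple of the displacement to the power `p`. -/
theorem exists_add_rpow_le {p : ℝ} (hp : 0 < p) {δ : ℝ} (hδ : 0 < δ) :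
    ∃ K : ℝ, 1 ≤ K ∧ ∀ a b : ℝ, 0 ≤ a → 0 ≤ b →
      (a + b) ^ p ≤ (1 + δ) * a ^ p + K * b ^ p := by
  set θ : ℝ := (1 + δ) ^ (1 / p) - 1 with hθ
  have hθ0 : 0 < θ := by
    have : 1 < (1 + δ) ^ (1 / p) := Real.one_lt_rpow (by linarith) (by positivity)
    linarith
  have hpow : (1 + θ) ^ p = 1 + δ := by
    rw [hθ, add_sub_cancel, ← Real.rpow_mul (by linarith), one_div,
      inv_mul_cancel₀ hp.ne', Real.rpow_one]
  refine ⟨(1 / θ + 1) ^ p, Real.one_le_rpow (by have : 0 < 1 / θ := by positivity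
                                                linarith) hp.le, fun a b ha hb => ?_⟩
  have h1 : 0 ≤ a ^ p := Real.rpow_nonneg ha p
  have h2 : 0 ≤ b ^ p := Real.rpow_nonneg hb p
  have h3 : 0 ≤ (1 / θ + 1) ^ p := by positivity
  by_cases h : b ≤ θ * a
  · calc (a + b) ^ p ≤ ((1 + θ) * a) ^ p := by
          apply Real.rpow_le_rpow (by positivity) (by linarith) hp.le
      _ = (1 + δ) * a ^ p := by rw [Real.mul_rpow (by positivity) ha, hpow]
      _ ≤ _ := by nlinarith
  · have h' : a ≤ 1 / θ * b := by
      rw [one_div, ← div_eq_inv_mul, le_div_iff₀ hθ0]; linarith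
    calc (a + b) ^ p ≤ ((1 / θ + 1) * b) ^ p := by
          apply Real.rpow_le_rpow (by positivity) (by linarith) hp.le
      _ = (1 / θ + 1) ^ p * b ^ p := by rw [Real.mul_rpow (by positivity) hb]
      _ ≤ _ := by nlinarith

end Inequalities

/-! ### Paths as an inductive relation. -/

/-- `PathCost p A x y s`: there is a path from `x` to `y` with all intermediate nodes in `A`
and total weight `s`. -/
inductive PathCost {d : ℕ} (p : ℝ) (A : Set (Pt d)) : Pt d → Pt d → ℝ → Prop
  | edge (x y : Pt d) : PathCost p A x y (dist x y ^ p)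
  | cons (x a y : Pt d) (s : ℝ) (ha : a ∈ A) (h : PathCost p A a y s) :
      PathCost p A x y (dist x a ^ p + s)

namespace PathCost

variable {d : ℕ} {p : ℝ} {A : Set (Pt d)} {x y z : Pt d} {s s' : ℝ}

theorem nonneg (h : PathCost p A x y s) : 0 ≤ s := by
  induction h with
  | edge x y => positivity
  | cons x a y s ha h ih => positivity

theorem mono {A' : Set (Pt d)} (hA : A ⊆ A') (h : PathCost p A x y s) : PathCost p A' x y s := by
  induction h with
  | edge x y => exact .edge x y
  | cons x a y s ha h ih => exact .cons x a y s (hA ha) ih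

theorem trans (h : PathCost p A x y s) (hy : y ∈ A) (h' : PathCost p A y z s') :
    PathCost p A x z (s + s') := by
  induction h with
  | edge x y => exact .cons x y z s' hy h'
  | cons x a y s ha h ih => rw [add_assoc]; exact .cons x a z _ ha (ih hy h')

theorem snoc {b : Pt d} (hb : b ∈ A) (h : PathCost p A x b s) :
    PathCost p A x y (s + dist b y ^ p) := h.trans hb (.edge b y)

theorem symm (h : PathCost p A x y s) : PathCost p A y x s := by
  induction h with
  | edge x y => rw [dist_comm]; exact .edge y x
  | cons x a y s ha h ih =>
    rw [add_comm, dist_comm]; exact ih.snoc ha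

theorem map {f : Pt d → Pt d} {c : ℝ} (hc : 0 ≤ c) (hf : ∀ u v, dist (f u) (f v) = c * dist u v)
    (h : PathCost p A x y s) : PathCost p (f '' A) (f x) (f y) (c ^ p * s) := by
  induction h with
  | edge x y =>
    rw [← Real.mul_rpow hc dist_nonneg, ← hf]; exact .edge _ _
  | cons x a y s ha h ih =>
    rw [mul_add, ← Real.mul_rpow hc dist_nonneg, ← hf]
    exact .cons _ _ _ _ (Set.mem_image_of_mem f ha) ih

/-- Only the first edge changes, and its new length exceeds the old one by at most `dist x q`. -/
theorem move_left {δ K : ℝ} (hp : 0 < p) (hδ : 0 ≤ δ) (hK : ∀ a b : ℝ, 0 ≤ a → 0 ≤ b →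
    (a + b) ^ p ≤ (1 + δ) * a ^ p + K * b ^ p) (q : Pt d) (h : PathCost p A x y s) :
    ∃ s', s' ≤ (1 + δ) * s + K * dist x q ^ p ∧ PathCost p A q y s' := by
  have key : ∀ a : Pt d, dist q a ^ p ≤ (1 + δ) * dist x a ^ p + K * dist x q ^ p := fun a =>
    (Real.rpow_le_rpow dist_nonneg (by
      have := dist_triangle q x a
      rw [dist_comm q x] at this; linarith : dist q a ≤ dist x a + dist x q) hp.le).trans
      (hK _ _ dist_nonneg dist_nonneg)
  cases h with
  | edge => exact ⟨_, key y, .edge q y⟩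
  | cons _ a _ s ha h =>
    refine ⟨_, ?_, .cons q a y s ha h⟩
    have := key a
    have := h.nonneg
    nlinarith

theorem move {δ K : ℝ} (hp : 0 < p) (hδ : 0 ≤ δ) (hK0 : 0 ≤ K) (hK : ∀ a b : ℝ, 0 ≤ a → 0 ≤ b →
    (a + b) ^ p ≤ (1 + δ) * a ^ p + K * b ^ p) (q q' : Pt d) (h : PathCost p A x y s) :
    ∃ s', s' ≤ (1 + δ) ^ 2 * s + (1 + δ) * K * (dist x q ^ p + dist y q' ^ p) ∧
      PathCost p A q q' s' := by
  obtain ⟨s₁, h₁, h₁'⟩ := h.move_left hp hδ hK q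
  obtain ⟨s₂, h₂, h₂'⟩ := h₁'.symm.move_left hp hδ hK q'
  refine ⟨s₂, ?_, h₂'.symm⟩
  have e1 : 0 ≤ dist y q' ^ p := by positivity
  calc s₂ ≤ (1 + δ) * s₁ + K * dist y q' ^ p := h₂
    _ ≤ (1 + δ) * ((1 + δ) * s + K * dist x q ^ p) + (1 + δ) * (K * dist y q' ^ p) := by
        have : 0 ≤ K * dist y q' ^ p := by positivity
        have := mul_le_mul_of_nonneg_left h₁ (by linarith : 0 ≤ 1 + δ)
        nlinarith
    _ = _ := by ring

end PathCost

/-! ### Basic properties of the shortest path length. -/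

section ShortestPath

variable {d : ℕ} {p : ℝ} {A : Set (Pt d)} {x y z : Pt d} {s s' : ℝ}

theorem shortestPathLength_bddBelow : BddBelow {s : ℝ | ∃ (k : ℕ) (π : ℕ → Pt d),
    π 0 = x ∧ π k = y ∧ (∀ i ≤ k, π i ∈ A ∪ {x, y}) ∧
    s = ∑ i ∈ Finset.range k, dist (π i) (π (i + 1)) ^ p} := by
  refine ⟨0, ?_⟩
  rintro s ⟨k, π, -, -, -, rfl⟩
  positivity

theorem PathCost.exists_nodes (h : PathCost p A x y s) : ∃ (k : ℕ) (π : ℕ → Pt d),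
    π 0 = x ∧ π k = y ∧ (∀ i, 0 < i → i < k → π i ∈ A) ∧ 0 < k ∧
    s = ∑ i ∈ Finset.range k, dist (π i) (π (i + 1)) ^ p := by
  induction h with
  | edge x y =>
    refine ⟨1, fun i => if i = 0 then x else y, by simp, by simp, ?_, one_pos, by simp⟩
    intro i h1 h2; omega
  | cons x a y s ha h ih =>
    obtain ⟨k, π, h0, hk, hπ, hkpos, hs⟩ := ih
    refine ⟨k + 1, fun i => match i with | 0 => x | j + 1 => π j, rfl, hk, ?_, by omega, ?_⟩
    · intro i h1 h2
      obtain ⟨j, rfl⟩ : ∃ j, i = j + 1 := ⟨i - 1, by omega⟩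
      rcases Nat.eq_zero_or_pos j with rfl | hj
      · simpa [h0] using ha
      · exact hπ j hj (by omega)
    · rw [Finset.sum_range_succ', hs, add_comm]
      simp [h0]

theorem PathCost.shortestPathLength_le (h : PathCost p A x y s) :
    shortestPathLength p x y A ≤ s := by
  obtain ⟨k, π, h0, hk, hπ, hkpos, hs⟩ := h.exists_nodes
  refine csInf_le shortestPathLength_bddBelow ⟨k, π, h0, hk, fun i hi => ?_, hs⟩
  rcases Nat.eq_zero_or_pos i with rfl | hi0
  · simp [h0]
  · rcases hi.eq_or_lt with rfl | hlt
    · simp [hk]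
    · exact Or.inl (hπ i hi0 hlt)

/-- An admissible path may revisit its endpoints, which need not belong to `A`. Reading it backwards
from `y`, the tail is discarded at each new visit to `y`, and the construction stops at the first
`x` encountered; neither operation increases the cost. -/
theorem exists_pathCost_of_nodes (hp : 0 < p) (k : ℕ) (π : ℕ → Pt d) (h0 : π 0 = x) (hk : π k = y)
    (hπ : ∀ i ≤ k, π i ∈ A ∪ {x, y}) :
    ∃ s ≤ ∑ i ∈ Finset.range k, dist (π i) (π (i + 1)) ^ p, PathCost p A x y s := by
  have key : ∀ j ≤ k, ∃ s ≤ ∑ i ∈ Finset.range j, dist (π (k - j + i)) (π (k - j + i + 1)) ^ p,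
      PathCost p A (π (k - j)) y s ∨ PathCost p A x y s := by
    intro j
    induction j with
    | zero =>
      intro _
      refine ⟨0, by simp, Or.inl ?_⟩
      have := PathCost.edge (p := p) (A := A) y y
      simp only [dist_self, Real.zero_rpow hp.ne'] at this
      simpa [hk] using this
    | succ j ih =>
      intro hj
      obtain ⟨s, hs, h⟩ := ih (by omega)
      have e1 : ∑ i ∈ Finset.range (j + 1),
          dist (π (k - (j + 1) + i)) (π (k - (j + 1) + i + 1)) ^ p =
          dist (π (k - (j + 1))) (π (k - j)) ^ p +
          ∑ i ∈ Finset.range j, dist (π (k - j + i)) (π (k - j + i + 1)) ^ p := by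
        rw [Finset.sum_range_succ', add_comm]
        congr 1
        · congr 3; simp; omega
        · apply Finset.sum_congr rfl
          intro i _
          congr 3 <;> omega
      rw [e1]
      set D := dist (π (k - (j + 1))) (π (k - j)) ^ p with hD
      have hD0 : 0 ≤ D := by positivity
      rcases h with h | h
      · rcases hπ (k - j) (by omega) with hA | hA
        · exact ⟨D + s, by linarith, Or.inl (.cons _ _ _ _ hA h)⟩
        · rcases hA with hA | hA
          · exact ⟨s, by linarith, Or.inr (hA ▸ h)⟩
          · have hA' : π (k - j) = y := hA
            refine ⟨D, ?_, Or.inl ?_⟩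
            · have := h.nonneg; linarith
            · rw [hD, hA']; exact .edge _ _
      · exact ⟨s, by linarith, Or.inr h⟩
  obtain ⟨s, hs, h⟩ := key k le_rfl
  simp only [Nat.sub_self, zero_add, h0, or_self] at hs h
  exact ⟨s, hs, h⟩

theorem exists_pathCost_lt (hp : 0 < p) (h : shortestPathLength p x y A < s) :
    ∃ s' < s, PathCost p A x y s' := by
  have hne : {s : ℝ | ∃ (k : ℕ) (π : ℕ → Pt d),
      π 0 = x ∧ π k = y ∧ (∀ i ≤ k, π i ∈ A ∪ {x, y}) ∧
      s = ∑ i ∈ Finset.range k, dist (π i) (π (i + 1)) ^ p}.Nonempty :=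
    ⟨_, 1, fun i => if i = 0 then x else y, by simp, by simp, fun i _ => by
      by_cases hi : i = 0 <;> simp [hi], rfl⟩
  obtain ⟨s₁, ⟨k, π, h0, hk, hπ, rfl⟩, h₁⟩ := exists_lt_of_csInf_lt hne h
  obtain ⟨s', hs', h'⟩ := exists_pathCost_of_nodes hp k π h0 hk hπ
  exact ⟨s', by linarith, h'⟩

theorem shortestPathLength_nonneg : 0 ≤ shortestPathLength p x y A := by
  apply Real.sInf_nonneg
  rintro s ⟨k, π, -, -, -, rfl⟩
  positivity

theorem shortestPathLength_le_dist : shortestPathLength p x y A ≤ dist x y ^ p :=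
  (PathCost.edge x y).shortestPathLength_le

theorem le_shortestPathLength (hp : 0 < p) (h : ∀ s', PathCost p A x y s' → s ≤ s') :
    s ≤ shortestPathLength p x y A := by
  by_contra! hlt
  obtain ⟨s', hs', h'⟩ := exists_pathCost_lt hp hlt
  exact absurd (h s' h') (by linarith)

theorem shortestPathLength_anti (hp : 0 < p) {A' : Set (Pt d)} (hA : A ⊆ A') :
    shortestPathLength p x y A' ≤ shortestPathLength p x y A :=
  le_shortestPathLength hp fun _ h => (h.mono hA).shortestPathLength_le

theorem shortestPathLength_triangle (hp : 0 < p) (hy : y ∈ A) :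
    shortestPathLength p x z A ≤ shortestPathLength p x y A + shortestPathLength p y z A := by
  rw [← sub_le_iff_le_add]
  refine le_shortestPathLength hp fun s h => ?_
  rw [sub_le_iff_le_add', ← sub_le_iff_le_add]
  refine le_shortestPathLength hp fun s' h' => ?_
  have := (h.trans hy h').shortestPathLength_le
  linarith

theorem shortestPathLength_move {δ K : ℝ} (hp : 0 < p) (hδ : 0 ≤ δ) (hK0 : 0 ≤ K)
    (hK : ∀ a b : ℝ, 0 ≤ a → 0 ≤ b →
    (a + b) ^ p ≤ (1 + δ) * a ^ p + K * b ^ p) (q q' : Pt d) :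
    shortestPathLength p q q' A ≤ (1 + δ) ^ 2 * shortestPathLength p x y A +
      (1 + δ) * K * (dist x q ^ p + dist y q' ^ p) := by
  have h1 : 0 < (1 + δ) ^ 2 := by positivity
  rw [← sub_le_iff_le_add, ← div_le_iff₀' h1]
  refine le_shortestPathLength hp fun s h => ?_
  obtain ⟨s', hs', h'⟩ := h.move hp hδ hK0 hK q q'
  have := h'.shortestPathLength_le
  rw [div_le_iff₀' h1]
  linarith

theorem shortestPathLength_image {f : Pt d → Pt d} {c : ℝ} (hp : 0 < p) (hc : 0 < c)
    (hf : ∀ u v, dist (f u) (f v) = c * dist u v) (hs : Function.Surjective f) :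
    shortestPathLength p (f x) (f y) (f '' A) = c ^ p * shortestPathLength p x y A := by
  have hcp : 0 < c ^ p := by positivity
  apply le_antisymm
  · rw [← div_le_iff₀' hcp]
    refine le_shortestPathLength hp fun s h => ?_
    rw [div_le_iff₀' hcp]
    exact (h.map hc.le hf).shortestPathLength_le
  · obtain ⟨g, hg⟩ := hs.hasRightInverse
    have hinj : Function.Injective f := by
      intro u v huv
      have := hf u v
      rw [huv, dist_self] at this
      exact dist_eq_zero.1 ((mul_eq_zero.1 this.symm).resolve_left hc.ne')
    have hgf : ∀ u, g (f u) = u := fun u => hinj (hg (f u))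
    refine le_shortestPathLength hp fun s h => ?_
    have h' := h.map (f := g) (c := c⁻¹) (by positivity) (fun u v => by
      have := hf (g u) (g v)
      rw [hg u, hg v] at this
      rw [this]; field_simp)
    rw [hgf, hgf, Set.image_image] at h'
    simp only [hgf, Set.image_id'] at h'
    have h2 := h'.shortestPathLength_le
    rw [Real.inv_rpow hc.le, ← div_eq_inv_mul, le_div_iff₀' hcp] at h2
    exact h2

theorem shortestPathLength_self (hp : 0 < p) : shortestPathLength p x x A = 0 :=
  le_antisymm (by simpa [Real.zero_rpow hp.ne'] using
    shortestPathLength_le_dist (p := p) (A := A) (x := x) (y := x)) shortestPathLength_nonneg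

end ShortestPath

/-! ### Configurations and the sigma-algebra of void events. -/

/-- A configuration of points in `ℝ^d`. -/
structure Config (d : ℕ) where
  /-- The set of points of the configuration. -/
  pts : Set (Pt d)

/-- The event that a configuration has no point in `U`. -/
def voidEvent {d : ℕ} (U : Set (Pt d)) : Set (Config d) := {A | Disjoint A.pts U}

/-- The void events of bounded open sets. -/
def voidSystem (d : ℕ) : Set (Set (Config d)) :=
  {S | ∃ U : Set (Pt d), IsOpen U ∧ Bornology.IsBounded U ∧ S = voidEvent U}

instance (d : ℕ) : MeasurableSpace (Config d) := MeasurableSpace.generateFrom (voidSystem d)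

/-- The part of a configuration lying in `D`. -/
def Config.restrict {d : ℕ} (D : Set (Pt d)) (A : Config d) : Config d := ⟨A.pts ∩ D⟩

/-- The image of a configuration. -/
def Config.image {d : ℕ} (f : Pt d → Pt d) (A : Config d) : Config d := ⟨f '' A.pts⟩

/-! ### Measurability of events about configurations. -/

section Measurability

variable {d : ℕ}

theorem voidEvent_inter (U V : Set (Pt d)) : voidEvent U ∩ voidEvent V = voidEvent (U ∪ V) := by
  ext A; simp [voidEvent, Set.disjoint_union_right]

theorem voidEvent_iUnion {ι : Sort*} (U : ι → Set (Pt d)) :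
    voidEvent (⋃ i, U i) = ⋂ i, voidEvent (U i) := by
  ext A; simp [voidEvent, Set.disjoint_iUnion_right]

theorem isPiSystem_voidSystem : IsPiSystem (voidSystem d) := by
  rintro _ ⟨U, hU, hU', rfl⟩ _ ⟨V, hV, hV', rfl⟩ -
  exact ⟨U ∪ V, hU.union hV, hU'.union hV', voidEvent_inter U V⟩

theorem measurableSet_voidEvent {U : Set (Pt d)} (hU : IsOpen U) :
    MeasurableSet (voidEvent U) := by
  have : U = ⋃ n : ℕ, U ∩ Metric.ball 0 n := by
    rw [← Set.inter_iUnion, Metric.iUnion_ball_nat, Set.inter_univ]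
  rw [this, voidEvent_iUnion]
  refine MeasurableSet.iInter fun n => MeasurableSpace.measurableSet_generateFrom
    ⟨_, hU.inter Metric.isOpen_ball, ?_, rfl⟩
  exact Metric.isBounded_ball.subset Set.inter_subset_right

theorem measurable_config {Ω : Type*} [MeasurableSpace Ω] {f : Ω → Config d}
    (h : ∀ U : Set (Pt d), IsOpen U → Bornology.IsBounded U →
      MeasurableSet {ω | Disjoint (f ω).pts U}) : Measurable f := by
  refine measurable_generateFrom ?_
  rintro _ ⟨U, hU, hU', rfl⟩
  exact h U hU hU'

theorem measurable_restrict {D : Set (Pt d)} (hD : IsOpen D) :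
    Measurable (Config.restrict D) := by
  refine measurable_config fun U hU _ => ?_
  have : {A : Config d | Disjoint (A.restrict D).pts U} = voidEvent (D ∩ U) := by
    ext A; simp only [Config.restrict, voidEvent, Set.mem_ofPred_eq, Set.disjoint_iff_inter_eq_empty,
      Set.inter_assoc]
  rw [this]
  exact measurableSet_voidEvent (hD.inter hU)

theorem measurable_image (f : Pt d ≃ₜ Pt d) : Measurable (Config.image f) := by
  refine measurable_config fun U hU _ => ?_
  have : {A : Config d | Disjoint (A.image f).pts U} = voidEvent (f ⁻¹' U) := by
    ext A; simp only [Config.image, voidEvent, Set.mem_ofPred_eq, Set.disjoint_image_left]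
  rw [this]
  exact measurableSet_voidEvent (hU.preimage f.continuous)

/-- An open set of tuples is a union of boxes of balls from a countable family, and a box contains a
tuple of the configuration exactly when each of its balls is hit. -/
theorem measurableSet_exists_tuple {k : ℕ} {O : Set (Fin k → Pt d)} (hO : IsOpen O) :
    MeasurableSet {A : Config d | ∃ v : Fin k → Pt d, (∀ i, v i ∈ A.pts) ∧ v ∈ O} := by
  let q := TopologicalSpace.denseSeq (Pt d)
  let B : (Fin k → ℕ) → ℕ → Fin k → Set (Pt d) := fun f m i => Metric.ball (q (f i)) (1 / (m + 1))
  have : {A : Config d | ∃ v : Fin k → Pt d, (∀ i, v i ∈ A.pts) ∧ v ∈ O} =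
      ⋃ (f : Fin k → ℕ) (m : ℕ) (_ : Set.pi Set.univ (B f m) ⊆ O), ⋂ i, (voidEvent (B f m i))ᶜ := by
    ext A
    simp only [Set.mem_ofPred_eq, Set.mem_iUnion, Set.mem_iInter, Set.mem_compl_iff, voidEvent,
      Set.not_disjoint_iff, exists_prop]
    constructor
    · rintro ⟨v, hv, hvO⟩
      obtain ⟨ε, hε, hball⟩ := Metric.isOpen_iff.1 hO v hvO
      obtain ⟨m, hm⟩ := exists_nat_one_div_lt (half_pos hε)
      have hm0 : (0 : ℝ) < 1 / (m + 1) := by positivity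
      have : ∀ i, ∃ n, dist (v i) (q n) < 1 / ((m : ℝ) + 1) := fun i =>
        (TopologicalSpace.denseRange_denseSeq (Pt d)).exists_dist_lt (v i) hm0
      choose f hf using this
      refine ⟨f, m, fun w hw => hball ?_, fun i => ⟨v i, hv i, hf i⟩⟩
      rw [Metric.mem_ball, dist_pi_lt_iff hε]
      intro i
      have h1 : dist (w i) (q (f i)) < 1 / (m + 1) := hw i trivial
      have h2 := hf i
      rw [dist_comm] at h2
      have := dist_triangle (w i) (q (f i)) (v i)
      linarith
    · rintro ⟨f, m, hsub, h⟩
      choose v hv hvB using h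
      exact ⟨v, hv, hsub fun i _ => hvB i⟩
  rw [this]
  refine MeasurableSet.iUnion fun f => MeasurableSet.iUnion fun m => MeasurableSet.iUnion fun _ =>
    MeasurableSet.iInter fun i => (measurableSet_voidEvent Metric.isOpen_ball).compl

end Measurability

/-! ### Measurability of path lengths. -/

section PathMeasurability

variable {d : ℕ} {p : ℝ}

/-- The nodes of the path from `x` to `y` with intermediate nodes `v`. -/
def pathNode {k : ℕ} (x y : Pt d) (v : Fin k → Pt d) (i : ℕ) : Pt d :=
  if i = 0 then x else if h : i - 1 < k then v ⟨i - 1, h⟩ else y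

/-- The weight of the path from `x` to `y` with intermediate nodes `v`. -/
noncomputable def nodeCost (p : ℝ) {k : ℕ} (x y : Pt d) (v : Fin k → Pt d) : ℝ :=
  ∑ i ∈ Finset.range (k + 1), dist (pathNode x y v i) (pathNode x y v (i + 1)) ^ p

theorem continuous_nodeCost (hp : 0 < p) (k : ℕ) :
    Continuous fun w : Pt d × Pt d × (Fin k → Pt d) => nodeCost p w.1 w.2.1 w.2.2 := by
  have h : ∀ i, Continuous fun w : Pt d × Pt d × (Fin k → Pt d) =>
      pathNode w.1 w.2.1 w.2.2 i := by
    intro i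
    unfold pathNode
    split_ifs <;> fun_prop
  refine continuous_finsetSum _ fun i _ => ?_
  exact ((h i).dist (h (i + 1))).rpow_const fun _ => Or.inr hp.le

theorem continuous_nodeCost_right (hp : 0 < p) {k : ℕ} (x y : Pt d) :
    Continuous fun v : Fin k → Pt d => nodeCost p x y v := by
  have h : Continuous fun v : Fin k → Pt d => ((x, y, v) : Pt d × Pt d × (Fin k → Pt d)) := by
    fun_prop
  have := (continuous_nodeCost hp k).comp h
  exact this

theorem exists_nodeCost_lt_iff (hp : 0 < p) {x y : Pt d} {A : Set (Pt d)} {a : ℝ} :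
    shortestPathLength p x y A < a ↔
      ∃ (k : ℕ) (v : Fin k → Pt d), (∀ i, v i ∈ A) ∧ nodeCost p x y v < a := by
  constructor
  · intro h
    obtain ⟨s, hs, h⟩ := exists_pathCost_lt hp h
    obtain ⟨k, π, h0, hk, hπ, hk0, rfl⟩ := h.exists_nodes
    obtain ⟨k, rfl⟩ : ∃ j, k = j + 1 := ⟨k - 1, by omega⟩
    refine ⟨k, fun i => π (i + 1), fun i => hπ _ (by omega) (by omega), ?_⟩
    convert hs using 1
    have : ∀ i ≤ k + 1, pathNode x y (fun i : Fin k => π (i + 1)) i = π i := by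
      intro i hi
      unfold pathNode
      split_ifs with h1 h2
      · rw [h1, h0]
      · simp only; congr 1; omega
      · rw [← hk]; congr 1; omega
    refine Finset.sum_congr rfl fun i hi => ?_
    rw [Finset.mem_range] at hi
    rw [this i (by omega), this (i + 1) (by omega)]
  · rintro ⟨k, v, hv, h⟩
    refine lt_of_le_of_lt (csInf_le shortestPathLength_bddBelow
      ⟨k + 1, pathNode x y v, rfl, ?_, fun i _ => ?_, rfl⟩) h
    · simp [pathNode]
    · unfold pathNode
      split_ifs with h1 h2
      · simp
      · exact Or.inl (hv _)
      · simp

theorem measurable_shortestPathLength (hp : 0 < p) (x y : Pt d) :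
    Measurable fun A : Config d => shortestPathLength p x y A.pts := by
  refine measurable_of_Iio fun a => ?_
  have : (fun A : Config d => shortestPathLength p x y A.pts) ⁻¹' Set.Iio a =
      ⋃ k : ℕ, {A : Config d | ∃ v : Fin k → Pt d, (∀ i, v i ∈ A.pts) ∧
        v ∈ {v | nodeCost p x y v < a}} := by
    ext A
    simp [exists_nodeCost_lt_iff hp]
  rw [this]
  refine MeasurableSet.iUnion fun k => measurableSet_exists_tuple ?_
  exact isOpen_lt (continuous_nodeCost_right hp x y) continuous_const

/-- The set `S` of endpoints may be uncountable: for a fixed number of nodes the union over `S` is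
taken inside the open set of node tuples, where arbitrary unions are harmless. -/
theorem measurableSet_exists_shortestPathLength_lt (hp : 0 < p) (S : Set (Pt d × Pt d)) (a : ℝ) :
    MeasurableSet {A : Config d | ∃ w ∈ S, shortestPathLength p w.1 w.2 A.pts < a} := by
  have : {A : Config d | ∃ w ∈ S, shortestPathLength p w.1 w.2 A.pts < a} =
      ⋃ k : ℕ, {A : Config d | ∃ v : Fin k → Pt d, (∀ i, v i ∈ A.pts) ∧
        v ∈ ⋃ w ∈ S, {v | nodeCost p w.1 w.2 v < a}} := by
    ext A
    simp only [Set.mem_ofPred_eq, exists_nodeCost_lt_iff hp, Set.mem_iUnion, exists_prop]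
    constructor
    · rintro ⟨w, hw, k, v, hv, h⟩; exact ⟨k, v, hv, w, hw, h⟩
    · rintro ⟨k, v, hv, w, hw, h⟩; exact ⟨w, hw, k, v, hv, h⟩
  rw [this]
  refine MeasurableSet.iUnion fun k => measurableSet_exists_tuple ?_
  exact isOpen_iUnion fun w => isOpen_iUnion fun _ =>
    isOpen_lt (continuous_nodeCost_right hp w.1 w.2) continuous_const

end PathMeasurability

/-! ### The Poisson law and its void probabilities. -/

section Law

variable {d : ℕ}

/-- The law of the homogeneous Poisson process of unit intensity is characterised by its void
probabilities. -/
structure IsPoissonLaw (μ : Measure (Config d)) : Prop where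
  prob : IsProbabilityMeasure μ
  void : ∀ U : Set (Pt d), IsOpen U → Bornology.IsBounded U →
    μ (voidEvent U) = ENNReal.ofReal (Real.exp (-volume.real U))

theorem config_measure_ext {μ ν : Measure (Config d)} [IsProbabilityMeasure μ]
    [IsProbabilityMeasure ν] (h : ∀ U : Set (Pt d), IsOpen U → Bornology.IsBounded U →
      μ (voidEvent U) = ν (voidEvent U)) : μ = ν := by
  refine ext_of_generate_finite (voidSystem d) rfl isPiSystem_voidSystem ?_ (by simp)
  rintro _ ⟨U, hU, hU', rfl⟩
  exact h U hU hU'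

theorem IsPoissonLaw.unique {μ ν : Measure (Config d)} (hμ : IsPoissonLaw μ)
    (hν : IsPoissonLaw ν) : μ = ν := by
  have := hμ.prob
  have := hν.prob
  exact config_measure_ext fun U hU hU' => by rw [hμ.void U hU hU', hν.void U hU hU']

theorem IsPoissonLaw.map_image {μ : Measure (Config d)} (hμ : IsPoissonLaw μ) (f : Pt d ≃ᵢ Pt d)
    (hf : MeasurePreserving f volume volume) : μ.map (Config.image f) = μ := by
  have := hμ.prob
  have hm : Measurable (Config.image f : Config d → Config d) := measurable_image f.toHomeomorph
  refine IsPoissonLaw.unique ⟨Measure.isProbabilityMeasure_map hm.aemeasurable,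
    fun U hU hU' => ?_⟩ hμ
  rw [Measure.map_apply hm (measurableSet_voidEvent hU)]
  have e : Config.image f ⁻¹' voidEvent U = voidEvent (f ⁻¹' U) := by
    ext A; simp only [Config.image, voidEvent, Set.mem_ofPred_eq, Set.mem_preimage,
      Set.disjoint_image_left]
  rw [e, hμ.void _ (hU.preimage f.continuous), measureReal_def, measureReal_def,
    hf.measure_preimage hU.measurableSet.nullMeasurableSet]
  have : f ⁻¹' U = f.symm '' U := (f.toEquiv.image_symm_eq_preimage U).symm
  rw [this]
  exact f.symm.isometry.lipschitz.isBounded_image hU'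

/-- Void events in disjoint regions intersect in the void event of the union; volume is additive
there and the exponential makes the probability a product. Void events form a generating pi-system,
so this suffices. -/
theorem IsPoissonLaw.iIndepFun_restrict {μ : Measure (Config d)} (hμ : IsPoissonLaw μ) {ι : Type*}
    (D : ι → Set (Pt d)) (hD : ∀ i, IsOpen (D i)) (hdisj : Pairwise fun i j => Disjoint (D i) (D j)) :
    iIndepFun (fun i A => Config.restrict (D i) A) μ := by
  have := hμ.prob
  rw [iIndepFun_iff_iIndep]
  refine iIndepSets.iIndep (fun i => (measurable_restrict (hD i)).comap_le)
    (fun i => Set.preimage (Config.restrict (D i)) '' voidSystem d)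
    (fun i => isPiSystem_voidSystem.comap _) (fun i => MeasurableSpace.comap_generateFrom) ?_
  rw [iIndepSets_iff]
  intro s f hf
  have hf' : ∀ i ∈ s, ∃ U : Set (Pt d), IsOpen U ∧ Bornology.IsBounded U ∧
      f i = voidEvent (D i ∩ U) := by
    intro i hi
    obtain ⟨_, ⟨U, hU, hU', rfl⟩, hS⟩ := hf i hi
    refine ⟨U, hU, hU', ?_⟩
    rw [← hS]
    ext A
    simp only [Config.restrict, voidEvent, Set.mem_ofPred_eq, Set.mem_preimage,
      Set.disjoint_iff_inter_eq_empty, Set.inter_assoc]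
  choose! U hU hU' hfU using hf'
  have e1 : ⋂ i ∈ s, f i = voidEvent (⋃ i ∈ s, D i ∩ U i) := by
    simp only [voidEvent_iUnion]
    exact Set.iInter₂_congr fun i hi => hfU i hi
  have hb : ∀ i ∈ s, Bornology.IsBounded (D i ∩ U i) := fun i hi =>
    (hU' i hi).subset Set.inter_subset_right
  have e2 := hμ.void (⋃ i ∈ s, D i ∩ U i) (isOpen_biUnion fun i hi => (hD i).inter (hU i hi))
    ((Bornology.isBounded_biUnion_finset s).2 hb)
  rw [e1, e2, measureReal_biUnion_finset
    (fun i _ j _ hij => (hdisj hij).mono Set.inter_subset_left Set.inter_subset_left)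
    (fun i hi => ((hD i).inter (hU i hi)).measurableSet)
    (fun i hi => (hb i hi).measure_lt_top.ne), ← Finset.sum_neg_distrib, Real.exp_sum,
    ENNReal.ofReal_prod_of_nonneg fun i _ => (Real.exp_pos _).le]
  refine Finset.prod_congr rfl fun i hi => ?_
  rw [hfU i hi, hμ.void _ ((hD i).inter (hU i hi)) (hb i hi)]

end Law

/-! ### Existence and uniqueness of the Poisson process. -/

section Poissonization

variable {d : ℕ}

theorem lintegral_poissonMeasure_pow (m : NNReal) {c : ℝ} (hc : 0 ≤ c) :
    ∫⁻ n, ENNReal.ofReal (c ^ n) ∂(poissonMeasure m) =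
      ENNReal.ofReal (Real.exp (-(m * (1 - c)))) := by
  have h : HasSum (fun n : ℕ => Real.exp (-m) * m ^ n / n.factorial * c ^ n)
      (Real.exp (-(m * (1 - c)))) := by
    have h1 := (NormedSpace.expSeries_div_hasSum_exp ((m : ℝ) * c)).mul_left (Real.exp (-m))
    rw [← Real.exp_eq_exp_ℝ, ← Real.exp_add] at h1
    have e1 : (fun n : ℕ => Real.exp (-m) * m ^ n / n.factorial * c ^ n) =
        fun n : ℕ => Real.exp (-m) * ((m * c) ^ n / n.factorial) := by
      ext n; rw [mul_pow]; ring
    have e2 : -((m : ℝ) * (1 - c)) = -m + m * c := by ring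
    rw [e1, e2]
    exact h1
  rw [poissonMeasure, lintegral_sum_measure, ← h.tsum_eq,
    ENNReal.ofReal_tsum_of_nonneg (fun n => by positivity) h.summable]
  refine tsum_congr fun n => ?_
  rw [lintegral_smul_measure, lintegral_dirac, smul_eq_mul, ← ENNReal.ofReal_mul (by positivity)]

theorem disjoint_sampleSet_iff {Ω : Type*} (X : ℕ → Ω → Pt d) (n : ℕ) (ω : Ω) (U : Set (Pt d)) :
    Disjoint (sampleSet X n ω) U ↔ ∀ i < n, X i ω ∉ U := by
  simp only [sampleSet, Set.disjoint_left, Set.mem_ofPred_eq]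
  exact ⟨fun h i hi => h ⟨i, hi, rfl⟩, fun h u ⟨i, hi, hu⟩ => hu ▸ h i hi⟩

theorem measurableSet_disjoint_sampleSet {Ω : Type*} [MeasurableSpace Ω] {X : ℕ → Ω → Pt d}
    (hX : ∀ i, Measurable (X i)) {U : Set (Pt d)} (hU : MeasurableSet U) :
    MeasurableSet {w : Ω × ℕ | Disjoint (sampleSet X w.2 w.1) U} := by
  simp only [disjoint_sampleSet_iff]
  have : {w : Ω × ℕ | ∀ i < w.2, X i w.1 ∉ U} =
      ⋂ i : ℕ, ((fun w : Ω × ℕ => X i w.1) ⁻¹' Uᶜ) ∪ ((fun w : Ω × ℕ => w.2) ⁻¹' {n | ¬ i < n}) := by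
    ext w
    simp only [Set.mem_ofPred_eq, Set.mem_iInter, Set.mem_union, Set.mem_preimage,
      Set.mem_compl_iff]
    exact forall_congr' fun i => by tauto
  rw [this]
  refine MeasurableSet.iInter fun i => MeasurableSet.union ?_ ?_
  · exact ((hX i).comp measurable_fst) hU.compl
  · exact measurable_snd trivial

/-- Given the sample size `n` the void probability is `μ(Uᶜ) ^ n`; averaging over `n` is the
generating function of the Poisson law. -/
theorem measure_disjoint_sampleSet_poisson {Ω : Type*} [MeasurableSpace Ω] {P : Measure Ω}
    [IsProbabilityMeasure P] {X : ℕ → Ω → Pt d} (hX : ∀ i, Measurable (X i))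
    (hind : iIndepFun X P) {μ : Measure (Pt d)} [IsProbabilityMeasure μ]
    (hlaw : ∀ i, P.map (X i) = μ) (m : NNReal) {U : Set (Pt d)} (hU : MeasurableSet U) :
    (P.prod (poissonMeasure m)) {w : Ω × ℕ | Disjoint (sampleSet X w.2 w.1) U} =
      ENNReal.ofReal (Real.exp (-(m * μ.real U))) := by
  rw [Measure.prod_apply_symm (measurableSet_disjoint_sampleSet hX hU)]
  have h1 : μ.real Uᶜ = 1 - μ.real U := probReal_compl_eq_one_sub hU
  have h2 : ∀ n : ℕ, P ((fun ω => (ω, n)) ⁻¹' {w : Ω × ℕ | Disjoint (sampleSet X w.2 w.1) U}) =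
      ENNReal.ofReal ((μ.real Uᶜ) ^ n) := by
    intro n
    have e : (fun ω => (ω, n)) ⁻¹' {w : Ω × ℕ | Disjoint (sampleSet X w.2 w.1) U} =
        ⋂ i ∈ Finset.range n, X i ⁻¹' Uᶜ := by
      ext ω
      simp [disjoint_sampleSet_iff]
    rw [e, hind.measure_inter_preimage_eq_mul (Finset.range n) (sets := fun _ => Uᶜ)
      (fun i _ => hU.compl)]
    have : ∀ i ∈ Finset.range n, P (X i ⁻¹' Uᶜ) = μ Uᶜ := fun i _ => by
      rw [← hlaw i, Measure.map_apply (hX i) hU.compl]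
    rw [Finset.prod_congr rfl this, Finset.prod_const, Finset.card_range,
      ENNReal.ofReal_pow measureReal_nonneg, ofReal_measureReal]
  simp only [h2]
  rw [lintegral_poissonMeasure_pow m measureReal_nonneg, h1, sub_sub_cancel]

/-- The null measure must be allowed: for `d = 0` all annuli but the first are empty in the
construction of the Poisson process. -/
theorem exists_probability_smul (ν : Measure (Pt d)) [IsFiniteMeasure ν] :
    ∃ (m : NNReal) (μ : Measure (Pt d)), IsProbabilityMeasure μ ∧ ∀ U, m * μ.real U = ν.real U := by
  by_cases h : ν Set.univ = 0
  · refine ⟨0, Measure.dirac 0, inferInstance, fun U => ?_⟩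
    have : ν = 0 := Measure.measure_univ_eq_zero.1 h
    simp [this]
  · have : NeZero ν := ⟨fun h0 => h (by simp [h0])⟩
    refine ⟨(ν Set.univ).toNNReal, (ν Set.univ)⁻¹ • ν, inferInstance, fun U => ?_⟩
    have h' : (ν Set.univ).toReal ≠ 0 := ENNReal.toReal_ne_zero.2 ⟨h, measure_ne_top _ _⟩
    rw [measureReal_ennreal_smul_apply, ENNReal.toReal_inv]
    rw [show (((ν Set.univ).toNNReal : NNReal) : ℝ) = (ν Set.univ).toReal from rfl]
    field_simp

/-- There is a homogeneous Poisson process of unit intensity. -/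
theorem exists_isPoissonLaw (d : ℕ) : ∃ μ : Measure (Config d), IsPoissonLaw μ := by
  -- Each annulus has finite volume and receives an independent Poisson number of i.i.d. uniform
  -- points; a bounded set meets only finitely many annuli.
  let a : ℕ → Set (Pt d) := fun j => Metric.ball 0 (j + 1) \ Metric.ball 0 j
  have ha : ∀ j, MeasurableSet (a j) := fun j => measurableSet_ball.diff measurableSet_ball
  have hfin : ∀ j, IsFiniteMeasure (volume.restrict (a j) : Measure (Pt d)) := fun j =>
    ⟨by rw [Measure.restrict_apply_univ]
        exact (measure_mono Set.sdiff_subset).trans_lt measure_ball_lt_top⟩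
  choose m μ hμ hmμ using fun j => exists_probability_smul (volume.restrict (a j) : Measure (Pt d))
  let Q : ℕ → Measure ((ℕ → Pt d) × ℕ) := fun j =>
    (Measure.infinitePi fun _ : ℕ => μ j).prod (poissonMeasure (m j))
  let Y : ℕ → (ℕ → Pt d) → Pt d := fun i w => w i
  have hY : ∀ i, Measurable (Y i) := fun i => measurable_pi_apply i
  have hYlaw : ∀ j i, (Measure.infinitePi fun _ : ℕ => μ j).map (Y i) = μ j := fun j i =>
    Measure.infinitePi_map_eval (fun _ : ℕ => μ j) i
  have hYind : ∀ j, iIndepFun Y (Measure.infinitePi fun _ : ℕ => μ j) := fun j =>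
    iIndepFun_infinitePi (X := fun _ x => x) (fun _ => measurable_id)
  -- Intersecting with `a j` makes the points of the `j`-th sample lie in their annulus surely, so
  -- that void events split exactly into independent conditions.
  let H : (ℕ → (ℕ → Pt d) × ℕ) → Config d := fun ω =>
    ⟨⋃ j, sampleSet Y (ω j).2 (ω j).1 ∩ a j⟩
  have hball : ∀ U : Set (Pt d), Bornology.IsBounded U → ∃ J : ℕ, U ⊆ ⋃ j ∈ Finset.range J, a j := by
    intro U hU
    obtain ⟨r, hr⟩ := hU.subset_ball 0
    refine ⟨⌈r⌉₊, fun u hu => ?_⟩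
    have h1 : ‖u‖ < r := by simpa using hr hu
    simp only [Set.mem_iUnion, Finset.mem_range]
    refine ⟨⌊‖u‖⌋₊, ?_, ?_⟩
    · exact (Nat.floor_lt (norm_nonneg u)).2 (h1.trans_le (Nat.le_ceil r))
    · simp only [a, Set.mem_sdiff, Metric.mem_ball, dist_zero_right, not_lt]
      exact ⟨Nat.lt_floor_add_one _, Nat.floor_le (norm_nonneg u)⟩
  have hadisj : ∀ i j, i ≠ j → Disjoint (a i) (a j) := by
    have key : ∀ i j, i < j → Disjoint (a i) (a j) := by
      intro i j hij
      rw [Set.disjoint_left]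
      intro u hu hu'
      simp only [a, Set.mem_sdiff, Metric.mem_ball, dist_zero_right, not_lt] at hu hu'
      have : (i : ℝ) + 1 ≤ j := by exact_mod_cast hij
      linarith [hu.1, hu'.2]
    intro i j hij
    rcases lt_or_gt_of_ne hij with h | h
    · exact key i j h
    · exact (key j i h).symm
  have hvoid : ∀ (U : Set (Pt d)) (J : ℕ), U ⊆ ⋃ j ∈ Finset.range J, a j →
      {ω | Disjoint (H ω).pts U} = Set.pi (Finset.range J)
        fun j => {w : (ℕ → Pt d) × ℕ | Disjoint (sampleSet Y w.2 w.1) (a j ∩ U)} := by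
    intro U J hJ
    ext ω
    simp only [H, Set.mem_ofPred_eq, Set.disjoint_iUnion_left, Set.mem_pi, Finset.coe_range,
      Set.mem_Iio]
    simp only [Set.disjoint_iff_inter_eq_empty, Set.inter_assoc]
    refine ⟨fun h j _ => h j, fun h j => ?_⟩
    by_cases hj : j < J
    · exact h j hj
    · have : a j ∩ U = ∅ := by
        rw [← Set.disjoint_iff_inter_eq_empty]
        refine Disjoint.mono_right hJ ?_
        simp only [Set.disjoint_iUnion_right, Finset.mem_range]
        exact fun i hi => hadisj j i (by omega)
      rw [this, Set.inter_empty]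
  have hHm : Measurable H := by
    refine measurable_config fun U hU hU' => ?_
    obtain ⟨J, hJ⟩ := hball U hU'
    rw [hvoid U J hJ]
    exact MeasurableSet.pi (Finset.range J).countable_toSet fun j _ =>
      measurableSet_disjoint_sampleSet hY ((ha j).inter hU.measurableSet)
  refine ⟨(Measure.infinitePi Q).map H, Measure.isProbabilityMeasure_map hHm.aemeasurable,
    fun U hU hU' => ?_⟩
  obtain ⟨J, hJ⟩ := hball U hU'
  rw [Measure.map_apply hHm (measurableSet_voidEvent hU)]
  change Measure.infinitePi Q {ω | Disjoint (H ω).pts U} = _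
  rw [hvoid U J hJ, Measure.infinitePi_pi Q fun j _ =>
    measurableSet_disjoint_sampleSet hY ((ha j).inter hU.measurableSet)]
  have e1 : ∀ j ∈ Finset.range J, Q j {w : (ℕ → Pt d) × ℕ |
      Disjoint (sampleSet Y w.2 w.1) (a j ∩ U)} =
      ENNReal.ofReal (Real.exp (-volume.real (U ∩ a j))) := by
    intro j _
    rw [measure_disjoint_sampleSet_poisson hY (hYind j) (hYlaw j) (m j)
      ((ha j).inter hU.measurableSet), hmμ, measureReal_restrict_apply
      ((ha j).inter hU.measurableSet)]
    congr 4
    ext u; simp only [Set.mem_inter_iff]; tauto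
  rw [Finset.prod_congr rfl e1, ← ENNReal.ofReal_prod_of_nonneg fun i _ => (Real.exp_pos _).le,
    ← Real.exp_sum, Finset.sum_neg_distrib, ← measureReal_biUnion_finset
    (fun i _ j _ hij => (hadisj i j hij).mono Set.inter_subset_right Set.inter_subset_right)
    (fun i _ => hU.measurableSet.inter (ha i))
    (fun i _ => (hU'.subset Set.inter_subset_left).measure_lt_top.ne)]
  congr 4
  rw [← Set.inter_iUnion₂, Set.inter_eq_left.2 hJ]

/-- The law of the homogeneous Poisson process of unit intensity. -/
noncomputable def poissonLaw (d : ℕ) : Measure (Config d) := (exists_isPoissonLaw d).choose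

theorem isPoissonLaw_poissonLaw (d : ℕ) : IsPoissonLaw (poissonLaw d) :=
  (exists_isPoissonLaw d).choose_spec

instance (d : ℕ) : IsProbabilityMeasure (poissonLaw d) := (isPoissonLaw_poissonLaw d).prob

/-- Every homogeneous Poisson point process of unit intensity has law `poissonLaw d`. -/
theorem IsPoissonPointProcess.exists_map_eq {Ω : Type*} [MeasurableSpace Ω] {P : Measure Ω}
    [IsProbabilityMeasure P] {H : Ω → Set (Pt d)} (hH : IsPoissonPointProcess P H 1) :
    ∃ H' : Ω → Config d, Measurable H' ∧ (∀ᵐ ω ∂P, (H' ω).pts = H ω) ∧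
      P.map H' = poissonLaw d := by
  classical
  have hae : ∀ᵐ ω ∂P, ∀ n : ℕ, (H ω ∩ Metric.ball 0 n).Finite :=
    ae_all_iff.2 fun n => hH.ae_finite _ measurableSet_ball measure_ball_lt_top
  -- Since `ncard` of an infinite set is `0`, a zero count means emptiness only where the
  -- configuration is locally finite. The null exceptional set is enlarged to a measurable one and
  -- the configuration emptied on it.
  let T := toMeasurable P {ω | ¬ ∀ n : ℕ, (H ω ∩ Metric.ball 0 n).Finite}
  have hT : P T = 0 := by rw [measure_toMeasurable]; exact hae
  have hTm : MeasurableSet T := measurableSet_toMeasurable _ _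
  have hTfin : ∀ ω ∉ T, ∀ U, Bornology.IsBounded U → (H ω ∩ U).Finite := by
    intro ω hω U hU
    have h1 : ∀ n : ℕ, (H ω ∩ Metric.ball 0 n).Finite := by
      by_contra h
      exact hω (subset_toMeasurable _ _ h)
    obtain ⟨r, hr⟩ := hU.subset_ball 0
    refine (h1 ⌈r⌉₊).subset (Set.inter_subset_inter_right _ (hr.trans ?_))
    exact Metric.ball_subset_ball (Nat.le_ceil r)
  let H' : Ω → Config d := fun ω => if ω ∈ T then ⟨∅⟩ else ⟨H ω⟩
  have hset : ∀ U : Set (Pt d), Bornology.IsBounded U → {ω | Disjoint (H' ω).pts U} =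
      T ∪ (fun ω => (H ω ∩ U).ncard) ⁻¹' {0} := by
    intro U hU
    ext ω
    by_cases hω : ω ∈ T
    · simp [H', hω]
    · simp only [H', hω, if_false, Set.mem_ofPred_eq, Set.mem_union, false_or, Set.mem_preimage,
        Set.mem_singleton_iff, Set.ncard_eq_zero (hTfin ω hω U hU),
        Set.disjoint_iff_inter_eq_empty]
  have hm : Measurable H' := by
    refine measurable_config fun U hU hU' => ?_
    rw [hset U hU']
    exact hTm.union (hH.measurable_count U hU.measurableSet hU'.measure_lt_top trivial)
  have hae' : ∀ᵐ ω ∂P, ω ∉ T := by rwa [ae_iff, show {ω | ¬ ω ∉ T} = T by ext; simp]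
  refine ⟨H', hm, ?_, ?_⟩
  · filter_upwards [hae'] with ω hω
    simp [H', hω]
  · refine IsPoissonLaw.unique ⟨Measure.isProbabilityMeasure_map hm.aemeasurable,
      fun U hU hU' => ?_⟩ (isPoissonLaw_poissonLaw d)
    rw [Measure.map_apply hm (measurableSet_voidEvent hU)]
    change P {ω | Disjoint (H' ω).pts U} = _
    have h1 : P {ω | Disjoint (H' ω).pts U} = P ((fun ω => (H ω ∩ U).ncard) ⁻¹' {0}) := by
      rw [hset U hU']
      refine le_antisymm ((measure_union_le _ _).trans ?_) (measure_mono Set.subset_union_right)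
      rw [hT, zero_add]
    have hc := hH.measurable_count U hU.measurableSet hU'.measure_lt_top
    rw [h1, ← Measure.map_apply hc trivial, hH.law_count U hU.measurableSet hU'.measure_lt_top,
      poissonMeasure_singleton]
    simp only [pow_zero, mul_one, Nat.factorial_zero, Nat.cast_one, div_one, one_mul]
    rfl

end Poissonization

/-! ### Chernoff bound for bounded nonnegative variables. -/

section Chernoff

theorem exp_mul_le_of_mem_Icc {u θ : ℝ} (h0 : 0 ≤ θ) (h1 : θ ≤ 1) :
    Real.exp (θ * u) ≤ 1 + θ * (Real.exp u - 1) := by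
  have := convexOn_exp.2 (Set.mem_univ (0 : ℝ)) (Set.mem_univ u) (sub_nonneg.2 h1) h0 (by ring)
  simp only [smul_eq_mul, mul_zero, zero_add, Real.exp_zero, mul_one] at this
  linarith

/-- A Chernoff bound for sums of independent variables in `[0, B]`, linear in `1 / B`. -/
theorem exists_chernoff_bound {w ε : ℝ} (hw : 0 ≤ w) (hε : 0 < ε) :
    ∃ c : ℝ, 0 < c ∧ ∀ {Ω : Type} [MeasurableSpace Ω] (P : Measure Ω) [IsProbabilityMeasure P]
      (n : ℕ) (X : ℕ → Ω → ℝ) (B : ℝ), 0 < B → (∀ i, Measurable (X i)) →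
      iIndepFun X P → (∀ i ω, 0 ≤ X i ω) → (∀ i ω, X i ω ≤ B) → (∀ i, ∫ ω, X i ω ∂P ≤ w) →
      P.real {ω | (w + ε) * n ≤ ∑ i ∈ Finset.range n, X i ω} ≤ Real.exp (-(c * (n / B))) := by
  -- The exponential tilt is `u / B`. This choice gives `w * u ≤ ε / 2`, so the second-order term `w
  -- * u ^ 2` consumes at most half of the gain `u * ε`.
  set u : ℝ := min 1 (ε / (2 * (w + 1))) with hu
  have hu0 : 0 < u := by rw [hu]; positivity
  have hu1 : u ≤ 1 := min_le_left _ _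
  have hu2 : w * u ≤ ε / 2 := by
    have : u ≤ ε / (2 * (w + 1)) := min_le_right _ _
    rw [le_div_iff₀ (by positivity)] at this
    nlinarith
  refine ⟨u * ε / 2, by positivity, ?_⟩
  intro Ω _ P _ n X B hB hX hind h0 hXB hEX
  have hexp : Real.exp u - 1 ≤ u + u ^ 2 := by
    have := Real.abs_exp_sub_one_sub_id_le (x := u) (by rw [abs_of_pos hu0]; exact hu1)
    have := (abs_le.1 this).2
    linarith
  have hsX : ∀ i ω, u / B * X i ω ≤ u := fun i ω => by
    rw [div_mul_eq_mul_div, div_le_iff₀ hB]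
    exact mul_le_mul_of_nonneg_left (hXB i ω) hu0.le
  have hXint : ∀ i, Integrable (X i) P := fun i =>
    Integrable.of_bound (hX i).aestronglyMeasurable B (ae_of_all _ fun ω => by
      rw [Real.norm_eq_abs, abs_of_nonneg (h0 i ω)]; exact hXB i ω)
  have hmgf : ∀ i, mgf (X i) P (u / B) ≤ Real.exp (w * (u + u ^ 2) / B) := by
    intro i
    have h1 : ∀ ω, Real.exp (u / B * X i ω) ≤ 1 + X i ω * ((Real.exp u - 1) / B) := by
      intro ω
      have := exp_mul_le_of_mem_Icc (u := u) (div_nonneg (h0 i ω) hB.le)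
        ((div_le_one hB).2 (hXB i ω))
      calc Real.exp (u / B * X i ω) = Real.exp (X i ω / B * u) := by congr 1; ring
        _ ≤ _ := this
        _ = _ := by ring
    have h2 : mgf (X i) P (u / B) ≤ ∫ ω, (1 + X i ω * ((Real.exp u - 1) / B)) ∂P := by
      refine integral_mono_of_nonneg (ae_of_all _ fun ω => (Real.exp_pos _).le) ?_
        (ae_of_all _ h1)
      exact (integrable_const _).add ((hXint i).mul_const _)
    have h3 : ∫ ω, (1 + X i ω * ((Real.exp u - 1) / B)) ∂P =
        1 + (∫ ω, X i ω ∂P) * ((Real.exp u - 1) / B) := by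
      rw [integral_add (integrable_const _) ((hXint i).mul_const _), integral_mul_const]
      simp
    have h4 : 0 ≤ (Real.exp u - 1) / B :=
      div_nonneg (by linarith [Real.add_one_le_exp u]) hB.le
    calc mgf (X i) P (u / B) ≤ 1 + (∫ ω, X i ω ∂P) * ((Real.exp u - 1) / B) := by rw [← h3]; exact h2
      _ ≤ 1 + w * ((u + u ^ 2) / B) := by
          have := mul_le_mul_of_nonneg_right (hEX i) h4
          have := mul_le_mul_of_nonneg_left (div_le_div_of_nonneg_right hexp hB.le) hw
          linarith
      _ ≤ Real.exp (w * (u + u ^ 2) / B) := by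
          rw [← mul_div_assoc, add_comm]; exact Real.add_one_le_exp _
  have hm := measure_ge_le_exp_mul_mgf (μ := P) (X := ∑ i ∈ Finset.range n, X i) (t := u / B)
    ((w + ε) * n) (by positivity) (by
      refine Integrable.of_bound (C := Real.exp (u * n)) ?_ (ae_of_all _ fun ω => ?_)
      · simp only [Finset.sum_apply]
        exact (Real.measurable_exp.comp ((Finset.measurable_sum (Finset.range n)
          fun i _ => hX i).const_mul (u / B))).aestronglyMeasurable
      · rw [Real.norm_eq_abs, Real.abs_exp, Real.exp_le_exp, Finset.sum_apply, Finset.mul_sum]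
        calc _ ≤ ∑ i ∈ Finset.range n, u := Finset.sum_le_sum fun i _ => hsX i ω
          _ = u * n := by simp [mul_comm])
  rw [hind.mgf_sum hX] at hm
  simp only [Finset.sum_apply] at hm
  refine hm.trans ?_
  calc Real.exp (-(u / B) * ((w + ε) * n)) * ∏ i ∈ Finset.range n, mgf (X i) P (u / B)
      ≤ Real.exp (-(u / B) * ((w + ε) * n)) *
        ∏ i ∈ Finset.range n, Real.exp (w * (u + u ^ 2) / B) := by
        gcongr with i hi
        · exact fun i _ => mgf_nonneg
        · exact hmgf i
    _ = Real.exp (n / B * (w * u ^ 2 - u * ε)) := by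
        rw [Finset.prod_const, Finset.card_range, ← Real.exp_nat_mul, ← Real.exp_add]
        congr 1; field_simp; ring
    _ ≤ _ := by
        rw [Real.exp_le_exp]
        have : w * u ^ 2 - u * ε ≤ -(u * ε / 2) := by nlinarith
        have hn : (0 : ℝ) ≤ n / B := by positivity
        nlinarith

end Chernoff

/-! ### Invariance under isometries and mean lengths. -/

section Invariance

variable {d : ℕ} {p : ℝ}

/-- Translate `x` to the origin, reflect `y - x` onto the vector `y' - x'` of the same norm, and
translate to `x'`. -/
theorem exists_isometry_pair {x y x' y' : Pt d} (h : dist x y = dist x' y') :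
    ∃ f : Pt d ≃ᵢ Pt d, MeasurePreserving f volume volume ∧ f x = x' ∧ f y = y' := by
  have hT : ∃ T : Pt d ≃ₗᵢ[ℝ] Pt d, T (y - x) = y' - x' := by
    have hn : ‖y - x‖ = ‖y' - x'‖ := by
      rw [← dist_eq_norm, ← dist_eq_norm, dist_comm y, dist_comm y', h]
    exact ⟨_, Submodule.reflection_sub hn⟩
  obtain ⟨T, hT⟩ := hT
  let f : Pt d ≃ᵢ Pt d := ((IsometryEquiv.subRight x).trans T.toIsometryEquiv).trans
    (IsometryEquiv.addRight x')
  have hf : ∀ u, f u = T (u - x) + x' := fun u => rfl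
  refine ⟨f, ?_, by simp [hf], by simp [hf, hT]⟩
  have h1 := (measurePreserving_add_right (volume : Measure (Pt d)) x').comp
    (T.measurePreserving.comp (measurePreserving_sub_right (volume : Measure (Pt d)) x))
  exact h1

theorem integral_poissonLaw_image (f : Pt d ≃ᵢ Pt d) (hf : MeasurePreserving f volume volume)
    {F : Config d → ℝ} (hF : Measurable F) :
    ∫ A, F (A.image f) ∂(poissonLaw d) = ∫ A, F A ∂(poissonLaw d) := by
  have hm : Measurable (Config.image f : Config d → Config d) := measurable_image f.toHomeomorph
  conv_rhs => rw [← (isPoissonLaw_poissonLaw d).map_image f hf]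
  rw [integral_map hm.aemeasurable hF.aestronglyMeasurable]

theorem shortestPathLength_isometry (hp : 0 < p) (f : Pt d ≃ᵢ Pt d) (x y : Pt d) (A : Set (Pt d)) :
    shortestPathLength p (f x) (f y) (f '' A) = shortestPathLength p x y A := by
  rw [shortestPathLength_image hp one_pos (fun u v => by rw [f.dist_eq, one_mul]) f.surjective,
    Real.one_rpow, one_mul]

/-- The expected shortest path length between two points at distance `t`. -/
noncomputable def meanLength (p : ℝ) {d : ℕ} (x y : Pt d) : ℝ :=
  ∫ A, shortestPathLength p x y A.pts ∂(poissonLaw d)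

/-- The expected shortest path length through the points in the ball of radius `M` around the
starting point. -/
noncomputable def localMeanLength (p : ℝ) {d : ℕ} (M : ℝ) (x y : Pt d) : ℝ :=
  ∫ A, shortestPathLength p x y (A.pts ∩ Metric.ball x M) ∂(poissonLaw d)

theorem measurable_shortestPathLength_inter (hp : 0 < p) (x y : Pt d) {D : Set (Pt d)}
    (hD : IsOpen D) : Measurable fun A : Config d => shortestPathLength p x y (A.pts ∩ D) :=
  (measurable_shortestPathLength hp x y).comp (measurable_restrict hD)

theorem integrable_shortestPathLength (hp : 0 < p) (x y : Pt d) :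
    Integrable (fun A : Config d => shortestPathLength p x y A.pts) (poissonLaw d) :=
  Integrable.of_bound (measurable_shortestPathLength hp x y).aestronglyMeasurable (dist x y ^ p)
    (ae_of_all _ fun A => by
      rw [Real.norm_eq_abs, abs_of_nonneg shortestPathLength_nonneg]
      exact shortestPathLength_le_dist)

theorem integrable_shortestPathLength_inter (hp : 0 < p) (x y : Pt d) {D : Set (Pt d)}
    (hD : IsOpen D) :
    Integrable (fun A : Config d => shortestPathLength p x y (A.pts ∩ D)) (poissonLaw d) :=
  Integrable.of_bound (measurable_shortestPathLength_inter hp x y hD).aestronglyMeasurable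
    (dist x y ^ p) (ae_of_all _ fun A => by
      rw [Real.norm_eq_abs, abs_of_nonneg shortestPathLength_nonneg]
      exact shortestPathLength_le_dist)

theorem localMeanLength_congr (hp : 0 < p) (M : ℝ) {x y x' y' : Pt d} (h : dist x y = dist x' y') :
    localMeanLength p M x y = localMeanLength p M x' y' := by
  obtain ⟨f, hf, rfl, rfl⟩ := exists_isometry_pair h
  rw [localMeanLength, localMeanLength]
  conv_rhs => rw [← integral_poissonLaw_image f hf
    (measurable_shortestPathLength_inter hp _ _ Metric.isOpen_ball)]
  refine integral_congr_ae (ae_of_all _ fun A => ?_)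
  have : (A.image f).pts ∩ Metric.ball (f x) M = f '' (A.pts ∩ Metric.ball x M) := by
    rw [Set.image_inter f.injective, f.image_ball]; rfl
  simp only
  rw [this, shortestPathLength_isometry hp]

theorem meanLength_congr (hp : 0 < p) {x y x' y' : Pt d} (h : dist x y = dist x' y') :
    meanLength p x y = meanLength p x' y' := by
  obtain ⟨f, hf, rfl, rfl⟩ := exists_isometry_pair h
  rw [meanLength, meanLength]
  conv_rhs => rw [← integral_poissonLaw_image f hf (measurable_shortestPathLength hp _ _)]
  refine integral_congr_ae (ae_of_all _ fun A => ?_)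
  exact (shortestPathLength_isometry hp f x y A.pts).symm

/-- A nearly optimal path has finitely many nodes, hence lies in a large enough ball. -/
theorem tendsto_shortestPathLength_inter_ball (hp : 0 < p) (x y : Pt d) (A : Set (Pt d)) :
    Tendsto (fun M : ℕ => shortestPathLength p x y (A ∩ Metric.ball x M)) atTop
      (𝓝 (shortestPathLength p x y A)) := by
  rw [tendsto_order]
  constructor
  · intro a ha
    exact Eventually.of_forall fun M => ha.trans_le (shortestPathLength_anti hp Set.inter_subset_left)
  · intro a ha
    obtain ⟨k, v, hv, hlt⟩ := (exists_nodeCost_lt_iff hp).1 ha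
    have : ∀ᶠ M : ℕ in atTop, ∀ i, v i ∈ Metric.ball x (M : ℝ) := by
      rw [eventually_all]
      intro i
      exact (tendsto_natCast_atTop_atTop.eventually_gt_atTop (dist (v i) x)).mono fun M hM => hM
    filter_upwards [this] with M hM
    exact (exists_nodeCost_lt_iff hp).2 ⟨k, v, fun i => ⟨hv i, hM i⟩, hlt⟩

theorem tendsto_localMeanLength (hp : 0 < p) (x y : Pt d) :
    Tendsto (fun M : ℕ => localMeanLength p M x y) atTop (𝓝 (meanLength p x y)) := by
  refine tendsto_integral_of_dominated_convergence (fun _ => dist x y ^ p)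
    (fun M => (measurable_shortestPathLength_inter hp x y Metric.isOpen_ball).aestronglyMeasurable)
    (integrable_const _) (fun M => ae_of_all _ fun A => ?_)
    (ae_of_all _ fun A => tendsto_shortestPathLength_inter_ball hp x y A.pts)
  rw [Real.norm_eq_abs, abs_of_nonneg shortestPathLength_nonneg]
  exact shortestPathLength_le_dist

theorem meanLength_nonneg (x y : Pt d) : 0 ≤ meanLength p x y :=
  integral_nonneg fun _ => shortestPathLength_nonneg

end Invariance

/-! ### The distance to the nearest point of the configuration. -/

section Voids

variable {d : ℕ} {p : ℝ}

/-- The `p`-th power of the distance of `x` to a configuration, rounded up to an integer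
and truncated at `N`. -/
noncomputable def voidCost (p : ℝ) (N : ℕ) (x : Pt d) (A : Set (Pt d)) : ℝ :=
  open Classical in
  ∑ k ∈ Finset.range N, if Disjoint A (Metric.ball x k) then ((k + 1 : ℕ) : ℝ) ^ p - (k : ℝ) ^ p else 0

theorem natCast_rpow_sub_nonneg (hp : 0 < p) (k : ℕ) :
    0 ≤ ((k + 1 : ℕ) : ℝ) ^ p - (k : ℝ) ^ p :=
  sub_nonneg.2 (Real.rpow_le_rpow (by positivity) (by push_cast; linarith) hp.le)

theorem voidCost_nonneg (hp : 0 < p) (N : ℕ) (x : Pt d) (A : Set (Pt d)) :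
    0 ≤ voidCost p N x A := by
  refine Finset.sum_nonneg fun k _ => ?_
  split_ifs
  · exact natCast_rpow_sub_nonneg hp k
  · exact le_rfl

theorem sum_natCast_rpow_sub (hp : 0 < p) (N : ℕ) :
    ∑ k ∈ Finset.range N, (((k + 1 : ℕ) : ℝ) ^ p - (k : ℝ) ^ p) = (N : ℝ) ^ p := by
  rw [Finset.sum_range_sub (fun k : ℕ => (k : ℝ) ^ p)]
  simp [Real.zero_rpow hp.ne']

theorem voidCost_le (hp : 0 < p) (N : ℕ) (x : Pt d) (A : Set (Pt d)) :
    voidCost p N x A ≤ (N : ℝ) ^ p := by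
  rw [← sum_natCast_rpow_sub hp N]
  refine Finset.sum_le_sum fun k _ => ?_
  split_ifs
  · exact le_rfl
  · exact natCast_rpow_sub_nonneg hp k

/-- If `k` is the first integer radius whose ball is hit, the terms below `k` all count and
telescope to `k ^ p`. -/
theorem exists_mem_dist_rpow_le_voidCost (hp : 0 < p) {N : ℕ} {x : Pt d} {A : Set (Pt d)}
    (h : ¬ Disjoint A (Metric.ball x N)) :
    ∃ q ∈ A, dist x q < N ∧ dist x q ^ p ≤ voidCost p N x A := by
  classical
  have hex : ∃ k : ℕ, ¬ Disjoint A (Metric.ball x k) := ⟨N, h⟩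
  obtain ⟨q, hqA, hq⟩ := Set.not_disjoint_iff.1 (Nat.find_spec hex)
  have hle : Nat.find hex ≤ N := Nat.find_min' hex h
  rw [Metric.mem_ball'] at hq
  refine ⟨q, hqA, hq.trans_le (by exact_mod_cast hle), ?_⟩
  calc dist x q ^ p ≤ (Nat.find hex : ℝ) ^ p := Real.rpow_le_rpow dist_nonneg hq.le hp.le
    _ = ∑ k ∈ Finset.range (Nat.find hex), (((k + 1 : ℕ) : ℝ) ^ p - (k : ℝ) ^ p) :=
        (sum_natCast_rpow_sub hp _).symm
    _ = ∑ k ∈ Finset.range (Nat.find hex), (if Disjoint A (Metric.ball x k) then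
          ((k + 1 : ℕ) : ℝ) ^ p - (k : ℝ) ^ p else 0) := by
        refine Finset.sum_congr rfl fun k hk => ?_
        rw [if_pos]
        exact not_not.1 (Nat.find_min hex (Finset.mem_range.1 hk))
    _ ≤ voidCost p N x A := by
        refine Finset.sum_le_sum_of_subset_of_nonneg (Finset.range_mono hle) fun k _ _ => ?_
        split_ifs
        · exact natCast_rpow_sub_nonneg hp k
        · exact le_rfl

theorem voidCost_inter {N : ℕ} {x : Pt d} {A D : Set (Pt d)} (h : Metric.ball x N ⊆ D) :
    voidCost p N x (A ∩ D) = voidCost p N x A := by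
  classical
  refine Finset.sum_congr rfl fun k hk => ?_
  have hsub : Metric.ball x (k : ℝ) ⊆ D := (Metric.ball_subset_ball (by
    exact_mod_cast (Finset.mem_range.1 hk).le)).trans h
  have : Disjoint (A ∩ D) (Metric.ball x k) ↔ Disjoint A (Metric.ball x k) := by
    rw [Set.disjoint_iff_inter_eq_empty, Set.disjoint_iff_inter_eq_empty, Set.inter_assoc,
      Set.inter_eq_right.2 hsub]
  simp only [this]

theorem measurable_voidCost (N : ℕ) (x : Pt d) :
    Measurable fun A : Config d => voidCost p N x A.pts := by
  classical
  refine Finset.measurable_sum _ fun k _ => ?_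
  exact Measurable.ite (measurableSet_voidEvent Metric.isOpen_ball) measurable_const
    measurable_const

/-- An upper bound for the expectation of `voidCost`. -/
noncomputable def voidMean (p : ℝ) (d : ℕ) : ℝ :=
  ∑' k : ℕ, (((k + 1 : ℕ) : ℝ) ^ p - (k : ℝ) ^ p) *
    Real.exp (-volume.real (Metric.ball (0 : Pt d) k))

/-- The volume of the unit ball. -/
noncomputable def unitVolume (d : ℕ) : ℝ := volume.real (Metric.ball (0 : Pt d) 1)

theorem unitVolume_pos (d : ℕ) : 0 < unitVolume d :=
  ENNReal.toReal_pos (Metric.measure_ball_pos _ _ one_pos).ne' measure_ball_lt_top.ne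

theorem volume_real_ball (x : Pt d) {r : ℝ} (hr : 0 ≤ r) (hd : 1 ≤ d) :
    volume.real (Metric.ball x r) = r ^ d * unitVolume d := by
  have : NeZero d := ⟨by omega⟩
  rw [measureReal_def, Measure.addHaar_ball _ _ hr, ENNReal.toReal_mul,
    ENNReal.toReal_ofReal (by positivity), finrank_euclideanSpace_fin]
  rfl

theorem summable_voidMean (hp : 0 < p) (hd : 1 ≤ d) :
    Summable fun k : ℕ => (((k + 1 : ℕ) : ℝ) ^ p - (k : ℝ) ^ p) *
      Real.exp (-volume.real (Metric.ball (0 : Pt d) k)) := by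
  have hv := unitVolume_pos d
  obtain ⟨q, hq⟩ := exists_nat_ge p
  have h1 : Summable fun k : ℕ => ((k : ℝ) ^ q * Real.exp (-unitVolume d * k)) :=
    Real.summable_pow_mul_exp_neg_nat_mul q hv
  have h2 := (summable_nat_add_iff 1).2 h1
  refine Summable.of_nonneg_of_le (fun k => mul_nonneg (natCast_rpow_sub_nonneg hp k)
    (Real.exp_pos _).le) (fun k => ?_) (h2.mul_left (Real.exp (unitVolume d)))
  have e1 : ((k + 1 : ℕ) : ℝ) ^ p - (k : ℝ) ^ p ≤ ((k + 1 : ℕ) : ℝ) ^ q := by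
    have h3 : (0 : ℝ) ≤ (k : ℝ) ^ p := by positivity
    have h4 : ((k + 1 : ℕ) : ℝ) ^ p ≤ ((k + 1 : ℕ) : ℝ) ^ (q : ℝ) :=
      Real.rpow_le_rpow_of_exponent_le (by push_cast; linarith [(Nat.cast_nonneg k : (0 : ℝ) ≤ k)]) hq
    rw [Real.rpow_natCast] at h4
    linarith
  have e2 : Real.exp (-volume.real (Metric.ball (0 : Pt d) k)) ≤
      Real.exp (unitVolume d) * Real.exp (-unitVolume d * (k + 1 : ℕ)) := by
    rw [← Real.exp_add, Real.exp_le_exp, volume_real_ball _ (Nat.cast_nonneg k) hd]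
    push_cast
    have : (k : ℝ) ≤ (k : ℝ) ^ d := by exact_mod_cast Nat.le_self_pow (by omega) k
    nlinarith
  calc _ ≤ ((k + 1 : ℕ) : ℝ) ^ q * (Real.exp (unitVolume d) *
        Real.exp (-unitVolume d * (k + 1 : ℕ))) :=
        mul_le_mul e1 e2 (Real.exp_pos _).le (by positivity)
    _ = _ := by ring

theorem poissonLaw_real_voidEvent_ball (x : Pt d) (r : ℝ) :
    (poissonLaw d).real (voidEvent (Metric.ball x r)) =
      Real.exp (-volume.real (Metric.ball x r)) := by
  rw [measureReal_def, (isPoissonLaw_poissonLaw d).void _ Metric.isOpen_ball Metric.isBounded_ball,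
    ENNReal.toReal_ofReal (Real.exp_pos _).le]

/-- The bound does not depend on the truncation level `N`, because void probabilities of balls decay
faster than any power of the radius. -/
theorem integral_voidCost_le (hp : 0 < p) (hd : 1 ≤ d) (N : ℕ) (x : Pt d) :
    ∫ A : Config d, voidCost p N x A.pts ∂(poissonLaw d) ≤ voidMean p d := by
  classical
  have h1 : ∀ k : ℕ, ∫ A : Config d, (if Disjoint A.pts (Metric.ball x k) then
      ((k + 1 : ℕ) : ℝ) ^ p - (k : ℝ) ^ p else 0) ∂(poissonLaw d) =
      (((k + 1 : ℕ) : ℝ) ^ p - (k : ℝ) ^ p) *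
      Real.exp (-volume.real (Metric.ball (0 : Pt d) k)) := by
    intro k
    have : (fun A : Config d => if Disjoint A.pts (Metric.ball x k) then
      ((k + 1 : ℕ) : ℝ) ^ p - (k : ℝ) ^ p else 0) = (voidEvent (Metric.ball x k)).indicator
        (fun _ => ((k + 1 : ℕ) : ℝ) ^ p - (k : ℝ) ^ p) := by
      ext A
      by_cases h : Disjoint A.pts (Metric.ball x k) <;> simp [Set.indicator, voidEvent, h]
    rw [this, integral_indicator_const _ (measurableSet_voidEvent Metric.isOpen_ball),
      poissonLaw_real_voidEvent_ball, smul_eq_mul, mul_comm,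
      volume_real_ball x (Nat.cast_nonneg k) hd, volume_real_ball 0 (Nat.cast_nonneg k) hd]
  have h2 : ∀ k : ℕ, Integrable (fun A : Config d => if Disjoint A.pts (Metric.ball x k) then
      ((k + 1 : ℕ) : ℝ) ^ p - (k : ℝ) ^ p else 0) (poissonLaw d) := by
    intro k
    refine Integrable.of_bound (Measurable.ite (measurableSet_voidEvent Metric.isOpen_ball)
      measurable_const measurable_const).aestronglyMeasurable (((k + 1 : ℕ) : ℝ) ^ p - (k : ℝ) ^ p)
      (ae_of_all _ fun A => ?_)
    have := natCast_rpow_sub_nonneg hp k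
    split_ifs
    · rw [Real.norm_eq_abs, abs_of_nonneg this]
    · simpa using this
  unfold voidCost
  rw [integral_finsetSum _ fun k _ => h2 k, Finset.sum_congr rfl fun k _ => h1 k]
  exact (summable_voidMean hp hd).sum_le_tsum _ fun k _ =>
    mul_nonneg (natCast_rpow_sub_nonneg hp k) (Real.exp_pos _).le

theorem voidMean_nonneg (hp : 0 < p) : 0 ≤ voidMean p d :=
  tsum_nonneg fun k => mul_nonneg (natCast_rpow_sub_nonneg hp k) (Real.exp_pos _).le

theorem integrable_voidCost (hp : 0 < p) (N : ℕ) (x : Pt d) :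
    Integrable (fun A : Config d => voidCost p N x A.pts) (poissonLaw d) :=
  Integrable.of_bound (measurable_voidCost N x).aestronglyMeasurable ((N : ℝ) ^ p)
    (ae_of_all _ fun A => by
      rw [Real.norm_eq_abs, abs_of_nonneg (voidCost_nonneg hp N x A.pts)]
      exact voidCost_le hp N x A.pts)

end Voids

/-! ### Concatenating local shortest paths. -/

section BlockCost

variable {d : ℕ} {p : ℝ}

/-- The cost attributed to the block from `u` to `v`: the local shortest path length, inflated to
account for the replacement of `u` and `v` by nearby points of the configuration. -/
noncomputable def blockCost (p δ K M : ℝ) (N : ℕ) (u v : Pt d) (A : Set (Pt d)) : ℝ :=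
  (1 + δ) ^ 2 * shortestPathLength p u v (A ∩ Metric.ball u M) +
    (1 + δ) * K * (voidCost p N u A + voidCost p N v A)

theorem blockCost_nonneg (hp : 0 < p) {δ K M : ℝ} (hδ : 0 ≤ δ) (hK : 0 ≤ K) (N : ℕ) (u v : Pt d)
    (A : Set (Pt d)) : 0 ≤ blockCost p δ K M N u v A := by
  have h1 := voidCost_nonneg hp N u A
  have h2 := voidCost_nonneg hp N v A
  have h3 : 0 ≤ shortestPathLength p u v (A ∩ Metric.ball u M) := shortestPathLength_nonneg
  unfold blockCost
  positivity

theorem blockCost_le (hp : 0 < p) {δ K M : ℝ} (hδ : 0 ≤ δ) (hK : 0 ≤ K) {N : ℕ} (hN : 1 ≤ N)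
    (u v : Pt d) (A : Set (Pt d)) :
    blockCost p δ K M N u v A ≤ ((1 + δ) ^ 2 * dist u v ^ p + 2 * (1 + δ) * K) * (N : ℝ) ^ p := by
  have h1 := voidCost_le hp N u A
  have h2 := voidCost_le hp N v A
  have h3 : shortestPathLength p u v (A ∩ Metric.ball u M) ≤ dist u v ^ p :=
    shortestPathLength_le_dist
  have h4 : dist u v ^ p ≤ dist u v ^ p * (N : ℝ) ^ p :=
    le_mul_of_one_le_right (by positivity) (Real.one_le_rpow (by exact_mod_cast hN) hp.le)
  unfold blockCost
  calc _ ≤ (1 + δ) ^ 2 * (dist u v ^ p * (N : ℝ) ^ p) +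
      (1 + δ) * K * ((N : ℝ) ^ p + (N : ℝ) ^ p) := by gcongr; exact h3.trans h4
    _ = _ := by ring

theorem measurable_blockCost (hp : 0 < p) (δ K M : ℝ) (N : ℕ) (u v : Pt d) :
    Measurable fun A : Config d => blockCost p δ K M N u v A.pts :=
  ((measurable_shortestPathLength_inter hp u v Metric.isOpen_ball).const_mul _).add
    (((measurable_voidCost N u).add (measurable_voidCost N v)).const_mul _)

theorem blockCost_inter {δ K M : ℝ} {N : ℕ} {u v : Pt d} {A D : Set (Pt d)}
    (h1 : Metric.ball u M ⊆ D) (h2 : Metric.ball u N ⊆ D) (h3 : Metric.ball v N ⊆ D) :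
    blockCost p δ K M N u v (A ∩ D) = blockCost p δ K M N u v A := by
  unfold blockCost
  rw [voidCost_inter h2, voidCost_inter h3, Set.inter_assoc, Set.inter_eq_right.2 h1]

theorem integral_blockCost_le (hp : 0 < p) (hd : 1 ≤ d) {δ K M : ℝ} (hδ : 0 ≤ δ) (hK : 0 ≤ K)
    (N : ℕ) (u v : Pt d) :
    ∫ A : Config d, blockCost p δ K M N u v A.pts ∂(poissonLaw d) ≤
      (1 + δ) ^ 2 * localMeanLength p M u v + 2 * (1 + δ) * K * voidMean p d := by
  unfold blockCost
  have i1 := (integrable_shortestPathLength_inter hp u v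
    (Metric.isOpen_ball (x := u) (ε := M))).const_mul ((1 + δ) ^ 2)
  have i2 := integrable_voidCost hp N u
  have i3 := integrable_voidCost hp N v
  have i4 : Integrable (fun A : Config d => (1 + δ) * K * (voidCost p N u A.pts +
    voidCost p N v A.pts)) (poissonLaw d) := (i2.add i3).const_mul _
  rw [integral_add i1 i4, integral_const_mul, integral_const_mul, integral_add i2 i3]
  have h1 := integral_voidCost_le hp hd N u
  have h2 := integral_voidCost_le hp hd N v
  have h3 : 0 ≤ (1 + δ) * K := by positivity
  unfold localMeanLength
  nlinarith

/-- Every `X i` with `1 ≤ i ≤ m` is replaced by a close point of `A`, and the local path of each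
block is transported to the new endpoints, the void costs paying for the displacement. The start `X
0` is kept as it is, and the last substitute point is joined to `y` by one edge. -/
theorem shortestPathLength_le_sum_blockCost (hp : 0 < p) {δ K M : ℝ} (hδ : 0 ≤ δ) (hK0 : 0 ≤ K)
    (hK : ∀ a b : ℝ, 0 ≤ a → 0 ≤ b → (a + b) ^ p ≤ (1 + δ) * a ^ p + K * b ^ p)
    {A A' : Set (Pt d)} (X : ℕ → Pt d) (N m : ℕ)
    (hM : ∀ i < m, A ∩ Metric.ball (X i) M ⊆ A') (hN : ∀ i ≤ m, A ∩ Metric.ball (X i) N ⊆ A')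
    (hit : ∀ i, 1 ≤ i → i ≤ m → ¬ Disjoint A (Metric.ball (X i) N)) (y : Pt d) :
    shortestPathLength p (X 0) y A' ≤
      ∑ i ∈ Finset.range m, blockCost p δ K M N (X i) (X (i + 1)) A +
        (dist (X m) y + N) ^ p := by
  have key : ∀ q z : Pt d, (q ∈ A' ∨ q = X 0) →
      shortestPathLength p (X 0) z A' ≤ shortestPathLength p (X 0) q A' +
        shortestPathLength p q z A' := by
    rintro q z (hq | rfl)
    · exact shortestPathLength_triangle hp hq
    · rw [shortestPathLength_self hp, zero_add]
  have main : ∀ j ≤ m, ∃ q, (q ∈ A' ∨ q = X 0) ∧ dist (X j) q ≤ N ∧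
      dist (X j) q ^ p ≤ voidCost p N (X j) A ∧ shortestPathLength p (X 0) q A' ≤
        ∑ i ∈ Finset.range j, blockCost p δ K M N (X i) (X (i + 1)) A := by
    intro j
    induction j with
    | zero =>
      intro _
      refine ⟨X 0, Or.inr rfl, by simp, ?_, ?_⟩
      · rw [dist_self, Real.zero_rpow hp.ne']; exact voidCost_nonneg hp _ _ _
      · simp [shortestPathLength_self hp]
    | succ j ih =>
      intro hj
      obtain ⟨q, hq, -, hqv, hqL⟩ := ih (by omega)
      obtain ⟨q', hq'A, hq'N, hq'v⟩ := exists_mem_dist_rpow_le_voidCost hp (hit (j + 1) (by omega) hj)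
      refine ⟨q', Or.inl (hN (j + 1) hj ⟨hq'A, Metric.mem_ball'.2 hq'N⟩), hq'N.le, hq'v, ?_⟩
      rw [Finset.sum_range_succ]
      refine (key q q' hq).trans (add_le_add hqL ?_)
      have h1 : shortestPathLength p q q' A' ≤
          shortestPathLength p q q' (A ∩ Metric.ball (X j) M) :=
        shortestPathLength_anti hp (hM j (by omega))
      refine h1.trans ((shortestPathLength_move (x := X j) (y := X (j + 1)) hp hδ hK0 hK q q').trans ?_)
      unfold blockCost
      gcongr
  obtain ⟨q, hq, hqN, -, hqL⟩ := main m le_rfl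
  refine (key q y hq).trans (add_le_add hqL (shortestPathLength_le_dist.trans ?_))
  refine Real.rpow_le_rpow dist_nonneg ?_ hp.le
  have := dist_triangle q (X m) y
  rw [dist_comm q (X m)] at this
  linarith

end BlockCost

/-! ### The mesoscopic scale and independence of distant blocks. -/

section UpperTail

variable {d : ℕ} {p : ℝ}

theorem sum_range_mul_eq (f : ℕ → ℝ) (k n : ℕ) :
    ∑ i ∈ Finset.range (k * n), f i =
      ∑ j ∈ Finset.range k, ∑ l ∈ Finset.range n, f (j + k * l) := by
  induction n with
  | zero => simp
  | succ n ih =>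
    rw [Nat.mul_succ, Finset.sum_range_add, ih, ← Finset.sum_add_distrib]
    refine Finset.sum_congr rfl fun j _ => ?_
    rw [Finset.sum_range_succ, add_comm j (k * n)]

/-- Polynomial prefactors from union bounds are absorbed by halving the rate. -/
theorem eventually_mul_exp_le (C k : ℝ) {c β : ℝ} (hc : 0 < c) (hβ : 0 < β) :
    ∀ᶠ t : ℝ in atTop, C * t ^ k * Real.exp (-(c * t ^ β)) ≤ Real.exp (-(c / 2 * t ^ β)) := by
  have h1 : Tendsto (fun t : ℝ => C * ((t ^ β) ^ (k / β) * Real.exp (-(c / 2) * t ^ β))) atTop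
      (𝓝 (C * 0)) :=
    ((tendsto_rpow_mul_exp_neg_mul_atTop_nhds_zero (k / β) (c / 2) (by positivity)).comp
      (tendsto_rpow_atTop hβ)).const_mul C
  rw [mul_zero] at h1
  filter_upwards [h1.eventually_le_const one_pos, eventually_ge_atTop 0] with t ht ht0
  rw [← Real.rpow_mul ht0, mul_div_cancel₀ _ hβ.ne'] at ht
  have e : Real.exp (-(c * t ^ β)) = Real.exp (-(c / 2) * t ^ β) * Real.exp (-(c / 2 * t ^ β)) := by
    rw [← Real.exp_add]; congr 1; ring
  rw [e]
  have := mul_le_mul_of_nonneg_right ht (Real.exp_pos (-(c / 2 * t ^ β))).le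
  linarith

/-- The `l`-th block depends only on the ball of radius `N + r` around its first point. For indices
in one class modulo `4 N` these centres are at least `4 N r` apart, which exceeds `2 (N + r)` up to
equality because `N` and `r` are at least `1`; hence the costs are independent and the bound `hc`
applies. -/
theorem measure_class_sum_le (hp : 0 < p) {δ K M : ℝ} (hδ : 0 ≤ δ) (hK0 : 0 ≤ K)
    {w ε c r : ℝ} (hr : 1 ≤ r)
    (hc : ∀ {Ω : Type} [MeasurableSpace Ω] (P : Measure Ω) [IsProbabilityMeasure P]
      (n : ℕ) (X : ℕ → Ω → ℝ) (B : ℝ), 0 < B → (∀ i, Measurable (X i)) →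
      iIndepFun X P → (∀ i ω, 0 ≤ X i ω) → (∀ i ω, X i ω ≤ B) → (∀ i, ∫ ω, X i ω ∂P ≤ w) →
      P.real {ω | (w + ε) * n ≤ ∑ i ∈ Finset.range n, X i ω} ≤ Real.exp (-(c * (n / B))))
    (hw : ∀ (N : ℕ) (u v : Pt d), dist u v = r →
      ∫ A : Config d, blockCost p δ K M N u v A.pts ∂(poissonLaw d) ≤ w)
    {e : Pt d} (he : ‖e‖ = 1) (x : Pt d) {N : ℕ} (hN : 1 ≤ N) (hMN : M ≤ N) (j n : ℕ) :
    (poissonLaw d).real {A : Config d | (w + ε) * n ≤ ∑ l ∈ Finset.range n,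
      blockCost p δ K M N (x + ((j + 4 * N * l : ℕ) * r) • e)
        (x + ((j + 4 * N * l + 1 : ℕ) * r) • e) A.pts} ≤
      Real.exp (-(c * (n / (((1 + δ) ^ 2 * r ^ p + 2 * (1 + δ) * K) * (N : ℝ) ^ p)))) := by
  have hr0 : 0 < r := by linarith
  have hN0 : (1 : ℝ) ≤ N := by exact_mod_cast hN
  have hdist : ∀ i : ℕ, dist (x + ((i : ℕ) * r) • e) (x + ((i + 1 : ℕ) * r) • e) = r := by
    intro i
    rw [dist_add_left, dist_eq_norm, ← sub_smul, norm_smul, he]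
    push_cast
    rw [show (i : ℝ) * r - (i + 1) * r = -r by ring, norm_neg, Real.norm_eq_abs, abs_of_pos hr0,
      mul_one]
  let D : ℕ → Set (Pt d) := fun l => Metric.ball (x + ((j + 4 * N * l : ℕ) * r) • e) (N + r)
  have hdisj : Pairwise fun l l' => Disjoint (D l) (D l') := by
    intro l l' hll
    refine Metric.ball_disjoint_ball ?_
    rw [dist_add_left, dist_eq_norm, ← sub_smul, norm_smul, he, mul_one, ← sub_mul, norm_mul,
      Real.norm_eq_abs, Real.norm_eq_abs, abs_of_pos hr0]
    have h1 : (1 : ℝ) ≤ |(l : ℝ) - l'| := by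
      have : (1 : ℤ) ≤ |(l : ℤ) - l'| := Int.one_le_abs (by omega)
      exact_mod_cast this
    have h2 : |((j + 4 * N * l : ℕ) : ℝ) - ((j + 4 * N * l' : ℕ) : ℝ)| =
        4 * N * |(l : ℝ) - l'| := by
      push_cast
      rw [show (j : ℝ) + 4 * N * l - (j + 4 * N * l') = 4 * N * (l - l') by ring, abs_mul,
        abs_of_nonneg (by positivity)]
    rw [h2]
    have h3 : (4 * N : ℝ) * 1 ≤ 4 * N * |(l : ℝ) - l'| := by gcongr
    nlinarith
  have hloc : ∀ (l : ℕ) (A : Set (Pt d)), blockCost p δ K M N (x + ((j + 4 * N * l : ℕ) * r) • e)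
      (x + ((j + 4 * N * l + 1 : ℕ) * r) • e) (A ∩ D l) =
      blockCost p δ K M N (x + ((j + 4 * N * l : ℕ) * r) • e)
      (x + ((j + 4 * N * l + 1 : ℕ) * r) • e) A := by
    intro l A
    refine blockCost_inter (Metric.ball_subset_ball (by linarith))
      (Metric.ball_subset_ball (by linarith)) (Metric.ball_subset_ball' ?_)
    rw [dist_comm, hdist]
  have hind := ((isPoissonLaw_poissonLaw d).iIndepFun_restrict D (fun _ => Metric.isOpen_ball)
    hdisj).comp (fun l A => blockCost p δ K M N (x + ((j + 4 * N * l : ℕ) * r) • e)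
      (x + ((j + 4 * N * l + 1 : ℕ) * r) • e) A.pts)
    (fun l => measurable_blockCost hp δ K M N _ _)
  have hind' : iIndepFun (fun (l : ℕ) (A : Config d) =>
      blockCost p δ K M N (x + ((j + 4 * N * l : ℕ) * r) • e)
      (x + ((j + 4 * N * l + 1 : ℕ) * r) • e) A.pts) (poissonLaw d) := by
    convert hind using 2 with l
    ext A
    exact (hloc l A.pts).symm
  refine hc (poissonLaw d) n _ _ ?_ (fun l => measurable_blockCost hp δ K M N _ _) hind'
    (fun l A => blockCost_nonneg hp hδ hK0 _ _ _ _) (fun l A => ?_) (fun l => hw _ _ _ (hdist _))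
  · positivity
  · have := blockCost_le (M := M) hp hδ hK0 hN (x + ((j + 4 * N * l : ℕ) * r) • e)
      (x + ((j + 4 * N * l + 1 : ℕ) * r) • e) A.pts
    rwa [hdist] at this

/-- The mesoscopic scale used in the upper tail estimate. -/
noncomputable def mesoScale (p : ℝ) (d : ℕ) (t : ℝ) : ℕ := ⌈t ^ (1 / ((d : ℝ) + 2 * p))⌉₊

theorem le_mesoScale (p : ℝ) (d : ℕ) (t : ℝ) : t ^ (1 / ((d : ℝ) + 2 * p)) ≤ mesoScale p d t :=
  Nat.le_ceil _

theorem mesoScale_le (hp : 0 < p) {t : ℝ} (ht : 1 ≤ t) :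
    (mesoScale p d t : ℝ) ≤ 2 * t ^ (1 / ((d : ℝ) + 2 * p)) := by
  have h1 : 1 ≤ t ^ (1 / ((d : ℝ) + 2 * p)) := Real.one_le_rpow ht (by positivity)
  have := (Nat.ceil_lt_add_one (by linarith : 0 ≤ t ^ (1 / ((d : ℝ) + 2 * p)))).le
  unfold mesoScale
  linarith

theorem tendsto_mesoScale (hp : 0 < p) :
    Tendsto (fun t => (mesoScale p d t : ℝ)) atTop atTop :=
  tendsto_atTop_mono (le_mesoScale p d) (tendsto_rpow_atTop (by positivity))

theorem eventually_const_mul_rpow_le {a : ℝ} (ha : a < 1) (C : ℝ) {κ : ℝ} (hκ : 0 < κ) :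
    ∀ᶠ t : ℝ in atTop, C * t ^ a ≤ κ * t := by
  have h1 : Tendsto (fun t : ℝ => C * t ^ (-(1 - a))) atTop (𝓝 (C * 0)) :=
    (tendsto_rpow_neg_atTop (by linarith)).const_mul C
  rw [mul_zero] at h1
  filter_upwards [h1.eventually_le_const hκ, eventually_gt_atTop 0] with t ht ht0
  have : t ^ a = t ^ (-(1 - a)) * t := by
    rw [← Real.rpow_add_one ht0.ne']; congr 1; ring
  rw [this, ← mul_assoc]
  gcongr

theorem eventually_mesoScale_rpow_le (hp : 1 < p) (hd : 1 ≤ d) {q : ℝ} (hq0 : 0 < q) (hq : q ≤ p)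
    {C : ℝ} (hC : 0 < C) {κ : ℝ} (hκ : 0 < κ) :
    ∀ᶠ t : ℝ in atTop, (C * mesoScale p d t) ^ q ≤ κ * t := by
  have hγ : 0 < (d : ℝ) + 2 * p := by positivity
  have h1 : 1 / ((d : ℝ) + 2 * p) * q < 1 := by
    rw [one_div_mul_eq_div, div_lt_one hγ]
    have : (0 : ℝ) ≤ d := by positivity
    linarith
  filter_upwards [eventually_const_mul_rpow_le h1 ((C * 2) ^ q) hκ, eventually_ge_atTop 1]
    with t ht ht1
  have ht0 : (0 : ℝ) ≤ t := by linarith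
  calc (C * mesoScale p d t) ^ q ≤ (C * 2 * t ^ (1 / ((d : ℝ) + 2 * p))) ^ q := by
        refine Real.rpow_le_rpow (by positivity) ?_ hq0.le
        rw [mul_assoc]
        exact mul_le_mul_of_nonneg_left (mesoScale_le (by linarith) ht1) hC.le
    _ = (C * 2) ^ q * t ^ (1 / ((d : ℝ) + 2 * p) * q) := by
        rw [Real.mul_rpow (by positivity) (by positivity), ← Real.rpow_mul ht0]
    _ ≤ κ * t := ht

theorem le_mesoScale_pow {t : ℝ} (ht : 0 ≤ t) :
    t ^ ((d : ℝ) / (d + 2 * p)) ≤ (mesoScale p d t : ℝ) ^ d := by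
  calc t ^ ((d : ℝ) / (d + 2 * p)) = (t ^ (1 / ((d : ℝ) + 2 * p))) ^ d := by
        rw [← Real.rpow_natCast, ← Real.rpow_mul ht]; congr 1; ring
    _ ≤ _ := pow_le_pow_left₀ (by positivity) (le_mesoScale p d t) d

/-- With `N` of order `t ^ (1 / (d + 2 p))` this is the exponent inequality `d + (p + 1) ≤ d + 2 p`,
where `1 < p` enters. -/
theorem rpow_le_div_mesoScale (hp : 1 < p) {t : ℝ} (ht : 1 ≤ t) :
    t ^ ((d : ℝ) / (d + 2 * p)) ≤ 2 ^ (p + 1) * (t / (mesoScale p d t : ℝ) ^ (p + 1)) := by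
  have ht0 : 0 < t := by linarith
  have hp0 : 0 < p := by linarith
  have hγ : 0 < (d : ℝ) + 2 * p := by positivity
  have hN : 0 < (mesoScale p d t : ℝ) := lt_of_lt_of_le (by positivity) (le_mesoScale p d t)
  have h1 : (mesoScale p d t : ℝ) ^ (p + 1) ≤
      2 ^ (p + 1) * t ^ (1 / ((d : ℝ) + 2 * p) * (p + 1)) := by
    rw [Real.rpow_mul ht0.le, ← Real.mul_rpow (by norm_num) (by positivity)]
    exact Real.rpow_le_rpow hN.le (mesoScale_le hp0 ht) (by linarith)
  rw [← mul_div_assoc, le_div_iff₀ (by positivity)]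
  calc t ^ ((d : ℝ) / (d + 2 * p)) * (mesoScale p d t : ℝ) ^ (p + 1)
      ≤ t ^ ((d : ℝ) / (d + 2 * p)) * (2 ^ (p + 1) * t ^ (1 / ((d : ℝ) + 2 * p) * (p + 1))) := by
        gcongr
    _ = 2 ^ (p + 1) * t ^ ((d : ℝ) / (d + 2 * p) + 1 / ((d : ℝ) + 2 * p) * (p + 1)) := by
        rw [Real.rpow_add ht0]; ring
    _ ≤ 2 ^ (p + 1) * t ^ (1 : ℝ) := by
        gcongr 2 ^ (p + 1) * ?_
        refine Real.rpow_le_rpow_of_exponent_le ht ?_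
        · rw [one_div_mul_eq_div, ← add_div, div_le_one hγ]
          linarith
    _ = _ := by rw [Real.rpow_one]

end UpperTail

/-! ### The upper tail from a single block length. -/

section UpperTailBound

variable {d : ℕ} {p : ℝ}

set_option maxHeartbeats 1000000 in
-- Failure requires either an empty ball of radius `N` around one of the division points, or a class
-- of blocks modulo `4 N` whose sum exceeds its mean appreciably. The number of such events is
-- linear in `t`, and each has probability at most `exp (-c₂ t ^ β)`.
theorem upper_tail_of_block (hp : 1 < p) (hd : 1 ≤ d) {u₀ v₀ : Pt d} (hr : 1 ≤ dist u₀ v₀)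
    {δ K : ℝ} (hδ : 0 ≤ δ) (hK0 : 0 < K)
    (hK : ∀ a b : ℝ, 0 ≤ a → 0 ≤ b → (a + b) ^ p ≤ (1 + δ) * a ^ p + K * b ^ p) {A₀ : ℝ}
    (hA₀ : (1 + δ) ^ 2 * meanLength p u₀ v₀ + 2 * (1 + δ) * K * voidMean p d < A₀ * dist u₀ v₀)
    {η : ℝ} (hη : 0 < η) :
    ∃ c : ℝ, 0 < c ∧ ∀ᶠ t : ℝ in atTop, ∀ x y : Pt d, dist x y = t → ∀ D : Set (Pt d),
      (∀ s ∈ segment ℝ x y, Metric.ball s (η * t) ⊆ D) →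
      (poissonLaw d).real {A | A₀ * t < shortestPathLength p x y (A.pts ∩ D)} ≤
        Real.exp (-(c * t ^ ((d : ℝ) / (d + 2 * p)))) := by
  have hp0 : 0 < p := by linarith
  set r := dist u₀ v₀ with hr_def
  have hr0 : 0 < r := by linarith
  set w₀ := (1 + δ) ^ 2 * meanLength p u₀ v₀ + 2 * (1 + δ) * K * voidMean p d with hw₀
  -- One share each for localizing the mean to radius `M`, for the Chernoff deviation, and for the
  -- final edge to `y`; the fourth is slack.
  set ε := (A₀ * r - w₀) / 4 with hε_def
  have hε : 0 < ε := by rw [hε_def]; linarith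
  have hw₀0 : 0 ≤ w₀ := by
    have h1 : 0 ≤ meanLength p u₀ v₀ := meanLength_nonneg _ _
    have h2 : 0 ≤ voidMean p d := voidMean_nonneg hp0
    rw [hw₀]; positivity
  obtain ⟨M, hM⟩ : ∃ M : ℕ, (1 + δ) ^ 2 * localMeanLength p M u₀ v₀ +
      2 * (1 + δ) * K * voidMean p d < w₀ + ε := by
    have h1 := ((tendsto_localMeanLength hp0 u₀ v₀).const_mul ((1 + δ) ^ 2)).add_const
      (2 * (1 + δ) * K * voidMean p d)
    exact (h1.eventually_lt_const (by rw [← hw₀]; linarith)).exists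
  set w := w₀ + ε with hw
  have hw0 : 0 ≤ w := by positivity
  obtain ⟨c₁, hc₁, hchern⟩ := exists_chernoff_bound hw0 hε
  set B₀ := (1 + δ) ^ 2 * r ^ p + 2 * (1 + δ) * K with hB₀
  have hB₀0 : 0 < B₀ := by rw [hB₀]; positivity
  have hv := unitVolume_pos d
  -- The smaller of the void rate and the Chernoff rate. The `8` is the `4` in the class length `4 r
  -- N`, doubled for the loss in rounding `n` down.
  set c₂ := min (unitVolume d) (c₁ / (8 * r * 2 ^ (p + 1) * B₀)) with hc₂
  have hc₂0 : 0 < c₂ := by rw [hc₂]; positivity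
  set β := (d : ℝ) / (d + 2 * p) with hβ
  have hdpos : (0 : ℝ) < d := by exact_mod_cast hd
  have hβ0 : 0 < β := by rw [hβ]; positivity
  refine ⟨c₂ / 2, by positivity, ?_⟩
  have hwb : ∀ (N : ℕ) (u v : Pt d), dist u v = r →
      ∫ A : Config d, blockCost p δ K M N u v A.pts ∂(poissonLaw d) ≤ w := by
    intro N u v huv
    refine (integral_blockCost_le hp0 hd hδ hK0.le N u v).trans ?_
    rw [localMeanLength_congr hp0 (M : ℝ) (huv.trans hr_def)]
    exact hM.le
  filter_upwards [eventually_ge_atTop 1, (tendsto_mesoScale (d := d) hp0).eventually_ge_atTop M,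
    (tendsto_mesoScale (d := d) hp0).eventually_ge_atTop (r + 1),
    eventually_mesoScale_rpow_le hp hd one_pos hp.le (C := 2) (by norm_num) hη,
    eventually_mesoScale_rpow_le hp hd one_pos hp.le (C := 4 * r) (by positivity) one_pos,
    eventually_mesoScale_rpow_le hp hd hp0 le_rfl (C := 5 * r) (by positivity)
      (by positivity : 0 < ε / r), eventually_mul_exp_le 9 1 hc₂0 hβ0]
    with t ht1 hNM hNr hNη hNt hNp hexp x y hxy D hD
  have ht0 : 0 < t := by linarith
  set N := mesoScale p d t with hN
  rw [Real.rpow_one] at hNη hNt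
  have hN1' : (1 : ℝ) ≤ N := by linarith
  have hN1 : 1 ≤ N := by exact_mod_cast hN1'
  set e : Pt d := t⁻¹ • (y - x) with he_def
  have he : ‖e‖ = 1 := by
    rw [he_def, norm_smul, norm_inv, Real.norm_eq_abs, abs_of_pos ht0, ← dist_eq_norm, dist_comm,
      hxy, inv_mul_cancel₀ ht0.ne']
  have hye : y = x + t • e := by
    rw [he_def, smul_inv_smul₀ ht0.ne']; abel
  -- `n` blocks in each of the `4 N` classes leave less than `4 r N` of the segment uncovered; with
  -- the displacement `N ≤ r N`, the last edge has length at most `5 r N`, and its `p`-th power is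
  -- `o(t)`.
  set n := ⌊t / (4 * r * N)⌋₊ with hn
  have h4rN : 0 < 4 * r * N := by positivity
  have hz : 1 ≤ t / (4 * r * N) := by rw [le_div_iff₀ h4rN]; linarith
  have hn_le : (n : ℝ) ≤ t / (4 * r * N) := Nat.floor_le (by positivity)
  have hn_gt : t / (4 * r * N) < n + 1 := Nat.lt_floor_add_one _
  have hn1 : (1 : ℝ) ≤ n := by exact_mod_cast (Nat.one_le_floor_iff _).2 hz
  set m := 4 * N * n with hm
  have hmr : (m : ℝ) * r = n * (4 * r * N) := by rw [hm]; push_cast; ring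
  have hmt : (m : ℝ) * r ≤ t := by rw [hmr]; rwa [le_div_iff₀ h4rN] at hn_le
  have hmt' : t < m * r + 4 * r * N := by
    rw [div_lt_iff₀ h4rN] at hn_gt
    rw [hmr]; linarith
  set X : ℕ → Pt d := fun i => x + ((i : ℕ) * r) • e with hX
  have hXseg : ∀ i ≤ m, X i ∈ segment ℝ x y := by
    intro i hi
    rw [segment_eq_image']
    refine ⟨(i * r) / t, ⟨by positivity, ?_⟩, ?_⟩
    · rw [div_le_one ht0]
      refine le_trans ?_ hmt
      gcongr
    · have hyx : y - x = t • e := by rw [hye, add_sub_cancel_left]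
      simp only [hyx, hX, smul_smul, div_mul_cancel₀ _ ht0.ne']
  have hXD : ∀ i ≤ m, ∀ ρ : ℝ, ρ ≤ N → Metric.ball (X i) ρ ⊆ D := by
    intro i hi ρ hρ
    refine (Metric.ball_subset_ball ?_).trans (hD _ (hXseg i hi))
    linarith
  have hXm : dist (X m) y ≤ 4 * r * N := by
    rw [hye, hX, dist_add_left, dist_eq_norm, ← sub_smul, norm_smul, he, mul_one, Real.norm_eq_abs,
      abs_of_nonpos (by linarith)]
    linarith
  let W : ℕ → Config d → ℝ := fun i A => blockCost p δ K M N (X i) (X (i + 1)) A.pts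
  let S₁ : Set (Config d) := ⋃ i ∈ Finset.range m, voidEvent (Metric.ball (X (i + 1)) N)
  let S₂ : Set (Config d) := ⋃ j ∈ Finset.range (4 * N),
    {A | (w + ε) * n ≤ ∑ l ∈ Finset.range n, W (j + 4 * N * l) A}
  have hsub : {A : Config d | A₀ * t < shortestPathLength p x y (A.pts ∩ D)} ⊆ S₁ ∪ S₂ := by
    intro A hA
    by_contra hcon
    rw [Set.mem_union, not_or] at hcon
    obtain ⟨h1, h2⟩ := hcon
    simp only [S₁, S₂, Set.mem_iUnion, Finset.mem_range, exists_prop, not_exists, not_and,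
      Set.mem_ofPred_eq, not_le] at h1 h2
    have hb := shortestPathLength_le_sum_blockCost (A := A.pts) (A' := A.pts ∩ D) (M := M) hp0 hδ
      hK0.le hK X N m (fun i hi => Set.inter_subset_inter_right _ (hXD i hi.le _ hNM))
      (fun i hi => Set.inter_subset_inter_right _ (hXD i hi _ le_rfl)) (fun i hi1 him => by
        have := h1 (i - 1) (by omega)
        rwa [Nat.sub_add_cancel hi1] at this) y
    have hX0 : X 0 = x := by simp [hX]
    rw [hX0, hm, sum_range_mul_eq] at hb
    have hb2 : ∑ j ∈ Finset.range (4 * N), ∑ l ∈ Finset.range n,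
        blockCost p δ K M N (X (j + 4 * N * l)) (X (j + 4 * N * l + 1)) A.pts ≤
        (t / r) * (w + ε) := by
      calc _ ≤ ∑ j ∈ Finset.range (4 * N), (w + ε) * n :=
            Finset.sum_le_sum fun j hj => (h2 j (Finset.mem_range.1 hj)).le
        _ = (m : ℝ) * (w + ε) := by
            rw [Finset.sum_const, Finset.card_range, nsmul_eq_mul, hm]; push_cast; ring
        _ ≤ _ := by
            gcongr
            rw [le_div_iff₀ hr0]; exact hmt
    have hb3 : (dist (X (4 * N * n)) y + N) ^ p ≤ ε / r * t := by
      refine le_trans (Real.rpow_le_rpow (by positivity) ?_ hp0.le) hNp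
      have : (N : ℝ) ≤ r * N := le_mul_of_one_le_left (by linarith) hr
      rw [← hm]
      linarith
    have h5 : A₀ * t < (t / r) * (w + ε) + ε / r * t := by
      have : A₀ * t < shortestPathLength p x y (A.pts ∩ D) := hA
      linarith
    have h6 : (t / r) * (w + ε) + ε / r * t = (w₀ + 3 * ε) * t / r := by
      rw [hw]; field_simp; ring
    rw [h6, lt_div_iff₀ hr0] at h5
    have h7 : w₀ + 3 * ε ≤ A₀ * r := by linarith
    have h8 := mul_le_mul_of_nonneg_right h7 ht0.le
    linarith
  have hE0 : Real.exp (-(unitVolume d * (N : ℝ) ^ d)) ≤ Real.exp (-(c₂ * t ^ β)) := by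
    rw [Real.exp_le_exp, neg_le_neg_iff]
    have h1 : c₂ ≤ unitVolume d := min_le_left _ _
    have h2 := le_mesoScale_pow (d := d) (p := p) ht0.le
    gcongr
  have hE1 : Real.exp (-(c₁ * (n / (B₀ * (N : ℝ) ^ p)))) ≤ Real.exp (-(c₂ * t ^ β)) := by
    rw [Real.exp_le_exp, neg_le_neg_iff]
    have h1 : c₂ ≤ c₁ / (8 * r * 2 ^ (p + 1) * B₀) := min_le_right _ _
    have h2 := rpow_le_div_mesoScale (d := d) hp ht1
    have hNp1 : (N : ℝ) ^ (p + 1) = N ^ p * N := by rw [Real.rpow_add_one (by positivity)]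
    calc c₂ * t ^ β ≤ c₁ / (8 * r * 2 ^ (p + 1) * B₀) *
          (2 ^ (p + 1) * (t / (N : ℝ) ^ (p + 1))) := by gcongr
      _ = c₁ * ((t / (4 * r * N) / 2) / (B₀ * (N : ℝ) ^ p)) := by
          rw [hNp1]; field_simp; norm_num
      _ ≤ _ := by gcongr; linarith
  have hS₁ : (poissonLaw d).real S₁ ≤ t * Real.exp (-(c₂ * t ^ β)) := by
    refine (measureReal_biUnion_finset_le _ _).trans ?_
    have : ∀ i ∈ Finset.range m, (poissonLaw d).real (voidEvent (Metric.ball (X (i + 1)) N)) ≤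
        Real.exp (-(c₂ * t ^ β)) := by
      intro i _
      rw [poissonLaw_real_voidEvent_ball, volume_real_ball _ (Nat.cast_nonneg N) hd, mul_comm]
      exact hE0
    refine (Finset.sum_le_sum this).trans ?_
    rw [Finset.sum_const, Finset.card_range, nsmul_eq_mul]
    gcongr
    exact (le_mul_of_one_le_right (Nat.cast_nonneg m) hr).trans hmt
  have hS₂ : (poissonLaw d).real S₂ ≤ (8 * t) * Real.exp (-(c₂ * t ^ β)) := by
    refine (measureReal_biUnion_finset_le _ _).trans ?_
    have : ∀ j ∈ Finset.range (4 * N), (poissonLaw d).real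
        {A | (w + ε) * n ≤ ∑ l ∈ Finset.range n, W (j + 4 * N * l) A} ≤
        Real.exp (-(c₂ * t ^ β)) := fun j _ =>
      (measure_class_sum_le hp0 hδ hK0.le hr hchern hwb he x hN1 hNM j n).trans hE1
    refine (Finset.sum_le_sum this).trans ?_
    rw [Finset.sum_const, Finset.card_range, nsmul_eq_mul]
    gcongr
    push_cast
    have : (N : ℝ) ≤ r * N := le_mul_of_one_le_left (by linarith) hr
    linarith
  calc _ ≤ (poissonLaw d).real (S₁ ∪ S₂) := measureReal_mono hsub
    _ ≤ (poissonLaw d).real S₁ + (poissonLaw d).real S₂ := measureReal_union_le _ _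
    _ ≤ 9 * t ^ (1 : ℝ) * Real.exp (-(c₂ * t ^ β)) := by rw [Real.rpow_one]; linarith
    _ ≤ _ := hexp

end UpperTailBound

/-! ### Existence of the time constant. -/

section TimeConstant

variable {d : ℕ} {p : ℝ}

theorem dist_zero_smul {e : Pt d} (he : ‖e‖ = 1) {t : ℝ} (ht : 0 ≤ t) :
    dist (0 : Pt d) (t • e) = t := by
  rw [dist_zero_left, norm_smul, he, mul_one, Real.norm_eq_abs, abs_of_nonneg ht]

/-- On the exceptional event the direct edge bounds the length. -/
theorem meanLength_le_of_tail (hp : 0 < p) {a : ℝ} (ha : 0 ≤ a) {x y : Pt d} :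
    meanLength p x y ≤ a + dist x y ^ p *
      (poissonLaw d).real {A | a < shortestPathLength p x y A.pts} := by
  have hS : MeasurableSet {A : Config d | a < shortestPathLength p x y A.pts} :=
    measurableSet_lt measurable_const (measurable_shortestPathLength hp x y)
  have h1 : meanLength p x y ≤ ∫ A, (a + {A : Config d | a < shortestPathLength p x y A.pts}.indicator
      (fun _ => dist x y ^ p) A) ∂(poissonLaw d) := by
    refine integral_mono (integrable_shortestPathLength hp x y)
      ((integrable_const _).add ((integrable_const _).indicator hS)) fun A => ?_
    by_cases hA : a < shortestPathLength p x y A.pts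
    · simp only [Set.indicator, Set.mem_ofPred_eq, hA, if_true]
      exact shortestPathLength_le_dist.trans (by linarith)
    · simp only [Set.indicator, Set.mem_ofPred_eq, hA, if_false]
      linarith
  rw [integral_add (integrable_const _) ((integrable_const _).indicator hS),
    integral_indicator_const _ hS] at h1
  simpa [mul_comm] using h1

theorem eventually_meanLength_le (hp : 0 < p) (hd : 1 ≤ d) {a c : ℝ} (ha : 0 ≤ a) (hc : 0 < c)
    (h : ∀ᶠ t : ℝ in atTop, ∀ x y : Pt d, dist x y = t → ∀ D : Set (Pt d),
      (∀ s ∈ segment ℝ x y, Metric.ball s (1 * t) ⊆ D) →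
      (poissonLaw d).real {A | a * t < shortestPathLength p x y (A.pts ∩ D)} ≤
        Real.exp (-(c * t ^ ((d : ℝ) / (d + 2 * p))))) :
    ∀ᶠ t : ℝ in atTop, ∀ x y : Pt d, dist x y = t → meanLength p x y ≤ a * t + 1 := by
  have hdpos : (0 : ℝ) < d := by exact_mod_cast hd
  have hβ0 : 0 < (d : ℝ) / (d + 2 * p) := by positivity
  filter_upwards [h, eventually_mul_exp_le 1 p hc hβ0, eventually_ge_atTop 0] with t ht hexp ht0 x y hxy
  have h1 := ht x y hxy Set.univ fun _ _ => Set.subset_univ _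
  simp only [Set.inter_univ] at h1
  refine (meanLength_le_of_tail hp (mul_nonneg ha ht0)).trans ?_
  rw [hxy]
  have h2 : t ^ p * Real.exp (-(c * t ^ ((d : ℝ) / (d + 2 * p)))) ≤ 1 := by
    rw [one_mul] at hexp
    refine hexp.trans (Real.exp_le_one_iff.2 ?_)
    have : 0 ≤ c / 2 * t ^ ((d : ℝ) / (d + 2 * p)) := by positivity
    linarith
  have h3 := mul_le_mul_of_nonneg_left h1 (by positivity : 0 ≤ t ^ p)
  linarith

/-- One block length suffices, so it can be chosen among arbitrarily large scales where the
normalized mean is below `C + ε`. Taking also `r ≥ V / ε` makes the void term at most `ε` per unit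
length. -/
theorem upper_tail_of_frequently (hp : 1 < p) (hd : 1 ≤ d) {e : Pt d} (he : ‖e‖ = 1) {C : ℝ}
    (hC : ∀ ε > 0, ∃ᶠ t : ℝ in atTop, meanLength p 0 (t • e) / t < C + ε)
    {A₀ : ℝ} (hA₀ : C < A₀) {η : ℝ} (hη : 0 < η) :
    ∃ c : ℝ, 0 < c ∧ ∀ᶠ t : ℝ in atTop, ∀ x y : Pt d, dist x y = t → ∀ D : Set (Pt d),
      (∀ s ∈ segment ℝ x y, Metric.ball s (η * t) ⊆ D) →
      (poissonLaw d).real {A | A₀ * t < shortestPathLength p x y (A.pts ∩ D)} ≤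
        Real.exp (-(c * t ^ ((d : ℝ) / (d + 2 * p)))) := by
  have hp0 : 0 < p := by linarith
  set ε := (A₀ - C) / 4 with hε_def
  have hε : 0 < ε := by rw [hε_def]; linarith
  obtain ⟨δ, hδ, hδ0⟩ : ∃ δ : ℝ, (1 + δ) ^ 2 * (C + ε) < C + 2 * ε ∧ 0 < δ := by
    have h1 : Tendsto (fun δ : ℝ => (1 + δ) ^ 2 * (C + ε)) (𝓝[>] 0) (𝓝 ((1 + 0) ^ 2 * (C + ε))) :=
      (Continuous.tendsto (by fun_prop) 0).mono_left nhdsWithin_le_nhds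
    have h2 : (1 + 0) ^ 2 * (C + ε) < C + 2 * ε := by linarith
    exact ((h1.eventually_lt_const h2).and self_mem_nhdsWithin).exists
  obtain ⟨K, hK1, hK⟩ := exists_add_rpow_le hp0 hδ0
  set V := 2 * (1 + δ) * K * voidMean p d with hV
  obtain ⟨r, hr1, hr2, hr3⟩ := ((hC ε hε).and_eventually
    ((eventually_ge_atTop 1).and (eventually_ge_atTop (V / ε)))).exists
  have hr0 : 0 < r := by linarith
  have hdist := dist_zero_smul he hr0.le
  refine upper_tail_of_block (u₀ := 0) (v₀ := r • e) hp hd (by rwa [hdist]) hδ0.le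
    (by linarith) hK ?_ hη
  rw [hdist]
  rw [div_lt_iff₀ hr0] at hr1
  rw [div_le_iff₀ hε] at hr3
  have h1 : (1 + δ) ^ 2 * meanLength p 0 (r • e) ≤ (C + 2 * ε) * r := by
    calc _ ≤ (1 + δ) ^ 2 * ((C + ε) * r) := by gcongr
      _ = ((1 + δ) ^ 2 * (C + ε)) * r := by ring
      _ ≤ _ := by gcongr
  have h2 : A₀ = C + 4 * ε := by rw [hε_def]; ring
  rw [h2]
  nlinarith

theorem eventually_meanLength_div_le (hp : 1 < p) (hd : 1 ≤ d) {e : Pt d} (he : ‖e‖ = 1) {C : ℝ}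
    (hC : ∀ ε > 0, ∃ᶠ t : ℝ in atTop, meanLength p 0 (t • e) / t < C + ε) (hC0 : 0 ≤ C)
    {A₀ : ℝ} (hA₀ : C < A₀) :
    ∀ᶠ t : ℝ in atTop, meanLength p 0 (t • e) / t ≤ A₀ := by
  obtain ⟨c, hc, h⟩ := upper_tail_of_frequently hp hd he hC
    (by linarith : C < (C + A₀) / 2) one_pos
  filter_upwards [eventually_meanLength_le (by linarith) hd (by linarith) hc h,
    eventually_gt_atTop 0, eventually_ge_atTop (2 / (A₀ - C))] with t ht ht0 ht1
  have h1 := ht 0 (t • e) (dist_zero_smul he ht0.le)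
  rw [div_le_iff₀ (by linarith)] at ht1
  rw [div_le_iff₀ ht0]
  nlinarith

/-- The time constant of the homogeneous Poisson model exists. -/
theorem exists_tendsto_meanLength_div (hp : 1 < p) (hd : 1 ≤ d) {e : Pt d} (he : ‖e‖ = 1) :
    ∃ C : ℝ, 0 ≤ C ∧ Tendsto (fun t : ℝ => meanLength p 0 (t • e) / t) atTop (𝓝 C) := by
  have hp0 : 0 < p := by linarith
  set b : ℝ → ℝ := fun t => meanLength p 0 (t • e) / t with hb
  have hb0 : ∀ᶠ t in atTop, 0 ≤ b t := by
    filter_upwards [eventually_ge_atTop 0] with t ht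
    exact div_nonneg (meanLength_nonneg _ _) ht
  -- A crude bound with blocks of unit length makes the normalized means bounded, so that their
  -- liminf is meaningful.
  obtain ⟨A₁, hA₁⟩ : ∃ A₁ : ℝ, ∀ᶠ t in atTop, b t ≤ A₁ := by
    obtain ⟨K, hK1, hK⟩ := exists_add_rpow_le hp0 one_pos
    have hdist := dist_zero_smul he zero_le_one
    set a := |(1 + 1) ^ 2 * meanLength p 0 ((1 : ℝ) • e) + 2 * (1 + 1) * K * voidMean p d| + 1 with ha
    have ha0 : 0 ≤ a := by positivity
    obtain ⟨c, hc, h⟩ := upper_tail_of_block (u₀ := 0) (v₀ := (1 : ℝ) • e) (A₀ := a) hp hd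
      hdist.ge zero_le_one (by linarith) hK (by
        rw [hdist, mul_one, ha]
        have := le_abs_self ((1 + 1) ^ 2 * meanLength p 0 ((1 : ℝ) • e) +
          2 * (1 + 1) * K * voidMean p d)
        linarith) one_pos
    refine ⟨a + 1, ?_⟩
    filter_upwards [eventually_meanLength_le hp0 hd ha0 hc h, eventually_ge_atTop 1] with t ht ht1
    have h1 := ht 0 (t • e) (dist_zero_smul he (by linarith))
    rw [hb]
    simp only
    rw [div_le_iff₀ (by linarith)]
    nlinarith
  have hbd1 : IsBoundedUnder (· ≤ ·) atTop b := ⟨A₁, hA₁⟩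
  have hbd2 : IsBoundedUnder (· ≥ ·) atTop b := ⟨0, hb0⟩
  -- The upper tail holds at every level above the liminf and bounds the means in turn, so the
  -- limsup does not exceed the liminf.
  set C := liminf b atTop with hC
  have hC0 : 0 ≤ C := le_liminf_of_le hbd1.isCoboundedUnder_ge hb0
  have hfreq : ∀ ε > 0, ∃ᶠ t : ℝ in atTop, meanLength p 0 (t • e) / t < C + ε := fun ε hε =>
    frequently_lt_of_liminf_lt hbd1.isCoboundedUnder_ge (by linarith)
  refine ⟨C, hC0, ?_⟩
  rw [tendsto_order]
  refine ⟨fun a ha => eventually_lt_of_lt_liminf ha hbd2, fun a ha => ?_⟩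
  filter_upwards [eventually_meanLength_div_le hp hd he hfreq hC0
    (by linarith : C < (C + a) / 2)] with t ht
  linarith

theorem upper_tail (hp : 1 < p) (hd : 1 ≤ d) {e : Pt d} (he : ‖e‖ = 1) {C : ℝ}
    (hC : Tendsto (fun t : ℝ => meanLength p 0 (t • e) / t) atTop (𝓝 C))
    {A₀ : ℝ} (hA₀ : C < A₀) {η : ℝ} (hη : 0 < η) :
    ∃ c : ℝ, 0 < c ∧ ∀ᶠ t : ℝ in atTop, ∀ x y : Pt d, dist x y = t → ∀ D : Set (Pt d),
      (∀ s ∈ segment ℝ x y, Metric.ball s (η * t) ⊆ D) →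
      (poissonLaw d).real {A | A₀ * t < shortestPathLength p x y (A.pts ∩ D)} ≤
        Real.exp (-(c * t ^ ((d : ℝ) / (d + 2 * p)))) :=
  upper_tail_of_frequently hp hd he (fun ε hε =>
    (hC.eventually_lt_const (by linarith : C < C + ε)).frequently) hA₀ hη

/-- A Markov argument for `(C + ε₁) t - L`, which is negative only on the upper tail event. Its mean
is at most `2 ε₁ t`, and correcting on that event costs at most a further `ε₁ t`; hence `ε₁ = κ ε /
3`. -/
theorem eventually_lower_prob_le (hp : 1 < p) (hd : 1 ≤ d) {e : Pt d} (he : ‖e‖ = 1) {C : ℝ}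
    (hC : Tendsto (fun t : ℝ => meanLength p 0 (t • e) / t) atTop (𝓝 C)) (hC0 : 0 ≤ C)
    {ε : ℝ} (hε : 0 < ε) {κ : ℝ} (hκ : 0 < κ) :
    ∀ᶠ t : ℝ in atTop, ∀ x y : Pt d, dist x y = t →
      (poissonLaw d).real {A | shortestPathLength p x y A.pts < (C - ε) * t} ≤ κ := by
  have hp0 : 0 < p := by linarith
  have hdpos : (0 : ℝ) < d := by exact_mod_cast hd
  have hβ0 : 0 < (d : ℝ) / (d + 2 * p) := by positivity
  set ε₁ := κ * ε / 3 with hε₁_def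
  have hε₁ : 0 < ε₁ := by positivity
  obtain ⟨c, hc, h⟩ := upper_tail hp hd he hC (by linarith : C < C + ε₁) one_pos
  filter_upwards [h, eventually_mul_exp_le 1 p hc hβ0, eventually_gt_atTop 0,
    eventually_ge_atTop (1 / ε₁), hC.eventually_const_lt (by linarith : C - ε₁ < C)]
    with t ht hexp ht0 ht1 hmean x y hxy
  have h1 := ht x y hxy Set.univ fun _ _ => Set.subset_univ _
  simp only [Set.inter_univ] at h1
  have h2 : t ^ p * Real.exp (-(c * t ^ ((d : ℝ) / (d + 2 * p)))) ≤ 1 := by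
    rw [one_mul] at hexp
    refine hexp.trans (Real.exp_le_one_iff.2 ?_)
    have : 0 ≤ c / 2 * t ^ ((d : ℝ) / (d + 2 * p)) := by positivity
    linarith
  have h3 := mul_le_mul_of_nonneg_left h1 (by positivity : 0 ≤ t ^ p)
  rw [lt_div_iff₀ ht0, meanLength_congr hp0 ((dist_zero_smul he ht0.le).trans hxy.symm)] at hmean
  rw [div_le_iff₀ hε₁] at ht1
  have hm := measurable_shortestPathLength hp0 x y
  have hS : MeasurableSet {A : Config d | (C + ε₁) * t < shortestPathLength p x y A.pts} :=
    measurableSet_lt measurable_const hm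
  have hT : MeasurableSet {A : Config d | shortestPathLength p x y A.pts < (C - ε) * t} :=
    measurableSet_lt hm measurable_const
  have hiL := integrable_shortestPathLength hp0 x y
  have hi1 : Integrable ({A : Config d | shortestPathLength p x y A.pts <
      (C - ε) * t}.indicator fun _ => ε * t) (poissonLaw d) := (integrable_const _).indicator hT
  have hi2 : Integrable ({A : Config d | (C + ε₁) * t <
      shortestPathLength p x y A.pts}.indicator fun _ => t ^ p) (poissonLaw d) :=
    (integrable_const _).indicator hS
  have hi3 : Integrable (fun A : Config d => (C + ε₁) * t - shortestPathLength p x y A.pts)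
    (poissonLaw d) := (integrable_const _).sub hiL
  have hCt : 0 ≤ (C + ε₁) * t := by positivity
  have hεt : 0 < ε * t := by positivity
  have hε₁t : 0 < ε₁ * t := by positivity
  have hmono := integral_mono hi1 (hi3.add hi2) (fun A => by
    have hA0 : 0 ≤ shortestPathLength p x y A.pts := shortestPathLength_nonneg
    have hAt : shortestPathLength p x y A.pts ≤ t ^ p := by
      rw [← hxy]; exact shortestPathLength_le_dist
    have htp : 0 ≤ t ^ p := by positivity
    simp only [Set.indicator, Set.mem_ofPred_eq, Pi.add_apply]
    split_ifs <;> nlinarith)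
  rw [integral_indicator_const _ hT] at hmono
  have hadd : ∫ A, ((fun A : Config d => (C + ε₁) * t - shortestPathLength p x y A.pts) +
      {A : Config d | (C + ε₁) * t < shortestPathLength p x y A.pts}.indicator
        fun _ => t ^ p) A ∂(poissonLaw d) = (C + ε₁) * t - meanLength p x y +
      (poissonLaw d).real {A : Config d | (C + ε₁) * t < shortestPathLength p x y A.pts} * t ^ p := by
    rw [integral_add' hi3 hi2, integral_sub (integrable_const _) hiL,
      integral_indicator_const _ hS]
    simp [meanLength]
  rw [hadd, smul_eq_mul] at hmono
  have h4 : (poissonLaw d).real {A | shortestPathLength p x y A.pts < (C - ε) * t} * (ε * t) ≤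
      κ * (ε * t) := by
    have : κ * (ε * t) = 3 * (ε₁ * t) := by rw [hε₁_def]; ring
    rw [this]
    nlinarith
  exact le_of_mul_le_mul_right h4 hεt

end TimeConstant

/-! ### Coarse-graining a path into a chain of cells. -/

section Cells

variable {d : ℕ} {p : ℝ}

/-- The lattice point `h • k` in `ℝ^d`. -/
noncomputable def cellCenter (h : ℝ) {d : ℕ} (k : Fin d → ℤ) : Pt d :=
  WithLp.toLp 2 fun i => h * k i

/-- The lattice cell containing a point. -/
noncomputable def cellOf (h : ℝ) {d : ℕ} (u : Pt d) : Fin d → ℤ := fun i => ⌊u i / h⌋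

theorem cellCenter_add (h : ℝ) (k v : Fin d → ℤ) :
    cellCenter h (k + v) = cellCenter h k + cellCenter h v := by
  ext i; simp [cellCenter, mul_add]

theorem norm_le_of_forall_abs_le {u : Pt d} {a : ℝ} (h : ∀ i, |u i| ≤ a) :
    ‖u‖ ≤ d * a := by
  have h1 : ‖u‖ ≤ ∑ i : Fin d, |u i| := by
    rw [EuclideanSpace.norm_eq]
    refine Real.sqrt_le_iff.2 ⟨by positivity, ?_⟩
    simp only [Real.norm_eq_abs]
    exact Finset.sum_sq_le_sq_sum_of_nonneg fun i _ => abs_nonneg _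
  refine h1.trans ((Finset.sum_le_sum fun i _ => h i).trans ?_)
  simp

theorem dist_cellCenter_cellOf_le {h : ℝ} (hh : 0 < h) (u : Pt d) :
    dist u (cellCenter h (cellOf h u)) ≤ d * h := by
  rw [dist_eq_norm]
  refine norm_le_of_forall_abs_le fun i => ?_
  have h1 := Int.floor_le (u i / h)
  have h2 := Int.lt_floor_add_one (u i / h)
  rw [le_div_iff₀ hh] at h1
  rw [div_lt_iff₀ hh] at h2
  simp only [PiLp.sub_apply, cellCenter, cellOf]
  rw [abs_le]
  constructor <;> nlinarith

theorem abs_apply_le_norm (u : Pt d) (i : Fin d) : |u i| ≤ ‖u‖ := by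
  have := PiLp.norm_apply_le u i
  rwa [Real.norm_eq_abs] at this

/-- The event that the ball around `c` can be crossed cheaply from near its center. -/
def CheapCrossing (p ρ r a : ℝ) (c : Pt d) (A : Set (Pt d)) : Prop :=
  ∃ w ∈ {w : Pt d × Pt d | dist w.1 c ≤ ρ ∧ dist w.2 c = r},
    shortestPathLength p w.1 w.2 (A ∩ Metric.ball c r) < a

/-- A coarse step of a path, from the point `a` near the center of the cell `k`, to the cell
`k + v`. -/
structure CoarseStep (p h r : ℝ) (A : Set (Pt d)) (a : Pt d) (k v : Fin d → ℤ) (s : ℝ) : Prop where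
  nonneg : 0 ≤ s
  le_norm : r - d * h ≤ ‖cellCenter h v‖
  overshoot : r + d * h ≤ ‖cellCenter h v‖ → (‖cellCenter h v‖ - r - d * h) ^ p ≤ s
  crossing : ∃ b, dist b (cellCenter h k) = r ∧
    shortestPathLength p a b (A ∩ Metric.ball (cellCenter h k) r) ≤ s

/-- A chain of coarse steps with the list of increments `l`. -/
inductive CoarseChain (p h r : ℝ) (A : Set (Pt d)) : (Fin d → ℤ) → List (Fin d → ℤ) → ℝ → Prop
  | nil (k : Fin d → ℤ) : CoarseChain p h r A k [] 0
  | cons (k v : Fin d → ℤ) (l : List (Fin d → ℤ)) (a : Pt d) (s s' : ℝ)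
      (ha : dist a (cellCenter h k) ≤ d * h) (hs : CoarseStep p h r A a k v s)
      (hl : CoarseChain p h r A (k + v) l s') : CoarseChain p h r A k (v :: l) (s + s')

/-- The cells visited when starting from `k` with increments `l`. -/
def visitedCells : (Fin d → ℤ) → List (Fin d → ℤ) → List (Fin d → ℤ)
  | k, [] => [k]
  | k, v :: l => k :: visitedCells (k + v) l

theorem exists_mem_sphere_dist_le {a z c : Pt d} {r : ℝ} (ha : dist a c < r) (hz : r ≤ dist z c) :
    ∃ b, dist b c = r ∧ dist a b ≤ dist a z := by
  have hcont : ContinuousOn (fun b => dist b c) (segment ℝ a z) := by fun_prop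
  have hconn : IsPreconnected (segment ℝ a z) := (convex_segment a z).isPreconnected
  obtain ⟨b, hb, hbr⟩ := hconn.intermediate_value (left_mem_segment ℝ a z)
    (right_mem_segment ℝ a z) hcont ⟨ha.le, hz⟩
  refine ⟨b, hbr, ?_⟩
  have := dist_add_dist_of_mem_segment hb
  linarith [dist_nonneg (x := b) (y := z)]

/-- The edge leaves the ball through a point of the sphere no farther from `a` than `z` is. The part
of the increment beyond `r`, up to the cell size, must be covered by the edge itself. -/
theorem coarseStep_of_edge (hp : 0 < p) {h r : ℝ} (hh : 0 < h) {A : Set (Pt d)} {a z : Pt d}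
    {k : Fin d → ℤ} (ha : dist a (cellCenter h k) < r) (hz : r ≤ dist z (cellCenter h k)) :
    CoarseStep p h r A a k (cellOf h z - k) (dist a z ^ p) := by
  have hv : ‖cellCenter h (cellOf h z - k)‖ =
      dist (cellCenter h (cellOf h z)) (cellCenter h k) := by
    rw [dist_eq_norm]
    congr 1
    ext i; simp [cellCenter, mul_sub]
  have h1 := dist_cellCenter_cellOf_le hh z
  have t1 := dist_triangle z (cellCenter h (cellOf h z)) (cellCenter h k)
  have t2 := dist_triangle (cellCenter h (cellOf h z)) z (cellCenter h k)
  have t3 := dist_triangle z a (cellCenter h k)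
  rw [dist_comm (cellCenter h (cellOf h z)) z] at t2
  rw [dist_comm z a] at t3
  refine ⟨by positivity, by rw [hv]; linarith, fun hov => ?_, ?_⟩
  · rw [hv] at hov ⊢
    exact Real.rpow_le_rpow (by linarith) (by linarith) hp.le
  · obtain ⟨b, hb, hab⟩ := exists_mem_sphere_dist_le ha hz
    exact ⟨b, hb, shortestPathLength_le_dist.trans (Real.rpow_le_rpow dist_nonneg hab hp.le)⟩

/-- Follow the path to its first node outside the ball, then recentre at the cell of that node. The
first step is kept apart from the chain because in the induction its start may be anywhere in the
ball, whereas steps in a chain start within `d * h` of their centre. -/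
theorem exists_coarseChain_aux (hp : 0 < p) {h r : ℝ} (hh : 0 < h) (hr : d * h < r)
    {A : Set (Pt d)} {a y : Pt d} {s : ℝ} (hs : PathCost p A a y s) :
    ∀ k : Fin d → ℤ, dist a (cellCenter h k) < r → dist y (cellCenter h k) < r ∨
      ∃ v s₁ l s₂, CoarseStep p h r A a k v s₁ ∧ CoarseChain p h r A (k + v) l s₂ ∧
        dist y (cellCenter h (k + v + l.sum)) < r ∧ s₁ + s₂ ≤ s := by
  induction hs with
  | edge a y =>
    intro k hk
    by_cases hy : dist y (cellCenter h k) < r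
    · exact Or.inl hy
    · refine Or.inr ⟨_, _, [], 0, coarseStep_of_edge hp hh hk (not_lt.1 hy), .nil _, ?_, by simp⟩
      simp only [add_sub_cancel, List.sum_nil, add_zero]
      exact (dist_cellCenter_cellOf_le hh y).trans_lt hr
  | cons a a' y s ha' hs ih =>
    intro k hk
    have hs0 := hs.nonneg
    by_cases ha : dist a' (cellCenter h k) < r
    · rcases ih k ha with hy | ⟨v, s₁, l, s₂, h₁, h₂, hy, hle⟩
      · exact Or.inl hy
      · refine Or.inr ⟨v, dist a a' ^ p + s₁, l, s₂, ⟨?_, h₁.le_norm, fun hov => ?_, ?_⟩, h₂, hy,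
          by linarith⟩
        · have := h₁.nonneg; positivity
        · exact (h₁.overshoot hov).trans (le_add_of_nonneg_left (by positivity))
        · obtain ⟨b, hb, hb'⟩ := h₁.crossing
          refine ⟨b, hb, (shortestPathLength_triangle hp
            (⟨ha', ha⟩ : a' ∈ A ∩ Metric.ball (cellCenter h k) r)).trans ?_⟩
          exact add_le_add shortestPathLength_le_dist hb'
    · refine Or.inr ⟨cellOf h a' - k, dist a a' ^ p, ?_⟩
      have hstep := coarseStep_of_edge (A := A) hp hh hk (not_lt.1 ha)
      have hnear := dist_cellCenter_cellOf_le hh a'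
      rcases ih (cellOf h a') (hnear.trans_lt hr) with hy | ⟨v, s₁, l, s₂, h₁, h₂, hy, hle⟩
      · refine ⟨[], 0, hstep, .nil _, ?_, by linarith⟩
        simpa using hy
      · refine ⟨v :: l, s₁ + s₂, hstep, ?_, ?_, by linarith⟩
        · rw [add_sub_cancel]
          exact .cons _ v l a' s₁ s₂ hnear h₁ h₂
        · rw [add_sub_cancel, List.sum_cons, ← add_assoc]
          exact hy

theorem exists_coarseChain (hp : 0 < p) {h r : ℝ} (hh : 0 < h) (hr : d * h < r)
    {A : Set (Pt d)} {x y : Pt d} {s : ℝ} (hs : PathCost p A x y s) :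
    ∃ l s', CoarseChain p h r A (cellOf h x) l s' ∧ s' ≤ s ∧
      dist y (cellCenter h (cellOf h x + l.sum)) < r := by
  have hnear := dist_cellCenter_cellOf_le hh x
  rcases exists_coarseChain_aux hp hh hr hs _ (hnear.trans_lt hr) with
    hy | ⟨v, s₁, l, s₂, h₁, h₂, hy, hle⟩
  · exact ⟨[], 0, .nil _, hs.nonneg, by simpa using hy⟩
  · refine ⟨v :: l, s₁ + s₂, .cons _ v l x s₁ s₂ hnear h₁ h₂, hle, ?_⟩
    rw [List.sum_cons, ← add_assoc]
    exact hy

theorem CoarseChain.exists_suffix {h r : ℝ} {A : Set (Pt d)} {k : Fin d → ℤ}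
    {l : List (Fin d → ℤ)} {s : ℝ} (hc : CoarseChain p h r A k l s) {j : Fin d → ℤ}
    (hj : j ∈ visitedCells k l) :
    ∃ l' s', CoarseChain p h r A j l' s' ∧ s' ≤ s ∧ j + l'.sum = k + l.sum ∧
      (visitedCells j l').Sublist (visitedCells k l) := by
  induction hc with
  | nil k =>
    simp only [visitedCells, List.mem_singleton] at hj
    subst hj
    exact ⟨[], 0, .nil _, le_rfl, rfl, List.Sublist.refl _⟩
  | cons k v l a s s' ha hs hl ih =>
    simp only [visitedCells, List.mem_cons] at hj
    rcases hj with rfl | hj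
    · exact ⟨v :: l, s + s', .cons _ _ _ a _ _ ha hs hl, le_rfl, rfl, List.Sublist.refl _⟩
    · obtain ⟨l', s'', h1, h2, h3, h4⟩ := ih hj
      refine ⟨l', s'', h1, ?_, ?_, h4.trans (List.sublist_cons_self _ _)⟩
      · linarith [hs.nonneg]
      · rw [h3, List.sum_cons, add_assoc]

/-- Loop erasure: when the current cell is visited again, the part of the chain before that visit is
dropped, which cannot increase the cost. -/
theorem CoarseChain.exists_nodup {h r : ℝ} {A : Set (Pt d)} {k : Fin d → ℤ}
    {l : List (Fin d → ℤ)} {s : ℝ} (hc : CoarseChain p h r A k l s) :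
    ∃ l' s', CoarseChain p h r A k l' s' ∧ s' ≤ s ∧ k + l'.sum = k + l.sum ∧
      (visitedCells k l').Nodup := by
  induction hc with
  | nil k => exact ⟨[], 0, .nil _, le_rfl, rfl, by simp [visitedCells]⟩
  | cons k v l a s s' ha hs hl ih =>
    obtain ⟨l', s'', h1, h2, h3, h4⟩ := ih
    by_cases hk : k ∈ visitedCells (k + v) l'
    · obtain ⟨l₂, s₂, g1, g2, g3, g4⟩ := h1.exists_suffix hk
      refine ⟨l₂, s₂, g1, by linarith [hs.nonneg], ?_, h4.sublist g4⟩
      rw [g3, h3, List.sum_cons, add_assoc]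
    · refine ⟨v :: l', s + s'', .cons _ _ _ a _ _ ha hs h1, by linarith, ?_, ?_⟩
      · rw [List.sum_cons, ← add_assoc, h3, List.sum_cons, add_assoc]
      · simp only [visitedCells, List.nodup_cons]
        exact ⟨hk, h4⟩

/-- The total Euclidean length of a list of increments. -/
noncomputable def chainLength (h : ℝ) {d : ℕ} (l : List (Fin d → ℤ)) : ℝ :=
  (l.map fun v => ‖cellCenter h v‖).sum

theorem norm_cellCenter_sum_le (h : ℝ) (l : List (Fin d → ℤ)) :
    ‖cellCenter h l.sum‖ ≤ chainLength h l := by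
  induction l with
  | nil =>
    have : cellCenter h (0 : Fin d → ℤ) = 0 := by ext i; simp [cellCenter]
    simp [chainLength, this]
  | cons v l ih =>
    simp only [chainLength, List.sum_cons, List.map_cons, cellCenter_add] at ih ⊢
    exact (norm_add_le _ _).trans (by linarith)

theorem CoarseChain.forall_le_norm {h r : ℝ} {A : Set (Pt d)} {k : Fin d → ℤ}
    {l : List (Fin d → ℤ)} {s : ℝ} (hc : CoarseChain p h r A k l s) :
    ∀ v ∈ l, r - d * h ≤ ‖cellCenter h v‖ := by
  induction hc with
  | nil k => simp
  | cons k v l a s s' ha hs hl ih =>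
    intro u hu
    rcases List.mem_cons.1 hu with rfl | hu
    · exact hs.le_norm
    · exact ih u hu

open Classical in
/-- The number of visited cells with a cheap crossing. -/
noncomputable def badCount (p h r κ : ℝ) (A : Set (Pt d)) (k : Fin d → ℤ)
    (l : List (Fin d → ℤ)) : ℕ :=
  (visitedCells k l).countP fun j => CheapCrossing p (d * h) r (κ * r) (cellCenter h j) A

/-- A long step pays for its length by its overshoot, since `p > 1` makes long edges superlinearly
expensive and `hκδ` sets the threshold. A step of length below `(1 + 2 δ) r` either costs at least
`κ r` or starts in a cell with a cheap crossing, which the count pays for. -/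
theorem CoarseChain.chainLength_le (hp : 1 < p) {h r κ δ : ℝ} (hr : 0 < r) (hκ : 0 < κ)
    (hδ : 0 < δ) (hδh : d * h = δ * r)
    (hκδ : κ * (2 + 1 / δ) ≤ (δ * r) ^ (p - 1)) {A : Set (Pt d)} {k : Fin d → ℤ}
    {l : List (Fin d → ℤ)} {s : ℝ} (hc : CoarseChain p h r A k l s) :
    κ * chainLength h l ≤ (1 + 2 * δ) * (s + κ * r * badCount p h r κ A k l) := by
  classical
  induction hc with
  | nil k =>
    simp only [chainLength, List.map_nil, List.sum_nil, mul_zero, zero_add]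
    positivity
  | cons k v l a s s' ha hs hl ih =>
    simp only [chainLength, List.map_cons, List.sum_cons] at ih ⊢
    have hb : (badCount p h r κ A k (v :: l) : ℝ) = badCount p h r κ A (k + v) l +
        if CheapCrossing p (d * h) r (κ * r) (cellCenter h k) A then 1 else 0 := by
      simp only [badCount, visitedCells, List.countP_cons, decide_eq_true_eq]
      push_cast
      rfl
    rw [hb]
    set g := ‖cellCenter h v‖ with hg
    have hs0 := hs.nonneg
    have hκr : 0 < κ * r := by positivity
    have key : κ * g ≤ (1 + 2 * δ) * (s + κ * r *
        if CheapCrossing p (d * h) r (κ * r) (cellCenter h k) A then 1 else 0) := by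
      by_cases hlong : (1 + 2 * δ) * r ≤ g
      · have hov := hs.overshoot (by rw [hδh]; nlinarith)
        rw [hδh, ← hg] at hov
        set ℓ := g - r - δ * r with hℓ
        have hℓ1 : δ * r ≤ ℓ := by rw [hℓ]; linarith
        have hℓ0 : 0 < ℓ := lt_of_lt_of_le (by positivity) hℓ1
        have h1 : κ * (2 + 1 / δ) * ℓ ≤ s := by
          calc κ * (2 + 1 / δ) * ℓ ≤ (δ * r) ^ (p - 1) * ℓ := by gcongr
            _ ≤ ℓ ^ (p - 1) * ℓ := by
                gcongr
            _ = ℓ ^ p := by rw [← Real.rpow_add_one hℓ0.ne', sub_add_cancel]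
            _ ≤ s := hov
        have h2 : g ≤ (2 + 1 / δ) * ℓ := by
          have h3 : r ≤ 1 / δ * ℓ := by
            rw [one_div, ← div_eq_inv_mul, le_div_iff₀ hδ]; linarith
          have h4 : g = ℓ + r + δ * r := by rw [hℓ]; ring
          rw [h4]; linarith
        have h5 : κ * g ≤ s := by
          calc κ * g ≤ κ * ((2 + 1 / δ) * ℓ) := by gcongr
            _ ≤ s := by linarith
        have h6 : 0 ≤ κ * r * (if CheapCrossing p (d * h) r (κ * r) (cellCenter h k) A then
            (1 : ℝ) else 0) := by
          split_ifs <;> simp [hκr.le]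
        nlinarith
      · push Not at hlong
        have h1 : κ * g ≤ (1 + 2 * δ) * (κ * r) := by nlinarith
        refine h1.trans (mul_le_mul_of_nonneg_left ?_ (by positivity))
        split_ifs with hcheap
        · linarith
        · obtain ⟨b, hb1, hb2⟩ := hs.crossing
          by_contra! hlt
          exact hcheap ⟨(a, b), ⟨ha, hb1⟩, by simp only; linarith⟩
    linarith

end Cells

/-! ### Many cheap crossings are unlikely. -/

section BadCells

variable {d : ℕ} {p : ℝ}

theorem measure_biInter_cheapCrossing_le (hp : 0 < p) {ρ r a η : ℝ}
    (hη : ∀ c : Pt d, (poissonLaw d).real {A | CheapCrossing p ρ r a c A.pts} ≤ η)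
    {ι : Type*} (S : Finset ι) (c : ι → Pt d)
    (hS : ∀ i ∈ S, ∀ j ∈ S, i ≠ j → 2 * r ≤ dist (c i) (c j)) :
    (poissonLaw d).real (⋂ i ∈ S, {A | CheapCrossing p ρ r a (c i) A.pts}) ≤ η ^ S.card := by
  classical
  let D : S → Set (Pt d) := fun i => Metric.ball (c i) r
  have hdisj : Pairwise fun i j => Disjoint (D i) (D j) := fun i j hij =>
    Metric.ball_disjoint_ball (by
      have := hS i i.2 j j.2 (fun h => hij (Subtype.ext h))
      linarith)
  have hind := (isPoissonLaw_poissonLaw d).iIndepFun_restrict D (fun _ => Metric.isOpen_ball) hdisj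
  have h1 := hind.measure_inter_preimage_eq_mul Finset.univ
    (sets := fun i => {A : Config d | ∃ w ∈ {w : Pt d × Pt d | dist w.1 (c i) ≤ ρ ∧
      dist w.2 (c i) = r}, shortestPathLength p w.1 w.2 A.pts < a})
    (fun i _ => measurableSet_exists_shortestPathLength_lt hp _ a)
  have h2 : (⋂ i ∈ S, {A : Config d | CheapCrossing p ρ r a (c i) A.pts}) =
      ⋂ i ∈ (Finset.univ : Finset S), (fun A : Config d => A.restrict (D i)) ⁻¹'
        {A : Config d | ∃ w ∈ {w : Pt d × Pt d | dist w.1 (c i) ≤ ρ ∧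
      dist w.2 (c i) = r}, shortestPathLength p w.1 w.2 A.pts < a} := by
    ext A
    simp only [Set.mem_iInter, Finset.mem_univ, true_imp_iff, Subtype.forall]
    rfl
  rw [measureReal_def, h2, h1, ENNReal.toReal_prod]
  calc _ ≤ ∏ _i : S, η :=
        Finset.prod_le_prod (fun i _ => ENNReal.toReal_nonneg) (fun i _ => hη (c i))
    _ = η ^ S.card := by simp

theorem two_mul_le_dist_cellCenter {h r : ℝ} (hh : 0 < h) {N : ℕ} (hN : 2 * r ≤ N * h)
    {k k' : Fin d → ℤ} (hkk : (fun i => (k i : ZMod N)) = fun i => (k' i : ZMod N))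
    (hne : k ≠ k') : 2 * r ≤ dist (cellCenter h k) (cellCenter h k') := by
  obtain ⟨i, hi⟩ := Function.ne_iff.1 hne
  have h1 : (N : ℤ) ∣ k i - k' i := by
    have := congrFun hkk i
    exact (ZMod.intCast_eq_intCast_iff_dvd_sub _ _ _).1 this.symm
  have h2 : (N : ℝ) ≤ |(k i : ℝ) - k' i| := by
    have := Int.le_of_dvd (abs_pos.2 (sub_ne_zero.2 hi)) ((dvd_abs _ _).2 h1)
    exact_mod_cast this
  have h3 := abs_apply_le_norm (cellCenter h k - cellCenter h k') i
  rw [dist_eq_norm]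
  refine le_trans ?_ h3
  simp only [PiLp.sub_apply, cellCenter]
  rw [← mul_sub, abs_mul, abs_of_pos hh]
  nlinarith

open Classical in
-- By pigeonhole one of the `N ^ d` residue classes contains at least `b` of the cheap cells; cells
-- of one class are `2 r` apart, so their crossings are independent. The factor `2 ^ V.card` counts
-- the possible subsets.
theorem measure_many_cheapCrossing_le (hp : 0 < p) {h ρ r a η : ℝ} (hh : 0 < h)
    (hη0 : 0 < η) (hη1 : η ≤ 1) {N : ℕ} [NeZero N] (hN : 2 * r ≤ N * h)
    (hη : ∀ c : Pt d, (poissonLaw d).real {A | CheapCrossing p ρ r a c A.pts} ≤ η)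
    (V : Finset (Fin d → ℤ)) (b : ℝ) :
    (poissonLaw d).real {A | b * (N : ℝ) ^ d ≤
      (V.filter fun k => CheapCrossing p ρ r a (cellCenter h k) A.pts).card} ≤
      2 ^ V.card * η ^ b := by
  let res : (Fin d → ℤ) → (Fin d → ZMod N) := fun k i => (k i : ZMod N)
  let good : Finset (Finset (Fin d → ℤ)) := V.powerset.filter fun S =>
    b ≤ S.card ∧ ∀ k ∈ S, ∀ k' ∈ S, res k = res k'
  have hcard : (Fintype.card (Fin d → ZMod N) : ℝ) = (N : ℝ) ^ d := by
    simp [ZMod.card]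
  have hsub : {A : Config d | b * (N : ℝ) ^ d ≤
      (V.filter fun k => CheapCrossing p ρ r a (cellCenter h k) A.pts).card} ⊆
      ⋃ S ∈ good, ⋂ k ∈ S, {A : Config d | CheapCrossing p ρ r a (cellCenter h k) A.pts} := by
    intro A hA
    obtain ⟨y, -, hy⟩ := Finset.exists_le_card_fiber_of_nsmul_le_card_of_maps_to
      (s := V.filter fun k => CheapCrossing p ρ r a (cellCenter h k) A.pts)
      (t := (Finset.univ : Finset (Fin d → ZMod N))) (f := res) (b := b)
      (fun _ _ => Finset.mem_univ _) Finset.univ_nonempty (by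
        rw [Finset.card_univ, nsmul_eq_mul, hcard, mul_comm]; exact hA)
    refine Set.mem_biUnion (x := Finset.filter (fun k => res k = y)
      (V.filter fun k => CheapCrossing p ρ r a (cellCenter h k) A.pts)) ?_ ?_
    · simp only [good, Finset.coe_filter, Finset.mem_powerset, Set.mem_ofPred_eq]
      refine ⟨(Finset.filter_subset _ _).trans (Finset.filter_subset _ _), hy, ?_⟩
      intro k hk k' hk'
      rw [(Finset.mem_filter.1 hk).2, (Finset.mem_filter.1 hk').2]
    · refine Set.mem_iInter₂.2 fun k hk => ?_
      exact (Finset.mem_filter.1 (Finset.mem_filter.1 hk).1).2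
  calc _ ≤ ∑ S ∈ good, (poissonLaw d).real
        (⋂ k ∈ S, {A : Config d | CheapCrossing p ρ r a (cellCenter h k) A.pts}) :=
        (measureReal_mono hsub (measure_ne_top _ _)).trans (measureReal_biUnion_finset_le _ _)
    _ ≤ ∑ S ∈ good, η ^ b := by
        refine Finset.sum_le_sum fun S hS => ?_
        obtain ⟨-, hSb, hSres⟩ := Finset.mem_filter.1 hS
        refine (measure_biInter_cheapCrossing_le hp hη S (cellCenter h)
          fun k hk k' hk' hne => two_mul_le_dist_cellCenter hh hN (hSres k hk k' hk') hne).trans ?_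
        rw [← Real.rpow_natCast]
        exact Real.rpow_le_rpow_of_exponent_ge hη0 hη1 hSb
    _ ≤ 2 ^ V.card * η ^ b := by
        rw [Finset.sum_const, nsmul_eq_mul]
        gcongr
        have : good.card ≤ 2 ^ V.card := by
          rw [← Finset.card_powerset]; exact Finset.card_filter_le _ _
        exact_mod_cast this

theorem length_visitedCells (k : Fin d → ℤ) (l : List (Fin d → ℤ)) :
    (visitedCells k l).length = l.length + 1 := by
  induction l generalizing k with
  | nil => rfl
  | cons v l ih => simp [visitedCells, ih]

theorem measure_badCount_le (hp : 0 < p) {h r κ η : ℝ} (hh : 0 < h)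
    (hη0 : 0 < η) (hη1 : η ≤ 1) {N : ℕ} [NeZero N] (hN : 2 * r ≤ N * h)
    (hη : ∀ c : Pt d, (poissonLaw d).real {A | CheapCrossing p (d * h) r (κ * r) c A.pts} ≤ η)
    (k : Fin d → ℤ) (l : List (Fin d → ℤ)) (hl : (visitedCells k l).Nodup) (b : ℝ) :
    (poissonLaw d).real {A | b * (N : ℝ) ^ d ≤ badCount p h r κ A.pts k l} ≤
      2 ^ (l.length + 1) * η ^ b := by
  classical
  have h1 := measure_many_cheapCrossing_le hp hh hη0 hη1 hN hη (visitedCells k l).toFinset b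
  rw [List.toFinset_card_of_nodup hl, length_visitedCells] at h1
  convert h1 using 6 with A
  rw [badCount, List.countP_eq_length_filter, ← List.toFinset_card_of_nodup (hl.filter _),
    List.toFinset_filter]
  congr 1
  ext; simp

theorem tsum_pi_prod {α : Type*} (w : α → ENNReal) (n : ℕ) :
    ∑' f : Fin n → α, ∏ i, w (f i) = (∑' a, w a) ^ n := by
  induction n with
  | zero => simp
  | succ n ih =>
    rw [← (Fin.consEquiv fun _ => α).tsum_eq, ENNReal.tsum_prod', pow_succ', ← ih,
      ← ENNReal.tsum_mul_right]
    refine tsum_congr fun a => ?_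
    rw [← ENNReal.tsum_mul_left]
    refine tsum_congr fun f => ?_
    simp [Fin.consEquiv, Fin.prod_univ_succ]

/-- Multiplicative weights turn the sum over all chains into a geometric series in the total weight
of one step. -/
theorem tsum_list_prod {α : Type*} (w : α → ENNReal) :
    ∑' l : List α, (l.map w).prod = ∑' n : ℕ, (∑' a, w a) ^ n := by
  rw [← List.equivSigmaTuple.symm.tsum_eq, ENNReal.tsum_sigma']
  refine tsum_congr fun n => ?_
  rw [← tsum_pi_prod w n]
  refine tsum_congr fun f => ?_
  simp [List.equivSigmaTuple, List.prod_ofFn]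

end BadCells

/-! ### The Peierls sum over chains. -/

section Renormalization

variable {d : ℕ} {p : ℝ}

theorem tsum_int_inv_two_pow_natAbs : ∑' a : ℤ, (2⁻¹ : ENNReal) ^ a.natAbs = 3 := by
  have h1 : HasSum (fun n : ℕ => (2⁻¹ : ENNReal) ^ (n : ℤ).natAbs) 2 := by
    simp only [Int.natAbs_natCast]
    rw [Summable.hasSum_iff ENNReal.summable, ENNReal.tsum_geometric, ENNReal.one_sub_inv_two,
      inv_inv]
  have h2 : HasSum (fun n : ℕ => (2⁻¹ : ENNReal) ^ (-((n : ℤ) + 1)).natAbs) 1 := by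
    have : ∀ n : ℕ, (-((n : ℤ) + 1)).natAbs = n + 1 := fun n => by omega
    simp only [this]
    rw [Summable.hasSum_iff ENNReal.summable]
    simp only [pow_succ]
    rw [ENNReal.tsum_mul_right, ENNReal.tsum_geometric, ENNReal.one_sub_inv_two, inv_inv,
      ENNReal.mul_inv_cancel (by simp) (by simp)]
  have h3 := HasSum.of_nat_of_neg_add_one (f := fun a : ℤ => (2⁻¹ : ENNReal) ^ a.natAbs) h1 h2
  rw [h3.tsum_eq]; norm_num

/-- The weight of an increment in the union bound over coarse chains. -/
noncomputable def stepWeight (lam : ℝ) {d : ℕ} (v : Fin d → ℤ) : ENNReal :=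
  ENNReal.ofReal (2 * Real.exp (-(lam / 8))) * ∏ i, (2⁻¹ : ENNReal) ^ (v i).natAbs

theorem tsum_stepWeight_le {lam : ℝ} (hlam : 4 * 3 ^ d ≤ Real.exp (lam / 8)) :
    ∑' v : Fin d → ℤ, stepWeight lam v ≤ 2⁻¹ := by
  unfold stepWeight
  rw [ENNReal.tsum_mul_left, tsum_pi_prod (fun a : ℤ => (2⁻¹ : ENNReal) ^ a.natAbs), tsum_int_inv_two_pow_natAbs]
  have h1 : (3 : ENNReal) ^ d = ENNReal.ofReal (3 ^ d) := by
    rw [ENNReal.ofReal_pow (by norm_num)]; norm_num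
  have h2 : (2⁻¹ : ENNReal) = ENNReal.ofReal (1 / 2) := by
    rw [one_div, ENNReal.ofReal_inv_of_pos (by norm_num)]; norm_num
  rw [h1, h2, ← ENNReal.ofReal_mul (by positivity)]
  refine ENNReal.ofReal_le_ofReal ?_
  rw [Real.exp_neg]
  have h3 : 0 < Real.exp (lam / 8) := Real.exp_pos _
  rw [mul_assoc, inv_mul_eq_div, ← mul_div_assoc, div_le_iff₀ h3]
  linarith

theorem sum_natAbs_le_norm_cellCenter {h : ℝ} (hh : 0 < h) (v : Fin d → ℤ) :
    h * ∑ i, ((v i).natAbs : ℝ) ≤ d * ‖cellCenter h v‖ := by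
  rw [Finset.mul_sum]
  have : ∀ i ∈ (Finset.univ : Finset (Fin d)), h * ((v i).natAbs : ℝ) ≤ ‖cellCenter h v‖ := by
    intro i _
    have := abs_apply_le_norm (cellCenter h v) i
    simp only [cellCenter, abs_mul, abs_of_pos hh] at this
    rwa [Nat.cast_natAbs, Int.cast_abs]
  refine (Finset.sum_le_sum this).trans ?_
  simp

/-- The exponent is split in two equal halves: one dominates the summable weight `2 ^ (-∑ |v i|)`,
the other, as the step has length at least `r / 2`, yields the small constant `exp (-lam / 8)`. -/
theorem ofReal_exp_norm_le_stepWeight (hd : 1 ≤ d) {lam δ r : ℝ} (hr : 0 < r) (hδ : 0 < δ)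
    (hlam0 : 0 ≤ lam) (hlam : Real.log 2 ≤ lam * δ / (4 * d ^ 2)) {v : Fin d → ℤ}
    (hv : r / 2 ≤ ‖cellCenter (δ * r / d) v‖) :
    ENNReal.ofReal (2 * Real.exp (-(lam * ‖cellCenter (δ * r / d) v‖ / (2 * r)))) ≤
      stepWeight lam v := by
  have hd0 : (0 : ℝ) < d := by exact_mod_cast hd
  set g := ‖cellCenter (δ * r / d) v‖ with hg
  have h1 := sum_natAbs_le_norm_cellCenter (by positivity : 0 < δ * r / d) v
  rw [← hg] at h1
  have e1 : ∏ i, (2⁻¹ : ENNReal) ^ (v i).natAbs =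
      ENNReal.ofReal (Real.exp (-(Real.log 2 * ∑ i, ((v i).natAbs : ℝ)))) := by
    rw [Finset.mul_sum, ← Finset.sum_neg_distrib, Real.exp_sum,
      ENNReal.ofReal_prod_of_nonneg fun _ _ => (Real.exp_pos _).le]
    refine Finset.prod_congr rfl fun i _ => ?_
    rw [mul_comm, ← mul_neg, Real.exp_nat_mul, Real.exp_neg, Real.exp_log two_pos,
      ENNReal.ofReal_pow (by norm_num), ENNReal.ofReal_inv_of_pos two_pos]
    norm_num
  unfold stepWeight
  rw [e1, ← ENNReal.ofReal_mul (by positivity), mul_assoc, ← Real.exp_add]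
  refine ENNReal.ofReal_le_ofReal ?_
  refine mul_le_mul_of_nonneg_left (Real.exp_le_exp.2 ?_) two_pos.le
  have h2 : Real.log 2 * ∑ i, ((v i).natAbs : ℝ) ≤ lam * g / (4 * r) := by
    calc Real.log 2 * ∑ i, ((v i).natAbs : ℝ)
        ≤ lam * δ / (4 * d ^ 2) * ∑ i, ((v i).natAbs : ℝ) := by gcongr
      _ = lam / (4 * d * r) * (δ * r / d * ∑ i, ((v i).natAbs : ℝ)) := by
          field_simp
      _ ≤ lam / (4 * d * r) * (d * g) := by gcongr
      _ = lam * g / (4 * r) := by field_simp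
  have h3 : lam / 8 ≤ lam * g / (4 * r) := by
    rw [le_div_iff₀ (by positivity)]
    nlinarith
  have h4 : lam * g / (2 * r) = lam * g / (4 * r) + lam * g / (4 * r) := by field_simp; ring
  linarith

theorem ofReal_exp_chainLength_le (hd : 1 ≤ d) {lam δ r : ℝ} (hr : 0 < r) (hδ : 0 < δ)
    (hlam0 : 0 ≤ lam) (hlam : Real.log 2 ≤ lam * δ / (4 * d ^ 2)) {l : List (Fin d → ℤ)}
    (hl : ∀ v ∈ l, r / 2 ≤ ‖cellCenter (δ * r / d) v‖) :
    ENNReal.ofReal (2 ^ l.length * Real.exp (-(lam * chainLength (δ * r / d) l / (2 * r)))) ≤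
      (l.map (stepWeight lam)).prod := by
  induction l with
  | nil => simp [chainLength]
  | cons v l ih =>
    have h1 := ih fun u hu => hl u (List.mem_cons_of_mem _ hu)
    have h2 := ofReal_exp_norm_le_stepWeight hd hr hδ hlam0 hlam (hl v List.mem_cons_self)
    have e : 2 ^ (v :: l).length *
        Real.exp (-(lam * chainLength (δ * r / d) (v :: l) / (2 * r))) =
        (2 * Real.exp (-(lam * ‖cellCenter (δ * r / d) v‖ / (2 * r)))) *
        (2 ^ l.length * Real.exp (-(lam * chainLength (δ * r / d) l / (2 * r)))) := by
      simp only [chainLength, List.map_cons, List.sum_cons, List.length_cons]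
      rw [mul_add, add_div, neg_add, Real.exp_add]
      ring
    rw [e, ENNReal.ofReal_mul (by positivity), List.map_cons, List.prod_cons]
    exact mul_le_mul' h2 h1

set_option maxHeartbeats 1000000 in
-- A Peierls argument. A path that is too cheap has a self-avoiding chain with many cheap cells, and
-- the union bound over chains converges once cheap crossings are rare. The threshold `η` comes
-- before `r` and `κ`, so it can be met with small as well as with large balls.
theorem lower_tail_of_cheapCrossing (hp : 1 < p) (hd : 1 ≤ d) {ε : ℝ} (hε : 0 < ε) (hε1 : ε < 1) :
    ∃ η : ℝ, 0 < η ∧ ∀ r κ : ℝ, 0 < r → 0 < κ →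
      κ * (2 + 1 / (ε / 8)) ≤ (ε / 8 * r) ^ (p - 1) →
      (∀ c : Pt d, (poissonLaw d).real {A | CheapCrossing p (ε / 8 * r) r (κ * r) c A.pts} ≤ η) →
      ∃ c : ℝ, 0 < c ∧ ∀ᶠ t : ℝ in atTop, ∀ x y : Pt d, dist x y = t →
        (poissonLaw d).real {A | shortestPathLength p x y A.pts < (1 - ε) * κ * t} ≤
          Real.exp (-(c * t)) := by
  have hp0 : 0 < p := by linarith
  have hd0 : (0 : ℝ) < d := by exact_mod_cast hd
  set δ := ε / 8 with hδ_def
  have hδ : 0 < δ := by positivity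
  -- Cells have size `h = δ r / d`, so distinct cells congruent modulo `N` have centres at least `2
  -- r` apart.
  set N : ℕ := ⌈2 * d / δ⌉₊ with hN
  have hNle : 2 * d / δ ≤ N := Nat.le_ceil _
  have hN0 : (0 : ℝ) < N := lt_of_lt_of_le (by positivity) hNle
  have : NeZero N := ⟨by rintro h; rw [h] at hN0; simp at hN0⟩
  -- The first entry makes the total weight of a step at most `1 / 2`, the second pays for the
  -- number of possible increments.
  set lam : ℝ := max (8 * Real.log (4 * 3 ^ d)) (4 * d ^ 2 * Real.log 2 / δ) with hlam_def
  have hlog2 : 0 < Real.log 2 := Real.log_pos (by norm_num)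
  have hlam0 : 0 < lam := lt_of_lt_of_le (by positivity) (le_max_right _ _)
  have hlam1 : 4 * 3 ^ d ≤ Real.exp (lam / 8) := by
    rw [← Real.log_le_iff_le_exp (by positivity)]
    have : 8 * Real.log (4 * 3 ^ d) ≤ lam := le_max_left _ _
    linarith
  have hlam2 : Real.log 2 ≤ lam * δ / (4 * d ^ 2) := by
    have : 4 * d ^ 2 * Real.log 2 / δ ≤ lam := le_max_right _ _
    rw [div_le_iff₀ hδ] at this
    rw [le_div_iff₀ (by positivity)]
    linarith
  -- Chosen so that `η ^ b l` equals `exp (-lam * chainLength h l / r)`.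
  refine ⟨Real.exp (-(8 * N ^ d / ε * lam)), Real.exp_pos _, ?_⟩
  intro r κ hr hκ hκδ hbad
  set h := δ * r / d with hh_def
  have hh : 0 < h := by positivity
  have hdh : d * h = δ * r := by rw [hh_def]; field_simp
  have hNh : 2 * r ≤ N * h := by
    rw [div_le_iff₀ hδ] at hNle
    rw [hh_def, ← mul_div_assoc, le_div_iff₀ hd0]
    nlinarith
  refine ⟨lam / (8 * r), by positivity, ?_⟩
  filter_upwards [eventually_ge_atTop (4 * r), eventually_ge_atTop (2 * r + 8 * r / ε),
    eventually_ge_atTop (8 * r * Real.log 4 / lam)] with t ht1 ht2 ht3 x y hxy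
  have ht0 : 0 < t := by linarith
  set k₀ := cellOf h x with hk₀
  let 𝓛 : Set (List (Fin d → ℤ)) := {l | (visitedCells k₀ l).Nodup ∧
    (∀ v ∈ l, r / 2 ≤ ‖cellCenter h v‖) ∧ t - 2 * r ≤ chainLength h l}
  -- A too cheap path forces about `ε G / (4 r) - 1` cheap cells on a chain of length `G`. Since `G
  -- ≥ 8 r / ε`, this is at least `ε G / (8 r)`; the division by `N ^ d` is the pigeonhole loss.
  let b : List (Fin d → ℤ) → ℝ := fun l => ε / 8 * (chainLength h l / r) / N ^ d
  let E : List (Fin d → ℤ) → Set (Config d) := fun l =>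
    {A | l ∈ 𝓛 ∧ b l * (N : ℝ) ^ d ≤ badCount p h r κ A.pts k₀ l}
  have hsub : {A : Config d | shortestPathLength p x y A.pts < (1 - ε) * κ * t} ⊆ ⋃ l, E l := by
    intro A hA
    obtain ⟨s, hs, hpath⟩ := exists_pathCost_lt hp0 hA
    have hδr : d * h < r := by rw [hdh]; nlinarith
    obtain ⟨l₀, s₀, hc₀, hs₀, hy₀⟩ := exists_coarseChain hp0 hh hδr hpath
    obtain ⟨l, s', hc, hs', hsum, hnd⟩ := hc₀.exists_nodup
    rw [← hsum] at hy₀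
    have hG := hc.chainLength_le hp hr hκ hδ hdh hκδ
    have hnorm := hc.forall_le_norm
    set G := chainLength h l with hG_def
    have htG : t ≤ G + 2 * r := by
      have h1 := dist_cellCenter_cellOf_le hh x
      have h2 := norm_cellCenter_sum_le h l
      have h3 := dist_triangle4 x (cellCenter h k₀) (cellCenter h (k₀ + l.sum)) y
      rw [hxy, dist_comm _ y, cellCenter_add, dist_self_add_right, ← cellCenter_add] at h3
      rw [hdh] at h1
      have h4 : δ * r ≤ r := by nlinarith
      linarith
    have hG0 : 8 * r / ε ≤ G := by linarith
    refine Set.mem_iUnion.2 ⟨l, ⟨hnd, fun v hv => ?_, by linarith⟩, ?_⟩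
    · have := hnorm v hv
      rw [hdh] at this
      nlinarith
    · set nb : ℝ := ((badCount p h r κ A.pts k₀ l : ℕ) : ℝ) with hnb
      have e1 : b l * (N : ℝ) ^ d = ε / 8 * (G / r) := by
        simp only [b]; rw [hG_def]; field_simp
      rw [e1]
      have hnb0 : 0 ≤ nb := by rw [hnb]; positivity
      have h1 : κ * G ≤ κ * ((1 - ε / 2) * t + 2 * r * nb) := by
        calc κ * G ≤ (1 + 2 * δ) * (s' + κ * r * nb) := hG
          _ ≤ (1 + 2 * δ) * ((1 - ε) * κ * t + κ * r * nb) := by gcongr; linarith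
          _ = κ * ((1 + 2 * δ) * (1 - ε) * t + (1 + 2 * δ) * r * nb) := by ring
          _ ≤ κ * ((1 - ε / 2) * t + 2 * r * nb) := by
              gcongr
              · rw [hδ_def]; nlinarith
              · rw [hδ_def]; linarith
      have h2 := le_of_mul_le_mul_left h1 hκ
      have h3 : (1 - ε / 2) * t ≤ (1 - ε / 2) * (G + 2 * r) :=
        mul_le_mul_of_nonneg_left htG (by linarith)
      rw [div_le_iff₀ hε] at hG0
      rw [← mul_div_assoc, div_le_iff₀ hr]
      nlinarith
  have hE : ∀ l, poissonLaw d (E l) ≤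
      ENNReal.ofReal (2 * Real.exp (-(lam * t / (4 * r)))) * (l.map (stepWeight lam)).prod := by
    intro l
    by_cases hl : l ∈ 𝓛
    · obtain ⟨hnd, hnorm, hlen⟩ := hl
      have h1 := measure_badCount_le hp0 hh (η := Real.exp (-(8 * N ^ d / ε * lam)))
        (Real.exp_pos _) (Real.exp_le_one_iff.2 (by
        have : 0 ≤ 8 * N ^ d / ε * lam := by positivity
        linarith)) hNh (by rw [hdh]; exact hbad) k₀ l hnd (b l)
      have h2 : poissonLaw d (E l) ≤ ENNReal.ofReal (2 ^ (l.length + 1) *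
          Real.exp (-(8 * N ^ d / ε * lam)) ^ b l) := by
        have hsubE : E l ⊆ {A | b l * (N : ℝ) ^ d ≤ badCount p h r κ A.pts k₀ l} :=
          fun A hA => hA.2
        refine (measure_mono hsubE).trans ?_
        rw [← ofReal_measureReal (measure_ne_top _ _)]
        exact ENNReal.ofReal_le_ofReal h1
      refine h2.trans ?_
      have e1 : Real.exp (-(8 * N ^ d / ε * lam)) ^ b l =
          Real.exp (-(lam * chainLength h l / r)) := by
        rw [← Real.exp_mul]
        congr 1
        simp only [b]
        field_simp
      have e2 : (2 : ℝ) ^ (l.length + 1) * Real.exp (-(lam * chainLength h l / r)) ≤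
          (2 * Real.exp (-(lam * t / (4 * r)))) *
          (2 ^ l.length * Real.exp (-(lam * chainLength h l / (2 * r)))) := by
        have : Real.exp (-(lam * chainLength h l / r)) ≤
            Real.exp (-(lam * t / (4 * r))) * Real.exp (-(lam * chainLength h l / (2 * r))) := by
          rw [← Real.exp_add, Real.exp_le_exp]
          have h3 : lam * t / (4 * r) ≤ lam * chainLength h l / (2 * r) := by
            rw [div_le_div_iff₀ (by positivity) (by positivity)]
            have : lam * r * t ≤ lam * r * (2 * chainLength h l) := by
              gcongr; linarith
            linarith
          have h4 : lam * chainLength h l / r = lam * chainLength h l / (2 * r) +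
            lam * chainLength h l / (2 * r) := by field_simp; ring
          linarith
        calc _ ≤ (2 : ℝ) ^ (l.length + 1) * (Real.exp (-(lam * t / (4 * r))) *
              Real.exp (-(lam * chainLength h l / (2 * r)))) := by gcongr
          _ = _ := by ring
      rw [e1]
      refine (ENNReal.ofReal_le_ofReal e2).trans ?_
      rw [ENNReal.ofReal_mul (by positivity)]
      exact mul_le_mul_right (ofReal_exp_chainLength_le hd hr hδ hlam0.le hlam2 hnorm) _
    · have : E l = ∅ := Set.eq_empty_of_forall_notMem fun A hA => hl hA.1
      rw [this]; simp
  have htot : poissonLaw d {A : Config d | shortestPathLength p x y A.pts < (1 - ε) * κ * t} ≤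
      ENNReal.ofReal (4 * Real.exp (-(lam * t / (4 * r)))) := by
    calc _ ≤ ∑' l, poissonLaw d (E l) := (measure_mono hsub).trans (measure_iUnion_le _)
      _ ≤ ∑' l : List (Fin d → ℤ), ENNReal.ofReal (2 * Real.exp (-(lam * t / (4 * r)))) *
          (l.map (stepWeight lam)).prod := ENNReal.tsum_le_tsum hE
      _ = ENNReal.ofReal (2 * Real.exp (-(lam * t / (4 * r)))) *
          ∑' n : ℕ, (∑' v : Fin d → ℤ, stepWeight lam v) ^ n := by
          rw [ENNReal.tsum_mul_left, tsum_list_prod]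
      _ ≤ ENNReal.ofReal (2 * Real.exp (-(lam * t / (4 * r)))) * ∑' n : ℕ, (2⁻¹ : ENNReal) ^ n := by
          gcongr
          exact tsum_stepWeight_le hlam1
      _ = _ := by
          rw [ENNReal.tsum_geometric, ENNReal.one_sub_inv_two, inv_inv,
            show (2 : ENNReal) = ENNReal.ofReal 2 by norm_num, ← ENNReal.ofReal_mul (by positivity)]
          congr 1; ring
  have h5 := ENNReal.toReal_mono ENNReal.ofReal_ne_top htot
  rw [ENNReal.toReal_ofReal (by positivity)] at h5
  refine h5.trans ?_
  rw [div_le_iff₀ hlam0] at ht3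
  have h6 : Real.log 4 ≤ lam / (8 * r) * t := by
    rw [div_mul_eq_mul_div, le_div_iff₀ (by positivity)]; linarith
  have h7 : (4 : ℝ) ≤ Real.exp (lam / (8 * r) * t) := by
    rwa [← Real.log_le_iff_le_exp (by norm_num)]
  have e : Real.exp (-(lam / (8 * r) * t)) =
      Real.exp (lam / (8 * r) * t) * Real.exp (-(lam * t / (4 * r))) := by
    rw [← Real.exp_add]; congr 1; field_simp; ring
  rw [e]
  gcongr

end Renormalization

/-! ### Positivity of the time constant. -/

section Positivity

variable {d : ℕ} {p : ℝ}

theorem le_shortestPathLength_empty (hp : 0 < p) (x y : Pt d) :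
    dist x y ^ p ≤ shortestPathLength p x y ∅ := by
  refine le_shortestPathLength hp fun s hs => ?_
  cases hs with
  | edge => exact le_rfl
  | cons _ a _ s ha _ => exact ha.elim

/-- In an empty ball the direct edge is the only path, and it has length at least `(1 - δ) r`. -/
theorem measure_cheapCrossing_le_volume (hp : 0 < p) {δ r a : ℝ} (hr : 0 < r)
    (hδ1 : δ ≤ 1) (ha : a ≤ ((1 - δ) * r) ^ p) (c : Pt d) :
    (poissonLaw d).real {A | CheapCrossing p (δ * r) r a c A.pts} ≤
      1 - Real.exp (-volume.real (Metric.ball c r)) := by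
  rw [← poissonLaw_real_voidEvent_ball, ← probReal_compl_eq_one_sub
    (measurableSet_voidEvent Metric.isOpen_ball)]
  refine measureReal_mono fun A hA hvoid => ?_
  obtain ⟨w, ⟨hw1, hw2⟩, hlt⟩ := hA
  have h1 := le_shortestPathLength_empty hp w.1 w.2
  rw [Set.disjoint_iff_inter_eq_empty.1 hvoid] at hlt
  have h2 : (1 - δ) * r ≤ dist w.1 w.2 := by
    have := dist_triangle_left w.2 c w.1
    linarith
  have h3 : ((1 - δ) * r) ^ p ≤ dist w.1 w.2 ^ p :=
    Real.rpow_le_rpow (mul_nonneg (by linarith) hr.le) h2 hp.le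
  linarith

/-- The ball radius is taken so small that the ball is empty with probability above `1 - η`, and `κ`
as large as the renormalization condition allows. -/
theorem exists_linear_lower_tail (hp : 1 < p) (hd : 1 ≤ d) :
    ∃ κ c : ℝ, 0 < κ ∧ 0 < c ∧ ∀ᶠ t : ℝ in atTop, ∀ x y : Pt d, dist x y = t →
      (poissonLaw d).real {A | shortestPathLength p x y A.pts < κ * t} ≤ Real.exp (-(c * t)) := by
  have hp0 : 0 < p := by linarith
  obtain ⟨η, hη, h⟩ := lower_tail_of_cheapCrossing (ε := 1 / 2) hp hd (by norm_num) (by norm_num)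
  set δ : ℝ := 1 / 2 / 8 with hδ
  have hδv : δ = 1 / 16 := by rw [hδ]; norm_num
  obtain ⟨r, hrη, hr⟩ : ∃ r : ℝ, 1 - Real.exp (-(r ^ d * unitVolume d)) < η ∧ 0 < r := by
    have h1 : Tendsto (fun r : ℝ => 1 - Real.exp (-(r ^ d * unitVolume d))) (𝓝[>] 0)
        (𝓝 (1 - Real.exp (-(0 ^ d * unitVolume d)))) :=
      (Continuous.tendsto (by fun_prop) 0).mono_left nhdsWithin_le_nhds
    have h2 : 1 - Real.exp (-(0 ^ d * unitVolume d)) < η := by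
      rw [zero_pow (by omega)]; simpa using hη
    exact ((h1.eventually_lt_const h2).and self_mem_nhdsWithin).exists
  set κ := (δ * r) ^ (p - 1) / (2 + 1 / δ) with hκ_def
  have hδ0 : 0 < δ := by rw [hδv]; norm_num
  have hκ : 0 < κ := by positivity
  obtain ⟨c, hc, hc'⟩ := h r κ hr hκ (by rw [hκ_def, div_mul_cancel₀ _ (by positivity)]) (fun x => by
    refine (measure_cheapCrossing_le_volume hp0 hr (by rw [hδv]; norm_num) ?_ x).trans ?_
    · have h1 : 0 < (1 - δ) * r := by rw [hδv]; positivity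
      have h2 : (δ * r) ^ (p - 1) ≤ ((1 - δ) * r) ^ (p - 1) := by
        refine Real.rpow_le_rpow (by positivity) ?_ (by linarith)
        rw [hδv]; linarith
      calc κ * r = (δ * r) ^ (p - 1) * (r / (2 + 1 / δ)) := by rw [hκ_def]; ring
        _ ≤ ((1 - δ) * r) ^ (p - 1) * ((1 - δ) * r) := by
            refine mul_le_mul h2 ?_ (by positivity) (by positivity)
            rw [hδv]; norm_num; linarith
        _ = ((1 - δ) * r) ^ p := by rw [← Real.rpow_add_one h1.ne', sub_add_cancel]
    · rw [volume_real_ball x hr.le hd]; exact hrη.le)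
  refine ⟨(1 - 1 / 2) * κ, c, by positivity, hc, ?_⟩
  simpa using hc'

theorem timeConstant_pos (hp : 1 < p) (hd : 1 ≤ d) {e : Pt d} (he : ‖e‖ = 1) {C : ℝ}
    (hC : Tendsto (fun t : ℝ => meanLength p 0 (t • e) / t) atTop (𝓝 C)) : 0 < C := by
  have hp0 : 0 < p := by linarith
  obtain ⟨κ, c, hκ, hc, h⟩ := exists_linear_lower_tail (p := p) hp hd
  have hexp : Tendsto (fun t : ℝ => Real.exp (-(c * t))) atTop (𝓝 0) :=
    Real.tendsto_exp_neg_atTop_nhds_zero.comp (tendsto_id.const_mul_atTop hc)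
  refine lt_of_lt_of_le (half_pos hκ) (ge_of_tendsto hC ?_)
  filter_upwards [h, hexp.eventually_le_const (by norm_num : (0 : ℝ) < 1 / 2),
    eventually_gt_atTop 0] with t ht hexp ht0
  have h1 := (ht 0 (t • e) (dist_zero_smul he ht0.le)).trans hexp
  have hm := measurable_shortestPathLength hp0 (0 : Pt d) (t • e)
  have hT : MeasurableSet {A : Config d | shortestPathLength p 0 (t • e) A.pts < κ * t} :=
    measurableSet_lt hm measurable_const
  have hκt : 0 < κ * t := by positivity
  have h2 := integral_mono (μ := poissonLaw d)
    ((integrable_const (κ * t)).indicator hT.compl)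
    (integrable_shortestPathLength hp0 0 (t • e)) (fun A => by
      simp only [Set.indicator]
      split_ifs with hA
      · exact not_lt.1 hA
      · exact shortestPathLength_nonneg)
  rw [integral_indicator_const _ hT.compl, probReal_compl_eq_one_sub hT, smul_eq_mul] at h2
  rw [le_div_iff₀ ht0]
  have h3 : meanLength p 0 (t • e) =
    ∫ A, shortestPathLength p 0 (t • e) A.pts ∂(poissonLaw d) := rfl
  rw [h3]
  nlinarith

end Positivity

/-! ### Regular configurations. -/

section Regularity

variable {d : ℕ} {p : ℝ}

/-- A configuration is regular near `c` at scale `r` if every point has a close neighbour in it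
and path lengths are bounded in terms of distances. -/
structure IsRegularAt (p Λ τ r : ℝ) (c : Pt d) (A : Set (Pt d)) : Prop where
  near : ∀ u, dist u c ≤ 2 * r → ∃ q ∈ A, dist u q ≤ τ * r ∧ dist u q ^ p ≤ τ * r
  length : ∀ u v, dist u c ≤ 2 * r → dist v c ≤ 2 * r →
    shortestPathLength p u v A ≤ Λ * dist u v + τ * r

set_option maxHeartbeats 1000000 in
-- A net of mesh `1` has polynomially many points. Pairs at distance at least `ℓ` obey the upper
-- tail, closer pairs use the direct edge, and arbitrary points are moved to the net; moving with `δ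
-- = 1` produces the factor `4` in front of `A₀`.
theorem eventually_measure_not_isRegularAt_le (hp : 1 < p) (hd : 1 ≤ d) {A₀ c₀ : ℝ} (hA₀ : 0 < A₀)
    (hc₀ : 0 < c₀)
    (hup : ∀ᶠ t : ℝ in atTop, ∀ x y : Pt d, dist x y = t →
      (poissonLaw d).real {A | A₀ * t < shortestPathLength p x y A.pts} ≤
        Real.exp (-(c₀ * t ^ ((d : ℝ) / (d + 2 * p))))) {τ η : ℝ} (hτ : 0 < τ) (hη : 0 < η) :
    ∀ᶠ r : ℝ in atTop, ∀ c : Pt d,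
      (poissonLaw d).real {A | ¬ IsRegularAt p (4 * A₀) τ r c A.pts} ≤ η := by
  have hp0 : 0 < p := by linarith
  have hd0 : (0 : ℝ) < d := by exact_mod_cast hd
  have hv := unitVolume_pos d
  obtain ⟨K, hK1, hK⟩ := exists_add_rpow_le hp0 one_pos
  set β := (d : ℝ) / (d + 2 * p) with hβ
  have hβ0 : 0 < β := by positivity
  -- With `ℓ = r ^ γ` the cost `ℓ ^ p = r ^ (1 / 2)` of a short edge is negligible against `r`,
  -- while `ℓ` still grows like a power of `r`, so the tail bounds beat the size of the net.
  set γ := 1 / (2 * p) with hγ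
  have hγ0 : 0 < γ := by positivity
  have hγp : γ * p = 1 / 2 := by rw [hγ]; field_simp
  have hγ1 : γ < 1 := by
    rw [hγ, div_lt_one (by positivity)]; linarith
  have hℓ : Tendsto (fun r : ℝ => r ^ γ) atTop atTop := tendsto_rpow_atTop hγ0
  obtain ⟨t₀, ht₀⟩ := eventually_atTop.1 hup
  set Q : ℝ := (8 * d + 5) ^ d with hQ
  have hQ0 : 0 < Q := by positivity
  have hexp1 : Tendsto (fun r : ℝ => Real.exp (-(unitVolume d / 2 * r ^ γ))) atTop (𝓝 0) :=
    Real.tendsto_exp_neg_atTop_nhds_zero.comp (hℓ.const_mul_atTop (by positivity))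
  have hγβ : 0 < γ * β := by positivity
  have hexp2 : Tendsto (fun r : ℝ => Real.exp (-(c₀ / 2 * r ^ (γ * β)))) atTop (𝓝 0) :=
    Real.tendsto_exp_neg_atTop_nhds_zero.comp
      ((tendsto_rpow_atTop hγβ).const_mul_atTop (by positivity))
  filter_upwards [eventually_ge_atTop 1, hℓ.eventually_ge_atTop t₀,
    eventually_const_mul_rpow_le hγ1 2 hτ,
    eventually_const_mul_rpow_le (by norm_num : (1 / 2 : ℝ) < 1) (2 ^ p) hτ,
    eventually_const_mul_rpow_le (by norm_num : (1 / 2 : ℝ) < 1) (8 * A₀ + 4 + 4 * K) hτ,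
    eventually_mul_exp_le Q d hv hγ0, eventually_mul_exp_le (Q ^ 2) (2 * d) hc₀ hγβ,
    hexp1.eventually_le_const (half_pos hη), hexp2.eventually_le_const (half_pos hη)]
    with r hr1 hℓt hn1 hn2 hn3 he1 he2 he1' he2' c
  have hr0 : 0 < r := by linarith
  set ℓ := r ^ γ with hℓ_def
  have hℓ1 : 1 ≤ ℓ := Real.one_le_rpow hr1 hγ0.le
  have hℓp : ℓ ^ p = r ^ (1 / 2 : ℝ) := by rw [hℓ_def, ← Real.rpow_mul hr0.le, hγp]
  have hr2 : 1 ≤ r ^ (1 / 2 : ℝ) := Real.one_le_rpow hr1 (by norm_num)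
  set h : ℝ := 1 / d with hh_def
  have hh : 0 < h := by positivity
  have hdh : d * h = 1 := by rw [hh_def]; field_simp
  set m : ℕ := ⌈d * (2 * r + 1)⌉₊ with hm
  let V : Finset (Fin d → ℤ) := Fintype.piFinset fun _ => Finset.Icc (-(m : ℤ)) m
  have hVcard : (V.card : ℝ) ≤ Q * r ^ (d : ℝ) := by
    have h1 : V.card = (2 * m + 1) ^ d := by
      simp only [V, Fintype.card_piFinset, Int.card_Icc, Finset.prod_const, Finset.card_univ,
        Fintype.card_fin]
      congr 1; omega
    have h2 : (m : ℝ) ≤ d * (2 * r + 1) + 1 := (Nat.ceil_lt_add_one (by positivity)).le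
    rw [h1, Real.rpow_natCast, hQ, ← mul_pow]
    push_cast
    refine pow_le_pow_left₀ (by positivity) ?_ d
    nlinarith
  let z : (Fin d → ℤ) → Pt d := fun k => c + cellCenter h k
  have hnet : ∀ u, dist u c ≤ 2 * r → ∃ k ∈ V, dist u (z k) ≤ 1 := by
    intro u hu
    have h1 := dist_cellCenter_cellOf_le hh (u - c)
    rw [hdh] at h1
    refine ⟨cellOf h (u - c), ?_, ?_⟩
    · simp only [V, Fintype.mem_piFinset, Finset.mem_Icc]
      intro i
      set k := cellOf h (u - c) with hk
      have h2 : ‖cellCenter h k‖ ≤ 2 * r + 1 := by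
        have h3 := norm_le_norm_add_norm_sub' (cellCenter h k) (u - c)
        rw [← dist_eq_norm, ← dist_eq_norm, dist_comm (cellCenter h k)] at h3
        linarith
      have h3 := (abs_apply_le_norm (cellCenter h k) i).trans h2
      simp only [cellCenter, abs_mul, abs_of_pos hh] at h3
      have h4 : |(k i : ℝ)| ≤ m := by
        refine le_trans ?_ (Nat.le_ceil _)
        rw [hh_def, one_div, inv_mul_eq_div, div_le_iff₀ hd0] at h3
        linarith
      have h5 := abs_le.1 h4
      exact ⟨by exact_mod_cast h5.1, by exact_mod_cast h5.2⟩
    · simp only [z]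
      rw [dist_eq_norm] at h1 ⊢
      rwa [← sub_sub]
  let S₁ : Set (Config d) := ⋃ k ∈ V, voidEvent (Metric.ball (z k) ℓ)
  let S₂ : Set (Config d) := ⋃ w ∈ (V ×ˢ V).filter fun w => ℓ ≤ dist (z w.1) (z w.2),
    {A | A₀ * dist (z w.1) (z w.2) < shortestPathLength p (z w.1) (z w.2) A.pts}
  have hsub : {A : Config d | ¬ IsRegularAt p (4 * A₀) τ r c A.pts} ⊆ S₁ ∪ S₂ := by
    intro A hA
    by_contra hcon
    rw [Set.mem_union, not_or] at hcon
    obtain ⟨h1, h2⟩ := hcon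
    simp only [S₁, S₂, Set.mem_iUnion, exists_prop, not_exists, not_and, Finset.mem_filter,
      Finset.mem_product, Set.mem_ofPred_eq, not_lt, Prod.forall] at h1 h2
    refine hA ⟨fun u hu => ?_, fun u v hu hv => ?_⟩
    · obtain ⟨k, hk, hku⟩ := hnet u hu
      obtain ⟨q, hqA, hq⟩ := Set.not_disjoint_iff.1 (h1 k hk)
      rw [Metric.mem_ball'] at hq
      have h3 : dist u q ≤ 2 * ℓ := (dist_triangle u (z k) q).trans (by linarith)
      refine ⟨q, hqA, h3.trans hn1, ?_⟩
      calc dist u q ^ p ≤ (2 * ℓ) ^ p := Real.rpow_le_rpow dist_nonneg h3 hp0.le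
        _ = 2 ^ p * r ^ (1 / 2 : ℝ) := by rw [Real.mul_rpow (by norm_num) (by positivity), hℓp]
        _ ≤ τ * r := hn2
    · obtain ⟨k, hk, hku⟩ := hnet u hu
      obtain ⟨k', hk', hkv⟩ := hnet v hv
      have h3 : shortestPathLength p (z k) (z k') A.pts ≤
          A₀ * (dist u v + 2) + r ^ (1 / 2 : ℝ) := by
        by_cases hfar : ℓ ≤ dist (z k) (z k')
        · have h4 := h2 k k' ⟨⟨hk, hk'⟩, hfar⟩
          have h5 : dist (z k) (z k') ≤ dist u v + 2 := by
            have := dist_triangle4 (z k) u v (z k')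
            rw [dist_comm (z k) u] at this
            linarith
          have h6 := mul_le_mul_of_nonneg_left h5 hA₀.le
          linarith
        · have h4 : shortestPathLength p (z k) (z k') A.pts ≤ ℓ ^ p :=
            shortestPathLength_le_dist.trans
              (Real.rpow_le_rpow dist_nonneg (not_le.1 hfar).le hp0.le)
          rw [hℓp] at h4
          have : 0 ≤ A₀ * (dist u v + 2) := by positivity
          linarith
      have h4 := shortestPathLength_move (A := A.pts) (x := z k) (y := z k') hp0 zero_le_one
        (by linarith) hK u v
      have h5 : dist (z k) u ^ p ≤ 1 := by
        rw [dist_comm]; exact Real.rpow_le_one dist_nonneg hku hp0.le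
      have h6 : dist (z k') v ^ p ≤ 1 := by
        rw [dist_comm]; exact Real.rpow_le_one dist_nonneg hkv hp0.le
      have h7 : (1 + 1) * K * (dist (z k) u ^ p + dist (z k') v ^ p) ≤ 4 * K := by nlinarith
      have h8 : 8 * A₀ + 4 * r ^ (1 / 2 : ℝ) + 4 * K ≤ τ * r := by
        refine le_trans ?_ hn3
        nlinarith
      have h9 : (1 + 1 : ℝ) ^ 2 * shortestPathLength p (z k) (z k') A.pts ≤
          4 * (A₀ * (dist u v + 2) + r ^ (1 / 2 : ℝ)) := by linarith
      linarith
  have hS₁ : (poissonLaw d).real S₁ ≤ η / 2 := by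
    refine (measureReal_biUnion_finset_le _ _).trans ?_
    have : ∀ k ∈ V, (poissonLaw d).real (voidEvent (Metric.ball (z k) ℓ)) ≤
        Real.exp (-(unitVolume d * r ^ γ)) := by
      intro k _
      rw [poissonLaw_real_voidEvent_ball, volume_real_ball _ (by positivity) hd, Real.exp_le_exp,
        neg_le_neg_iff, mul_comm]
      gcongr
      exact le_self_pow₀ hℓ1 (by omega)
    refine (Finset.sum_le_sum this).trans ?_
    rw [Finset.sum_const, nsmul_eq_mul]
    calc _ ≤ Q * r ^ (d : ℝ) * Real.exp (-(unitVolume d * r ^ γ)) := by gcongr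
      _ ≤ _ := he1.trans he1'
  have hS₂ : (poissonLaw d).real S₂ ≤ η / 2 := by
    refine (measureReal_biUnion_finset_le _ _).trans ?_
    have : ∀ w ∈ (V ×ˢ V).filter fun w => ℓ ≤ dist (z w.1) (z w.2), (poissonLaw d).real
        {A | A₀ * dist (z w.1) (z w.2) < shortestPathLength p (z w.1) (z w.2) A.pts} ≤
        Real.exp (-(c₀ * r ^ (γ * β))) := by
      intro w hw
      have hw' := (Finset.mem_filter.1 hw).2
      refine (ht₀ _ (hℓt.trans hw') _ _ rfl).trans ?_
      rw [Real.exp_le_exp, neg_le_neg_iff, Real.rpow_mul hr0.le]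
      gcongr
    refine (Finset.sum_le_sum this).trans ?_
    rw [Finset.sum_const, nsmul_eq_mul]
    have hcard : (((V ×ˢ V).filter fun w => ℓ ≤ dist (z w.1) (z w.2)).card : ℝ) ≤
        Q ^ 2 * r ^ (2 * d : ℝ) := by
      calc _ ≤ ((V ×ˢ V).card : ℝ) := by exact_mod_cast Finset.card_filter_le _ _
        _ = (V.card : ℝ) * V.card := by rw [Finset.card_product]; push_cast; ring
        _ ≤ (Q * r ^ (d : ℝ)) * (Q * r ^ (d : ℝ)) := by gcongr
        _ = Q ^ 2 * r ^ (2 * d : ℝ) := by rw [two_mul (d : ℝ), Real.rpow_add hr0]; ring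
    calc _ ≤ Q ^ 2 * r ^ (2 * d : ℝ) * Real.exp (-(c₀ * r ^ (γ * β))) := by gcongr
      _ ≤ _ := he2.trans he2'
  calc _ ≤ (poissonLaw d).real (S₁ ∪ S₂) := measureReal_mono hsub
    _ ≤ (poissonLaw d).real S₁ + (poissonLaw d).real S₂ := measureReal_union_le _ _
    _ ≤ η := by linarith

end Regularity

/-! ### The sharp lower tail. -/

section LowerTail

variable {d : ℕ} {p : ℝ}

/-- Under regularity, a cheap crossing moves to a cheap path between points of a finite net. -/
theorem IsRegularAt.not_cheapCrossing (hp : 0 < p) {Λ τ r a a' δ δ' K : ℝ} {c : Pt d}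
    {A : Set (Pt d)} (hA : IsRegularAt p Λ τ r c A) (hΛ : 0 ≤ Λ) (hr : 0 < r) (hτ : 0 ≤ τ)
    (hδ : 0 ≤ δ) (hδτ : δ + τ ≤ 1) (hδ' : 0 ≤ δ') (hK0 : 0 ≤ K)
    (hK : ∀ a b : ℝ, 0 ≤ a → 0 ≤ b → (a + b) ^ p ≤ (1 + δ') * a ^ p + K * b ^ p)
    {F : Set (Pt d)} (hF : ∀ v : Pt d, ‖v‖ = 1 → ∃ f ∈ F, ‖f‖ = 1 ∧ dist v f ≤ τ)
    (hlen : ∀ f ∈ F, a' * r ≤ shortestPathLength p c (c + r • f) A)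
    (ha : Λ * (δ + 3 * τ) + 2 * τ + (1 + δ') ^ 2 * a + (1 + δ') * K * (2 * τ) ≤ a') :
    ¬ CheapCrossing p (δ * r) r (a * r) c A := by
  rintro ⟨⟨u, b⟩, ⟨hu, hb⟩, hlt⟩
  simp only at hu hb hlt
  have hlt' : shortestPathLength p u b A < a * r :=
    (shortestPathLength_anti hp Set.inter_subset_left).trans_lt hlt
  have hτr : 0 ≤ τ * r := by positivity
  have hδr : δ * r + τ * r ≤ r := by nlinarith
  have hδr0 : 0 ≤ δ * r := by positivity
  -- The route `c → q → q' → c + r • f` is too short for `hlen`: `f` is a net direction close to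
  -- that of `b`, and `q`, `q'` are configuration points close to `u` and `b`.
  obtain ⟨f, hfF, hf1, hf⟩ := hF (r⁻¹ • (b - c)) (by
    rw [norm_smul, ← dist_eq_norm, hb, Real.norm_of_nonneg (by positivity), inv_mul_cancel₀ hr.ne'])
  have hbf : dist b (c + r • f) ≤ τ * r := by
    have h1 : b - (c + r • f) = r • (r⁻¹ • (b - c) - f) := by
      rw [smul_sub, smul_inv_smul₀ hr.ne']; abel
    rw [dist_eq_norm, h1, norm_smul, Real.norm_of_nonneg hr.le, ← dist_eq_norm, mul_comm]
    gcongr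
  obtain ⟨q, hqA, hq1, hq2⟩ := hA.near u (by linarith)
  obtain ⟨q', hqA', hq1', hq2'⟩ := hA.near b (by linarith)
  have hcq : dist c q ≤ (δ + τ) * r := by
    have := dist_triangle c u q
    rw [dist_comm c u] at this
    linarith
  have hqb : dist q' (c + r • f) ≤ 2 * τ * r := by
    have := dist_triangle_left q' (c + r • f) b
    linarith
  have hcb : dist (c + r • f) c = r := by
    rw [dist_eq_norm, add_sub_cancel_left, norm_smul, hf1, mul_one, Real.norm_of_nonneg hr.le]
  have hq'c : dist q' c ≤ 2 * r := by
    have := dist_triangle_left q' c b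
    linarith
  have h1 := hA.length c q (by simpa using hr.le) (by rw [dist_comm]; linarith)
  have h2 := hA.length q' (c + r • f) hq'c (by linarith)
  have h3 := shortestPathLength_move (A := A) (x := u) (y := b) hp hδ' hK0 hK q q'
  have h4 := shortestPathLength_triangle (x := c) (z := c + r • f) hp hqA
  have h5 := shortestPathLength_triangle (x := q) (z := c + r • f) hp hqA'
  have h6 := hlen f hfF
  have h7 := mul_le_mul_of_nonneg_left hcq hΛ
  have h8 := mul_le_mul_of_nonneg_left hqb hΛ
  have h9 : (1 + δ') ^ 2 * shortestPathLength p u b A < (1 + δ') ^ 2 * (a * r) :=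
    mul_lt_mul_of_pos_left hlt' (by positivity)
  have h10 : (1 + δ') * K * (dist u q ^ p + dist b q' ^ p) ≤ (1 + δ') * K * (2 * τ * r) :=
    mul_le_mul_of_nonneg_left (by linarith) (by positivity)
  have h11 := mul_le_mul_of_nonneg_right ha hr.le
  linarith

theorem exists_finite_sphere_net {τ : ℝ} (hτ : 0 < τ) : ∃ F : Finset (Pt d),
    (∀ f ∈ F, ‖f‖ = 1) ∧ ∀ v : Pt d, ‖v‖ = 1 → ∃ f ∈ F, dist v f ≤ τ := by
  obtain ⟨t, ht, htf, hcov⟩ := (isCompact_sphere (0 : Pt d) 1).finite_cover_balls hτ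
  refine ⟨htf.toFinset, fun f hf => by simpa using ht (htf.mem_toFinset.1 hf), fun v hv => ?_⟩
  obtain ⟨f, hf, hvf⟩ := Set.mem_iUnion₂.1 (hcov (by simpa using hv : v ∈ Metric.sphere 0 1))
  exact ⟨f, htf.mem_toFinset.2 hf, (Metric.mem_ball.1 hvf).le⟩

/-- A cheap crossing needs an irregular configuration or a short path from the centre in one of
finitely many net directions; both are unlikely for large `r`. The bound `δ₀` keeps the cost of
reaching the starting point from the centre below `ε / 8` per unit of `r`. -/
theorem eventually_measure_cheapCrossing_le (hp : 1 < p) (hd : 1 ≤ d) {e : Pt d} (he : ‖e‖ = 1)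
    {C : ℝ} (hC : Tendsto (fun t : ℝ => meanLength p 0 (t • e) / t) atTop (𝓝 C)) (hC0 : 0 < C)
    {ε : ℝ} (hε : 0 < ε) (hεC : ε < C) :
    ∃ δ₀ : ℝ, 0 < δ₀ ∧ ∀ δ : ℝ, 0 < δ → δ ≤ δ₀ → ∀ η : ℝ, 0 < η → ∀ᶠ r : ℝ in atTop,
      ∀ c : Pt d, (poissonLaw d).real
        {A | CheapCrossing p (δ * r) r ((C - ε) * r) c A.pts} ≤ η := by
  have hp0 : 0 < p := by linarith
  set δ₁ : ℝ := min (1 / 2) (ε / (32 * (C + 1))) with hδ₁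
  refine ⟨δ₁, by positivity, fun δ hδ hδδ η hη => ?_⟩
  have hδh : δ ≤ 1 / 2 := hδδ.trans (min_le_left _ _)
  have hδε : 4 * (C + 1) * δ ≤ ε / 8 := by
    have := hδδ.trans (min_le_right _ _)
    rw [le_div_iff₀ (by positivity)] at this
    linarith
  obtain ⟨δ', hδ', hδ'C⟩ : ∃ δ' : ℝ, 0 < δ' ∧ (1 + δ') ^ 2 * (C - ε) ≤ C - ε + ε / 8 := by
    have h1 : Tendsto (fun x : ℝ => (1 + x) ^ 2 * (C - ε)) (𝓝[>] 0)
        (𝓝 ((1 + 0) ^ 2 * (C - ε))) :=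
      (Continuous.tendsto (by fun_prop) 0).mono_left nhdsWithin_le_nhds
    obtain ⟨x, hx, hx0⟩ := ((h1.eventually_lt_const
      (by linarith : (1 + 0) ^ 2 * (C - ε) < C - ε + ε / 8)).and self_mem_nhdsWithin).exists
    exact ⟨x, hx0, hx.le⟩
  obtain ⟨K, hK1, hK⟩ := exists_add_rpow_le hp0 hδ'
  have hK0 : 0 < K := by linarith
  obtain ⟨τ, hτ, hτ2, hτε⟩ : ∃ τ : ℝ, 0 < τ ∧ τ ≤ 1 / 2 ∧
      (12 * (C + 1) + 2 + (1 + δ') * K * 2) * τ ≤ ε / 8 := by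
    set G := 12 * (C + 1) + 2 + (1 + δ') * K * 2 with hG
    have hG0 : 0 < G := by positivity
    refine ⟨min (1 / 2) (ε / 8 / G), by positivity, min_le_left _ _, ?_⟩
    calc G * min (1 / 2) (ε / 8 / G) ≤ G * (ε / 8 / G) := by
          gcongr; exact min_le_right _ _
      _ = ε / 8 := by field_simp
  obtain ⟨F, hF1, hF⟩ := exists_finite_sphere_net (d := d) hτ
  obtain ⟨c₀, hc₀, hup⟩ := upper_tail hp hd he hC (by linarith : C < C + 1) one_pos
  have hup' : ∀ᶠ t : ℝ in atTop, ∀ x y : Pt d, dist x y = t →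
      (poissonLaw d).real {A | (C + 1) * t < shortestPathLength p x y A.pts} ≤
        Real.exp (-(c₀ * t ^ ((d : ℝ) / (d + 2 * p)))) := by
    filter_upwards [hup] with t ht x y hxy
    simpa using ht x y hxy Set.univ fun _ _ => Set.subset_univ _
  have hreg := eventually_measure_not_isRegularAt_le hp hd (by linarith : 0 < C + 1) hc₀ hup' hτ
    (half_pos hη)
  have hκ : 0 < η / 2 / (F.card + 1) := by positivity
  filter_upwards [hreg, eventually_lower_prob_le hp hd he hC hC0.le (half_pos hε) hκ,
    eventually_gt_atTop 0] with r hreg hlow hr c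
  have hsub : {A : Config d | CheapCrossing p (δ * r) r ((C - ε) * r) c A.pts} ⊆
      {A | ¬ IsRegularAt p (4 * (C + 1)) τ r c A.pts} ∪
      ⋃ f ∈ F, {A | shortestPathLength p c (c + r • f) A.pts < (C - ε / 2) * r} := by
    intro A hA
    by_contra hcon
    simp only [Set.mem_union, Set.mem_iUnion, Set.mem_ofPred_eq, not_or, not_not, exists_prop,
      not_exists, not_and, not_lt] at hcon
    refine hcon.1.not_cheapCrossing hp0 (by positivity) hr hτ.le hδ.le (by linarith) hδ'.le hK0.le
      hK (F := F) (fun v hv => ?_) hcon.2 ?_ hA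
    · obtain ⟨f, hf, hvf⟩ := hF v hv
      exact ⟨f, hf, hF1 f hf, hvf⟩
    · linarith
  have hsum : (poissonLaw d).real
      (⋃ f ∈ F, {A | shortestPathLength p c (c + r • f) A.pts < (C - ε / 2) * r}) ≤ η / 2 := by
    refine (measureReal_biUnion_finset_le _ _).trans ?_
    refine (Finset.sum_le_sum fun f hf => hlow c (c + r • f) ?_).trans ?_
    · rw [dist_self_add_right, norm_smul, hF1 f hf, mul_one, Real.norm_of_nonneg hr.le]
    · rw [Finset.sum_const, nsmul_eq_mul, mul_div_assoc', div_le_iff₀ (by positivity)]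
      nlinarith
  calc _ ≤ _ := measureReal_mono hsub (measure_ne_top _ _)
    _ ≤ _ := measureReal_union_le _ _
    _ ≤ η / 2 + η / 2 := add_le_add (hreg c) hsum
    _ = η := by ring

theorem lower_tail (hp : 1 < p) (hd : 1 ≤ d) {e : Pt d} (he : ‖e‖ = 1) {C : ℝ}
    (hC : Tendsto (fun t : ℝ => meanLength p 0 (t • e) / t) atTop (𝓝 C)) {ε : ℝ} (hε : 0 < ε) :
    ∃ c : ℝ, 0 < c ∧ ∀ᶠ t : ℝ in atTop, ∀ x y : Pt d, dist x y = t →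
      (poissonLaw d).real {A | shortestPathLength p x y A.pts < (C - ε) * t} ≤
        Real.exp (-(c * t)) := by
  have hC0 := timeConstant_pos hp hd he hC
  set ε' := min ε (C / 2) with hε'
  have hε'0 : 0 < ε' := by positivity
  have hε'C : ε' ≤ C / 2 := min_le_right _ _
  obtain ⟨δ₀, hδ₀, hcheap⟩ := eventually_measure_cheapCrossing_le hp hd he hC hC0
    (half_pos hε'0) (by linarith)
  -- The renormalization uses starting radius `ε₂ / 8 * r`, hence the bound by `8 δ₀`; the second
  -- entry ensures `(1 - ε₂) (C - ε' / 2) ≥ C - ε`.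
  set ε₂ := min (8 * δ₀) (min (ε' / (2 * C)) (1 / 2)) with hε₂
  have hε₂0 : 0 < ε₂ := by positivity
  have hε₂1 : ε₂ < 1 :=
    ((min_le_right _ _).trans (min_le_right _ _)).trans_lt (by norm_num)
  have hε₂C : ε₂ * C ≤ ε' / 2 := by
    have := (min_le_right (8 * δ₀) _).trans (min_le_left (ε' / (2 * C)) (1 / 2))
    rw [le_div_iff₀ (by positivity)] at this
    linarith
  have hε₂δ : ε₂ / 8 ≤ δ₀ := by
    have := min_le_left (8 * δ₀) (min (ε' / (2 * C)) (1 / 2))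
    linarith
  obtain ⟨η, hη, htail⟩ := lower_tail_of_cheapCrossing (p := p) hp hd hε₂0 hε₂1
  have hlim : Tendsto (fun r : ℝ => (ε₂ / 8 * r) ^ (p - 1)) atTop atTop :=
    (tendsto_rpow_atTop (by linarith)).comp (tendsto_id.const_mul_atTop (by positivity))
  obtain ⟨r, hr0, hr1, hr2⟩ := ((eventually_gt_atTop 0).and
    ((hlim.eventually_ge_atTop ((C - ε' / 2) * (2 + 1 / (ε₂ / 8)))).and
      (hcheap (ε₂ / 8) (by positivity) hε₂δ η hη))).exists
  obtain ⟨c, hc, h⟩ := htail r (C - ε' / 2) hr0 (by linarith) hr1 hr2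
  refine ⟨c, hc, ?_⟩
  filter_upwards [h, eventually_ge_atTop 0] with t ht ht0 x y hxy
  refine le_trans (measureReal_mono (fun A hA => ?_) (measure_ne_top _ _)) (ht x y hxy)
  refine lt_of_lt_of_le (Set.mem_ofPred_eq ▸ hA) ?_
  refine mul_le_mul_of_nonneg_right ?_ ht0
  have : ε' ≤ ε := min_le_left _ _
  nlinarith

end LowerTail

/-! ### From a Poisson sample size to a fixed one. -/

section Poissonization

variable {d : ℕ} {p : ℝ}

theorem withDensity_uniformBallDensity_real (z : Pt d) (R : ℝ) {U : Set (Pt d)}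
    (hU : MeasurableSet U) :
    (volume.withDensity fun u => ENNReal.ofReal (uniformBallDensity z R u)).real U =
      volume.real (U ∩ Metric.ball z R) / volume.real (Metric.ball z R) := by
  have h1 : (fun u => ENNReal.ofReal (uniformBallDensity z R u)) =
      (Metric.ball z R).indicator
        fun _ => ENNReal.ofReal (1 / (volume (Metric.ball z R)).toReal) := by
    ext u
    simp only [uniformBallDensity, Set.indicator]
    split_ifs <;> simp
  rw [h1, withDensity_indicator measurableSet_ball, withDensity_const, measureReal_def,
    Measure.smul_apply, Measure.restrict_apply hU, smul_eq_mul, ENNReal.toReal_mul,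
    ENNReal.toReal_ofReal (by positivity), ← measureReal_def, ← measureReal_def]
  ring

/-- The configuration of the first `N` sample points, dilated by `s`. -/
def scaledSample {Ω : Type*} (X : ℕ → Ω → Pt d) (s : ℝ) (w : Ω × ℕ) : Config d :=
  Config.image (fun u => s • u) ⟨sampleSet X w.2 w.1⟩

theorem disjoint_scaledSample_iff {Ω : Type*} {X : ℕ → Ω → Pt d} {s : ℝ} {w : Ω × ℕ}
    {U : Set (Pt d)} : Disjoint (scaledSample X s w).pts U ↔
      Disjoint (sampleSet X w.2 w.1) ((fun u => s • u) ⁻¹' U) := by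
  simp [scaledSample, Config.image, Set.disjoint_image_left]

theorem measurable_scaledSample {Ω : Type*} [MeasurableSpace Ω] {X : ℕ → Ω → Pt d}
    (hX : ∀ i, Measurable (X i)) (s : ℝ) : Measurable (scaledSample X s) := by
  refine measurable_config fun U hU _ => ?_
  simp only [disjoint_scaledSample_iff]
  exact measurableSet_disjoint_sampleSet hX
    (hU.preimage (continuous_const_smul s)).measurableSet

/-- Both laws give `U` the void probability `exp (-|U ∩ B|)`, `B` being the dilated ball: `hn` says
that dilation by `s` turns the intensity of the sample into `1`. -/
theorem map_scaledSample {Ω : Type*} [MeasurableSpace Ω] {P : Measure Ω} [IsProbabilityMeasure P]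
    {X : ℕ → Ω → Pt d} {z : Pt d} {R s : ℝ} (hX : IsIIDWithDensity P X (uniformBallDensity z R))
    (hs : 0 < s) {n : ℕ} (hn : (n : ℝ) / volume.real (Metric.ball z R) = s ^ d) :
    (P.prod (poissonMeasure (n : NNReal))).map (scaledSample X s) =
      (poissonLaw d).map (Config.restrict (Metric.ball (s • z) (s * R))) := by
  have hm := measurable_scaledSample hX.measurable s
  have hr := measurable_restrict (d := d) (Metric.isOpen_ball (x := s • z) (ε := s * R))
  have : IsProbabilityMeasure ((P.prod (poissonMeasure (n : NNReal))).map (scaledSample X s)) :=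
    Measure.isProbabilityMeasure_map hm.aemeasurable
  have : IsProbabilityMeasure
      ((poissonLaw d).map (Config.restrict (Metric.ball (s • z) (s * R)))) :=
    Measure.isProbabilityMeasure_map hr.aemeasurable
  have : IsProbabilityMeasure
      (volume.withDensity fun u => ENNReal.ofReal (uniformBallDensity z R u)) := by
    rw [← hX.law 0]
    exact Measure.isProbabilityMeasure_map (hX.measurable 0).aemeasurable
  refine config_measure_ext fun U hU hU' => ?_
  have hpre : MeasurableSet ((fun u : Pt d => s • u) ⁻¹' U) :=
    (hU.preimage (continuous_const_smul s)).measurableSet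
  rw [Measure.map_apply hm (measurableSet_voidEvent hU),
    Measure.map_apply hr (measurableSet_voidEvent hU)]
  have e1 : scaledSample X s ⁻¹' voidEvent U =
      {w : Ω × ℕ | Disjoint (sampleSet X w.2 w.1) ((fun u => s • u) ⁻¹' U)} := by
    ext w
    exact disjoint_scaledSample_iff
  have e2 : Config.restrict (Metric.ball (s • z) (s * R)) ⁻¹' voidEvent U =
      voidEvent (U ∩ Metric.ball (s • z) (s * R)) := by
    ext A
    simp only [Config.restrict, voidEvent, Set.mem_ofPred_eq, Set.mem_preimage,
      Set.disjoint_iff_inter_eq_empty, Set.inter_assoc, Set.inter_comm U]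
  rw [e1, e2, measure_disjoint_sampleSet_poisson hX.measurable hX.indep hX.law _ hpre,
    (isPoissonLaw_poissonLaw d).void _ (hU.inter Metric.isOpen_ball)
      (hU'.subset Set.inter_subset_left), withDensity_uniformBallDensity_real z R hpre]
  have e3 : (fun u : Pt d => s • u) ⁻¹' U ∩ Metric.ball z R =
      (fun u : Pt d => s • u) ⁻¹' (U ∩ Metric.ball (s • z) (s * R)) := by
    ext u
    simp only [Set.mem_inter_iff, Set.mem_preimage, Metric.mem_ball, dist_smul₀,
      Real.norm_of_nonneg hs.le, mul_lt_mul_iff_right₀ hs]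
  have e4 : volume.real ((fun u : Pt d => s • u) ⁻¹' (U ∩ Metric.ball (s • z) (s * R))) =
      (s ^ d)⁻¹ * volume.real (U ∩ Metric.ball (s • z) (s * R)) := by
    rw [measureReal_def, Measure.addHaar_preimage_smul _ hs.ne', ENNReal.toReal_mul,
      ENNReal.toReal_ofReal (abs_nonneg _), finrank_euclideanSpace_fin,
      abs_of_pos (by positivity), measureReal_def]
  have e5 : (n : ℝ) * (volume.real (U ∩ Metric.ball (s • z) (s * R)) / s ^ d /
      volume.real (Metric.ball z R)) = volume.real (U ∩ Metric.ball (s • z) (s * R)) := by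
    have hsd : s ^ d ≠ 0 := by positivity
    rw [mul_div_assoc', mul_div_right_comm, hn]
    field_simp
  rw [e3, e4, inv_mul_eq_div, NNReal.coe_natCast, e5]

/-- Stirling's sequence decreases from its first term, so `n! ≤ e √n (n / e) ^ n`; the bound `√n ≤
n` is then enough. -/
theorem one_le_mul_poissonMeasure_real {n : ℕ} (hn : 1 ≤ n) :
    1 ≤ Real.exp 1 * n * (poissonMeasure (n : NNReal)).real {n} := by
  obtain ⟨k, rfl⟩ : ∃ k, n = k + 1 := ⟨n - 1, by omega⟩
  have h1 : Stirling.stirlingSeq (k + 1) ≤ Real.exp 1 / √2 := by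
    rw [← Stirling.stirlingSeq_one]
    exact Stirling.stirlingSeq'_antitone (Nat.zero_le k)
  set n : ℕ := k + 1
  have hn0 : (0 : ℝ) < n := by exact_mod_cast hn
  have hn1 : (1 : ℝ) ≤ n := by exact_mod_cast hn
  rw [Stirling.stirlingSeq, div_le_iff₀ (by positivity), div_pow, ← Real.exp_nat_mul, mul_one,
    Real.sqrt_mul (by norm_num)] at h1
  have h2 : Real.exp 1 / √2 * (√2 * √(n : ℝ) * ((n : ℝ) ^ n / Real.exp n)) =
      Real.exp 1 * √(n : ℝ) * ((n : ℝ) ^ n * Real.exp (-n)) := by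
    rw [Real.exp_neg]
    field_simp
  have h3 : √(n : ℝ) ≤ n := Real.sqrt_le_self_iff.2 (Or.inr hn1)
  rw [poissonMeasure_real_singleton, mul_div_assoc', one_le_div (by positivity)]
  calc (n.factorial : ℝ) ≤ Real.exp 1 * √(n : ℝ) * ((n : ℝ) ^ n * Real.exp (-n)) := h2 ▸ h1
    _ ≤ Real.exp 1 * n * ((n : ℝ) ^ n * Real.exp (-n)) := by gcongr
    _ = _ := by
      simp only [NNReal.coe_natCast]
      ring

/-- The Poisson size is independent of the points and equals `n` with probability at least `1 / (e
n)`. -/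
theorem measureReal_scaledSample_le {Ω : Type*} [MeasurableSpace Ω] {P : Measure Ω}
    [IsProbabilityMeasure P] {X : ℕ → Ω → Pt d} {z : Pt d} {R s : ℝ}
    (hX : IsIIDWithDensity P X (uniformBallDensity z R)) (hs : 0 < s) {n : ℕ} (hn1 : 1 ≤ n)
    (hn : (n : ℝ) / volume.real (Metric.ball z R) = s ^ d) {B : Set (Config d)}
    (hB : MeasurableSet B) :
    P.real {ω | scaledSample X s (ω, n) ∈ B} ≤ Real.exp 1 * n *
      (poissonLaw d).real {A | A.restrict (Metric.ball (s • z) (s * R)) ∈ B} := by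
  have hm := measurable_scaledSample hX.measurable s
  have h1 : P.real {ω | scaledSample X s (ω, n) ∈ B} * (poissonMeasure (n : NNReal)).real {n} ≤
      (poissonLaw d).real {A | A.restrict (Metric.ball (s • z) (s * R)) ∈ B} := by
    have h2 : (poissonLaw d).real {A | A.restrict (Metric.ball (s • z) (s * R)) ∈ B} =
        (P.prod (poissonMeasure (n : NNReal))).real (scaledSample X s ⁻¹' B) := by
      rw [← map_measureReal_apply hm hB, map_scaledSample hX hs hn,
        map_measureReal_apply (measurable_restrict Metric.isOpen_ball) hB]
      rfl
    rw [h2, ← measureReal_prod_prod]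
    refine measureReal_mono ?_ (measure_ne_top _ _)
    rintro ⟨ω, m⟩ ⟨hω, hm⟩
    obtain rfl : m = n := hm
    exact hω
  have h2 := one_le_mul_poissonMeasure_real hn1
  calc P.real {ω | scaledSample X s (ω, n) ∈ B} ≤ P.real {ω | scaledSample X s (ω, n) ∈ B} *
        (Real.exp 1 * n * (poissonMeasure (n : NNReal)).real {n}) :=
        le_mul_of_one_le_right measureReal_nonneg h2
    _ = Real.exp 1 * n * (P.real {ω | scaledSample X s (ω, n) ∈ B} *
        (poissonMeasure (n : NNReal)).real {n}) := by ring
    _ ≤ _ := by gcongr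

end Poissonization

/-! ### Two-sided deviations for the Poisson process. -/

section LargeDeviation

variable {d : ℕ} {p : ℝ}

/-- Restricting to `D` only lengthens paths, so the lower tail needs no condition on `D`; its rate
`t` dominates `t ^ β` for `t ≥ 1`. -/
theorem large_deviation (hp : 1 < p) (hd : 1 ≤ d) {e : Pt d} (he : ‖e‖ = 1) {C : ℝ}
    (hC : Tendsto (fun t : ℝ => meanLength p 0 (t • e) / t) atTop (𝓝 C)) {ε η : ℝ} (hε : 0 < ε)
    (hη : 0 < η) :
    ∃ c : ℝ, 0 < c ∧ ∀ᶠ t : ℝ in atTop, ∀ x y : Pt d, dist x y = t → ∀ D : Set (Pt d),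
      (∀ s ∈ segment ℝ x y, Metric.ball s (η * t) ⊆ D) →
      (poissonLaw d).real {A | ε < |shortestPathLength p x y (A.pts ∩ D) / t - C|} ≤
        2 * Real.exp (-(c * t ^ ((d : ℝ) / (d + 2 * p)))) := by
  have hp0 : 0 < p := by linarith
  obtain ⟨c₁, hc₁, h₁⟩ := upper_tail hp hd he hC (by linarith : C < C + ε) hη
  obtain ⟨c₂, hc₂, h₂⟩ := lower_tail hp hd he hC hε
  set β := (d : ℝ) / (d + 2 * p) with hβ
  have hβ1 : β ≤ 1 := div_le_one_of_le₀ (by linarith) (by positivity)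
  refine ⟨min c₁ c₂, lt_min hc₁ hc₂, ?_⟩
  filter_upwards [h₁, h₂, eventually_ge_atTop 1] with t h₁ h₂ ht1 x y hxy D hD
  have ht0 : 0 < t := by linarith
  have hsub : {A : Config d | ε < |shortestPathLength p x y (A.pts ∩ D) / t - C|} ⊆
      {A | (C + ε) * t < shortestPathLength p x y (A.pts ∩ D)} ∪
      {A | shortestPathLength p x y A.pts < (C - ε) * t} := by
    intro A hA
    rcases lt_abs.1 (Set.mem_ofPred_eq ▸ hA) with h | h
    · refine Or.inl ?_
      have : C + ε < shortestPathLength p x y (A.pts ∩ D) / t := by linarith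
      exact (lt_div_iff₀ ht0).1 this
    · refine Or.inr ((shortestPathLength_anti (A := A.pts ∩ D) hp0 Set.inter_subset_left).trans_lt ?_)
      have : shortestPathLength p x y (A.pts ∩ D) / t < C - ε := by linarith
      exact (div_lt_iff₀ ht0).1 this
  have hexp₁ : Real.exp (-(c₁ * t ^ β)) ≤ Real.exp (-(min c₁ c₂ * t ^ β)) := by
    gcongr; exact min_le_left _ _
  have hexp₂ : Real.exp (-(c₂ * t)) ≤ Real.exp (-(min c₁ c₂ * t ^ β)) := by
    rw [Real.exp_le_exp, neg_le_neg_iff]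
    have : t ^ β ≤ t := Real.rpow_le_self_of_one_le ht1 hβ1
    exact mul_le_mul (min_le_right _ _) this (by positivity) hc₂.le
  calc _ ≤ _ := measureReal_mono hsub (measure_ne_top _ _)
    _ ≤ _ := measureReal_union_le _ _
    _ ≤ Real.exp (-(min c₁ c₂ * t ^ β)) + Real.exp (-(min c₁ c₂ * t ^ β)) :=
        add_le_add ((h₁ x y hxy D hD).trans hexp₁) ((h₂ x y hxy).trans hexp₂)
    _ = _ := by ring

end LargeDeviation

/-! ### Transfer to the uniform sample. -/

section Main

variable {d : ℕ} {p : ℝ}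

theorem IsPoissonPointProcess.integral_shortestPathLength (hp : 0 < p) {Ω : Type*}
    [MeasurableSpace Ω] {P : Measure Ω} [IsProbabilityMeasure P] {H : Ω → Set (Pt d)}
    (hH : IsPoissonPointProcess P H 1) (x y : Pt d) :
    ∫ ω, shortestPathLength p x y (H ω) ∂P = meanLength p x y := by
  obtain ⟨H', hm, hae, hmap⟩ := hH.exists_map_eq
  rw [meanLength, ← hmap, integral_map hm.aemeasurable
    (measurable_shortestPathLength hp x y).aestronglyMeasurable]
  refine integral_congr_ae ?_
  filter_upwards [hae] with ω hω
  rw [hω]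

/-- The rescaled distance is `t = (n f(z)) ^ (1 / d) |x n - y n|`, and `β / d = α` turns the Poisson
rate `t ^ β` into `(n f(z)) ^ α |x n - y n| ^ β`. -/
theorem eventually_measure_scaledSample_le (hp : 1 < p) (hd : 2 ≤ d) {e : Pt d} (he : ‖e‖ = 1)
    {C : ℝ} (hC : Tendsto (fun t : ℝ => meanLength p 0 (t • e) / t) atTop (𝓝 C))
    {z : Pt d} {R₁ R₂ : ℝ} (hR₁ : 0 < R₁) (hR : R₁ < R₂) {Ω : Type*} [MeasurableSpace Ω]
    {P : Measure Ω} [IsProbabilityMeasure P] {X : ℕ → Ω → Pt d}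
    (hX : IsIIDWithDensity P X (uniformBallDensity z R₂)) {x y : ℕ → Pt d}
    (hx : ∀ n, x n ∈ Metric.ball z R₁) (hy : ∀ n, y n ∈ Metric.ball z R₁)
    (hxy : Tendsto (fun n : ℕ => ((n : ℝ) * uniformBallDensity z R₂ z) ^ (1 / ((d : ℝ) + 2 * p)) *
      dist (x n) (y n)) atTop atTop) {ε : ℝ} (hε : 0 < ε) :
    ∃ c : ℝ, 0 < c ∧ ∀ᶠ n : ℕ in atTop,
      P.real {ω | ε < |shortestPathLength p (x n) (y n) (sampleSet X n ω) /
          (((n : ℝ) * uniformBallDensity z R₂ z) ^ ((1 - p) / (d : ℝ)) * dist (x n) (y n)) - C|} ≤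
        Real.exp (-(c * (((n : ℝ) * uniformBallDensity z R₂ z) ^ (1 / ((d : ℝ) + 2 * p)) *
          dist (x n) (y n)))) := by
  have hp0 : 0 < p := by linarith
  have hd1 : 1 ≤ d := by omega
  have hd0 : (0 : ℝ) < d := by exact_mod_cast hd1
  set V := volume.real (Metric.ball z R₂) with hV
  have hV0 : 0 < V := by
    rw [hV, volume_real_ball z (by linarith) hd1]
    have := unitVolume_pos d
    have : 0 < R₂ := by linarith
    positivity
  have hfz : uniformBallDensity z R₂ z = 1 / V := by
    rw [uniformBallDensity, Set.indicator_of_mem (Metric.mem_ball_self (by linarith))]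
    rfl
  rw [hfz] at hxy ⊢
  set α := 1 / ((d : ℝ) + 2 * p) with hα
  set β := (d : ℝ) / (d + 2 * p) with hβ
  have hα0 : 0 < α := by positivity
  have hβ0 : 0 < β := by positivity
  have hβ1 : β ≤ 1 := div_le_one_of_le₀ (by linarith) (by positivity)
  have hαβ : 1 / d * β = α := by rw [hα, hβ]; field_simp
  -- The growth hypothesis yields `t ≥ (n f(z)) ^ γ`, so `t` tends to infinity and the factor `e n`
  -- is at most a power of `t`.
  set γ := 1 / d - α with hγ
  have hγ0 : 0 < γ := by
    rw [hγ, hα, sub_pos]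
    exact one_div_lt_one_div_of_lt hd0 (by linarith)
  -- As `|x n - y n| ≤ 2 R₁`, a tube of radius `η t` around the dilated segment stays in the dilated
  -- ball of radius `s R₂`.
  have hη : 0 < (R₂ - R₁) / (2 * R₁) := div_pos (by linarith) (by linarith)
  obtain ⟨c, hc, hdev⟩ := large_deviation hp hd1 he hC hε hη
  let lam : ℕ → ℝ := fun n => n * (1 / V)
  have hlam : Tendsto lam atTop atTop :=
    tendsto_natCast_atTop_atTop.atTop_mul_const (by positivity)
  let t : ℕ → ℝ := fun n => lam n ^ (1 / (d : ℝ)) * dist (x n) (y n)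
  have hle : ∀ᶠ n in atTop, lam n ^ γ ≤ t n := by
    filter_upwards [hlam.eventually_gt_atTop 0, hxy.eventually_ge_atTop 1] with n h0 h1
    have h2 : lam n ^ (1 / (d : ℝ)) = lam n ^ γ * lam n ^ α := by
      rw [← Real.rpow_add h0, hγ, sub_add_cancel]
    simp only [t]
    rw [h2, mul_assoc]
    exact le_mul_of_one_le_right (by positivity) h1
  have ht : Tendsto t atTop atTop :=
    tendsto_atTop_mono' _ hle ((tendsto_rpow_atTop hγ0).comp hlam)
  -- Half of `c` absorbs the prefactor; the power of `2 R₁` comes from `u ^ β ≥ (2 R₁) ^ (β - 1) *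
  -- u` for `u ≤ 2 R₁`, as `β ≤ 1`.
  refine ⟨c / 2 * (2 * R₁) ^ (β - 1), by positivity, ?_⟩
  filter_upwards [hle, hlam.eventually_gt_atTop 0, ht.eventually_gt_atTop 0,
    ht.eventually hdev, ht.eventually (eventually_mul_exp_le (2 * Real.exp 1 * V) (1 / γ) hc hβ0),
    eventually_ge_atTop 1] with n hle h0 ht0 hdev hexp hn1
  set u := dist (x n) (y n) with hu_def
  set s := lam n ^ (1 / (d : ℝ)) with hs_def
  have hs : 0 < s := by positivity
  have hts : t n = s * u := rfl
  have hu : 0 < u := by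
    rw [hts] at ht0
    exact pos_of_mul_pos_right ht0 hs.le
  have hsd : (n : ℝ) / V = s ^ d := by
    rw [hs_def, ← Real.rpow_natCast, ← Real.rpow_mul h0.le, one_div_mul_cancel hd0.ne',
      Real.rpow_one]
    exact div_eq_mul_one_div _ _
  have hu2 : u ≤ 2 * R₁ := by
    have := dist_triangle_right (x n) (y n) z
    have h1 := Metric.mem_ball.1 (hx n)
    have h2 := Metric.mem_ball.1 (hy n)
    linarith
  have hdist : dist (s • x n) (s • y n) = t n := by
    rw [dist_smul₀, Real.norm_of_nonneg hs.le, hts]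
  have hscale : ∀ ω, shortestPathLength p (x n) (y n) (sampleSet X n ω) /
      (lam n ^ ((1 - p) / (d : ℝ)) * u) =
      shortestPathLength p (s • x n) (s • y n) (scaledSample X s (ω, n)).pts / t n := by
    intro ω
    have h1 : shortestPathLength p (s • x n) (s • y n) (scaledSample X s (ω, n)).pts =
        s ^ p * shortestPathLength p (x n) (y n) (sampleSet X n ω) :=
      shortestPathLength_image (f := fun v : Pt d => s • v) hp0 hs
        (fun u v => by rw [dist_smul₀, Real.norm_of_nonneg hs.le])
        (fun v => ⟨s⁻¹ • v, smul_inv_smul₀ hs.ne' v⟩)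
    have h2 : lam n ^ ((1 - p) / (d : ℝ)) = s / s ^ p := by
      rw [hs_def, ← Real.rpow_mul h0.le, ← Real.rpow_sub h0]
      congr 1
      ring
    have hsp : 0 < s ^ p := by positivity
    rw [h1, h2, hts]
    field_simp
  have hB : MeasurableSet {A : Config d |
      ε < |shortestPathLength p (s • x n) (s • y n) A.pts / t n - C|} :=
    measurableSet_lt measurable_const
      (((measurable_shortestPathLength hp0 _ _).div_const _).sub_const _).abs
  have hseg : segment ℝ (s • x n) (s • y n) ⊆ Metric.ball (s • z) (s * R₁) := by
    refine (convex_ball _ _).segment_subset ?_ ?_ <;>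
    · rw [Metric.mem_ball, dist_smul₀, Real.norm_of_nonneg hs.le]
      first
      | exact mul_lt_mul_of_pos_left (Metric.mem_ball.1 (hx n)) hs
      | exact mul_lt_mul_of_pos_left (Metric.mem_ball.1 (hy n)) hs
  have htube : ∀ w ∈ segment ℝ (s • x n) (s • y n),
      Metric.ball w ((R₂ - R₁) / (2 * R₁) * t n) ⊆ Metric.ball (s • z) (s * R₂) := by
    intro w hw
    refine Metric.ball_subset_ball' ?_
    have h1 := Metric.mem_ball.1 (hseg hw)
    have h2 : (R₂ - R₁) / (2 * R₁) * t n ≤ s * (R₂ - R₁) := by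
      calc (R₂ - R₁) / (2 * R₁) * t n ≤ (R₂ - R₁) / (2 * R₁) * (s * (2 * R₁)) := by
            rw [hts]; gcongr
        _ = s * (R₂ - R₁) := by field_simp
    linarith
  have hmain := measureReal_scaledSample_le hX hs hn1 hsd hB
  have hpoi := hdev (s • x n) (s • y n) hdist (Metric.ball (s • z) (s * R₂)) htube
  have hn : Real.exp 1 * n ≤ Real.exp 1 * V * t n ^ (1 / γ) := by
    have h1 : (n : ℝ) = V * lam n := by
      simp only [lam]
      field_simp
    have h2 : lam n ≤ t n ^ (1 / γ) := by
      rw [one_div]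
      exact (Real.le_rpow_inv_iff_of_pos h0.le ht0.le hγ0).2 hle
    rw [h1, mul_assoc]
    gcongr
  have hpow : (2 * R₁) ^ (β - 1) * (lam n ^ α * u) ≤ t n ^ β := by
    have h1 : t n ^ β = lam n ^ α * (u ^ (β - 1) * u) := by
      rw [hts, Real.mul_rpow hs.le hu.le, hs_def, ← Real.rpow_mul h0.le, hαβ,
        ← Real.rpow_add_one hu.ne', sub_add_cancel]
    rw [h1, mul_left_comm]
    gcongr _ * (?_ * _)
    exact Real.rpow_le_rpow_of_nonpos hu hu2 (by linarith)
  have hset : {ω | ε < |shortestPathLength p (x n) (y n) (sampleSet X n ω) /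
      (((n : ℝ) * (1 / V)) ^ ((1 - p) / (d : ℝ)) * u) - C|} =
      {ω | scaledSample X s (ω, n) ∈ {A : Config d |
        ε < |shortestPathLength p (s • x n) (s • y n) A.pts / t n - C|}} := by
    ext ω
    simp only [Set.mem_ofPred_eq]
    rw [← hscale ω]
  rw [hset]
  calc _ ≤ _ := hmain
    _ ≤ (Real.exp 1 * V * t n ^ (1 / γ)) * (2 * Real.exp (-(c * t n ^ β))) := by
        refine mul_le_mul hn hpoi measureReal_nonneg (by positivity)
    _ = 2 * Real.exp 1 * V * t n ^ (1 / γ) * Real.exp (-(c * t n ^ β)) := by ring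
    _ ≤ Real.exp (-(c / 2 * t n ^ β)) := hexp
    _ ≤ _ := by
        rw [Real.exp_le_exp, neg_le_neg_iff, mul_assoc]
        gcongr

/-- Subadditivity is enough, so measurability of the event is not needed. -/
theorem one_sub_measure_le {Ω : Type*} [MeasurableSpace Ω] {P : Measure Ω}
    [IsProbabilityMeasure P] (s : Set Ω) : 1 - P s ≤ ENNReal.ofReal (P.real sᶜ) := by
  rw [ofReal_measureReal, tsub_le_iff_left, ← measure_univ (μ := P), ← Set.union_compl_self s]
  exact measure_union_le _ _

/-- Monotonicity of the extended logarithm also covers `q = 0`, where the logarithm is `⊥`. -/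
theorem inv_mul_log_le {a c : ℝ} (ha : 0 < a) {q : ENNReal}
    (hq : q ≤ ENNReal.ofReal (Real.exp (-(c * a)))) :
    ((1 / a : ℝ) : EReal) * ENNReal.log q ≤ ((-c : ℝ) : EReal) := by
  have h1 := ENNReal.log_le_log hq
  rw [ENNReal.log_ofReal_of_pos (Real.exp_pos _), Real.log_exp] at h1
  refine (mul_le_mul_of_nonneg_left h1 (by exact_mod_cast (by positivity))).trans ?_
  rw [← EReal.coe_mul]
  apply le_of_eq
  congr 1
  field_simp

end Main

theorem mainTheorem5 (d : ℕ) (hd : 2 ≤ d) (p : ℝ) (hp : 1 < p) :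
    ∃ C : ℝ, 0 < C ∧
      (∀ (Ω : Type*) [MeasurableSpace Ω] (P : Measure Ω) [IsProbabilityMeasure P]
        (H : Ω → Set (EuclideanSpace ℝ (Fin d))), IsPoissonPointProcess P H 1 →
        ∀ e : EuclideanSpace ℝ (Fin d), ‖e‖ = 1 →
          Tendsto (fun t : ℝ => (1 / t) * ∫ ω, shortestPathLength p 0 (t • e) (H ω) ∂P)
            atTop (𝓝 C)) ∧
      (∀ (z : EuclideanSpace ℝ (Fin d)) (R₁ R₂ : ℝ), 0 < R₁ → R₁ < R₂ →
        ∀ (α : ℝ), α = 1 / ((d : ℝ) + 2 * p) →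
        ∀ (f : EuclideanSpace ℝ (Fin d) → ℝ), f = uniformBallDensity z R₂ →
        ∀ (Ω : Type*) [MeasurableSpace Ω] (P : Measure Ω) [IsProbabilityMeasure P]
          (X : ℕ → Ω → EuclideanSpace ℝ (Fin d)), IsIIDWithDensity P X f →
        ∀ x y : ℕ → EuclideanSpace ℝ (Fin d),
          (∀ n, x n ∈ Metric.ball z R₁) → (∀ n, y n ∈ Metric.ball z R₁) →
          Tendsto (fun n : ℕ => ((n : ℝ) * f z) ^ α * dist (x n) (y n)) atTop atTop →
        ∀ ε : ℝ, 0 < ε →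
          limsup (fun n : ℕ =>
            ((1 / (((n : ℝ) * f z) ^ α * dist (x n) (y n)) : ℝ) : EReal) *
              ENNReal.log (1 - P {ω |
                |shortestPathLength p (x n) (y n) (sampleSet X n ω) /
                  (((n : ℝ) * f z) ^ ((1 - p) / (d : ℝ)) * dist (x n) (y n)) - C| ≤ ε}))
            atTop < 0) := by
  have hp0 : 0 < p := by linarith
  have hd1 : 1 ≤ d := by omega
  obtain ⟨e₀, he₀⟩ : ∃ e : Pt d, ‖e‖ = 1 := ⟨EuclideanSpace.single ⟨0, hd1⟩ 1, by simp⟩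
  obtain ⟨C, -, hC⟩ := exists_tendsto_meanLength_div hp hd1 he₀
  refine ⟨C, timeConstant_pos hp hd1 he₀ hC, ?_, ?_⟩
  · intro Ω _ P _ H hH e he
    refine hC.congr' ?_
    filter_upwards [eventually_ge_atTop 0] with t ht
    -- The limit was obtained for the direction `e₀`; isometry invariance of the Poisson law gives
    -- the same mean in every direction.
    rw [hH.integral_shortestPathLength hp0, div_eq_inv_mul, one_div,
      meanLength_congr hp0 ((dist_zero_smul he₀ ht).trans (dist_zero_smul he ht).symm)]
  · rintro z R₁ R₂ hR₁ hR α rfl f rfl Ω _ P _ X hX x y hx hy hxy ε hε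
    obtain ⟨c, hc, h⟩ := eventually_measure_scaledSample_le hp hd he₀ hC hR₁ hR hX hx hy hxy hε
    refine lt_of_le_of_lt (limsup_le_of_le (a := ((-c : ℝ) : EReal)) (by isBoundedDefault) ?_)
      (by exact_mod_cast neg_lt_zero.2 hc)
    filter_upwards [h, hxy.eventually_gt_atTop 0] with n hn h0
    refine inv_mul_log_le h0 ((one_sub_measure_le _).trans (ENNReal.ofReal_le_ofReal ?_))
    simpa only [Set.compl_ofPred, not_le] using hn
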